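/- **Setting.** Let $\{x,y\}=x^0y^0-x^1y^1-x^2y^2-x^3y^3$ on $\mathbb R^4$ and (bilinearly) on $\mathbb C^4$, let $P>0$, and let $\Gamma_P^+=\{p\in\mathbb R^4:\{p,p\}=P,\ p^0>0\}$, with the Lorentz invariant measure $d^3p/p^0$, and $\Gamma_P^{(c)}=\{\zeta\in\mathbb C^4:\{\zeta,\zeta\}=P\}$. Let $L_+^\uparrow$ be the proper orthochronous homogeneous Lorentz group, $\Lambda(\tau)$ $(\tau\in\mathbb C)$ the velocity transformation in $x^3$-direction given by $y^0=\cosh\tau\,x^0-\sinh\tau\,x^3$, $y^3=-\sinh\tau\,x^0+\cosh\tau\,x^3$, $y^1=x^1$, $y^2=x^2$, and $\Upsilon$ the rotation by $\pi$ around the $x^3$-axis. Let $W=\{x\in\mathbb R^4:x^3>|x^0|\}$ and $W_{(a,I)}=IW+a$ for $a\in\mathbb R^4$, $I\in L_+^\uparrow$. On $L^2(\Gamma_P^+)$ put $(U(a,I)\varphi)(p)=e^{i\{p,a\}}\varphi(I^{-1}p)$ and, for $L=(a,I)$, $$U_L(t)=U\big((1-I\Lambda(t)I^{-1})a,\ I\Lambda(t)I^{-1}\big)\quad(t\in\mathbb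 R),\qquad j_L\varphi=U\big((1+I\Upsilon I^{-1})a,\ I\Upsilon I^{-1}\big)\bar\varphi .$$ For $\tau\in\mathbb C$ let $U_L(\tau)=e^{-i\tau H}$ (where $U_L(t)=e^{-itH}$) be the analytic continuation of $U_L(t)$, i.e. the closed operator which is the closure of $\psi\mapsto U_L(\tau)\psi$ on the vectors $\psi$ for which $t\mapsto U_L(t)\psi$ extends to an entire function $\tau\mapsto U_L(\tau)\psi$. Let $K\subset\mathbb R^4$ be a region with vertices (extreme points) $a_1,\dots,a_n$ such that $K=\bigcap_{i=1}^n\bigcap_{I\in X_{K,a_i}}\overline{W}_{(a_i,I)}$, where each $X_{K,a_i}$ is a closed subset of $L_+^\uparrow$ with nonempty interior $X_{K,a_i}^\circ$, and let $$\mathcal H^R_{K,+}=\{\varphi\in L^2(\Gamma_P^+):\ \varphi\in D(U_L(i\pi)),\ j_LU_L(i\pi)\varphi=\varphi\ \text{ for all } L=(a_i,I),\ 1\le i\le n,\ I\in X_{K,a_i}\}.$$ For a vertex $a_i$ define $$M^+_{K,a_i}=\{\zeta\in\Gamma_P^{(c)}:\ \zeta=I\Lambda(\tau)^{-1}I^{-1}p,\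 p\in\Gamma_P^+,\ 0<\operatorname{Im}\tau<\pi,\ I\in X^\circ_{K,a_i}\},$$ $$\mathcal T^+_{K,a_i}=\mathbb R^4+i\,\{I\eta':\ I\in X^\circ_{K,a_i},\ \eta'\in\Gamma^+\},\qquad \Gamma^+=\{\eta\in\mathbb R^4:\ \eta^0-\eta^3<0<\eta^0+\eta^3,\ \eta^1=\eta^2=0\}.$$ **Lemma.** For every vertex $a_i$: 1. $M^+_{K,a_i}$ is an open subset of $\Gamma_P^{(c)}$, it equals $\Gamma_P^{(c)}\cap\mathcal T^+_{K,a_i}$, and it is a complex $3$-dimensional submanifold of $\mathbb C^4$. 2. Let $\varphi\in\mathcal H^R_{K,+}$. For all $L=(a_i,I)$ with $I\in X_{K,a_i}$ and all $\tau$ with $0\le\operatorname{Im}\tau\le\pi$ the vector $U_L(\tau)\varphi\in L^2(\Gamma_P^+)$ is defined (and unique), and $(I,\tau)\mapsto U_L(\tau)\varphi$ is continuous into $L^2(\Gamma_P^+)$ on $X_{K,a_i}\times\{0\le\operatorname{Im}\tau\le\pi\}$. 3. There is exactly one holomorphic function $u_{+,a_i}$ on $M^+_{K,a_i}$ such that for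 all $L=(a_i,I)$ with $I\in X^\circ_{K,a_i}$ and all $\tau$ with $0<\operatorname{Im}\tau<\pi$, $$(U_L(\tau)\varphi)(p)=e^{i\{p,a_i\}}\,u_{+,a_i}(\zeta),\qquad \zeta=I\Lambda(\tau)^{-1}I^{-1}p,\qquad\text{for almost every }p\in\Gamma_P^+ .$$ -/

import Mathlib

open MeasureTheory
open scoped Matrix

noncomputable section

/-! ### Minkowski space and the Lorentz group -/

/-- The Minkowski bilinear form `{x, y} = x⁰y⁰ - x¹y¹ - x²y² - x³y³`, over `ℝ` or over `ℂ`. -/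
def mink {R : Type*} [CommRing R] (x y : Fin 4 → R) : R :=
  x 0 * y 0 - x 1 * y 1 - x 2 * y 2 - x 3 * y 3

/-- The metric tensor `diag(1, -1, -1, -1)`. -/
def minkMetric : Matrix (Fin 4) (Fin 4) ℝ := Matrix.diagonal ![1, -1, -1, -1]

/-- The proper orthochronous homogeneous Lorentz group, with the topology of matrices. -/
abbrev ProperLorentz : Type :=
  {A : Matrix (Fin 4) (Fin 4) ℝ // Aᵀ * minkMetric * A = minkMetric ∧ A.det = 1 ∧ 0 < A 0 0}

/-- The velocity transformation `Λ(t)` in the `x³`-direction, for a real parameter. -/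
def boost (t : ℝ) : Matrix (Fin 4) (Fin 4) ℝ :=
  !![Real.cosh t, 0, 0, -Real.sinh t;
     0, 1, 0, 0;
     0, 0, 1, 0;
     -Real.sinh t, 0, 0, Real.cosh t]

/-- The velocity transformation `Λ(τ)` in the `x³`-direction, for a complex parameter. -/
def boostC (τ : ℂ) : Matrix (Fin 4) (Fin 4) ℂ :=
  !![Complex.cosh τ, 0, 0, -Complex.sinh τ;
     0, 1, 0, 0;
     0, 0, 1, 0;
     -Complex.sinh τ, 0, 0, Complex.cosh τ]

/-- The rotation `Υ` by `π` around the `x³`-axis. -/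
def rotPi : Matrix (Fin 4) (Fin 4) ℝ := Matrix.diagonal ![1, -1, -1, 1]

/-- The wedge `W = {x : x³ > |x⁰|}`. -/
def wedge : Set (Fin 4 → ℝ) := {x | |x 0| < x 3}

/-- The transformed wedge `W_L`, `L = (a, A)`, the image of `W` under `x ↦ A x + a`. -/
def wedgeAt (a : Fin 4 → ℝ) (A : ProperLorentz) : Set (Fin 4 → ℝ) :=
  (fun x => A.1 *ᵥ x + a) '' wedge

/-- A closed region `K` with vertices `a_i`, `i = 1, …, n`, that is the intersection of
closed wedges `closure W_{(a_i, A)}`, `A ∈ X_{K, a_i}`, where each `X_{K, a_i}` is a nonempty closed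
subset of full dimension six of the proper orthochronous homogeneous Lorentz group. -/
structure PolyhedralRegion where
  /-- the region `K` -/
  carrier : Set (Fin 4 → ℝ)
  /-- the number of vertices -/
  n : ℕ
  /-- the vertices `a_i` -/
  vertex : Fin n → (Fin 4 → ℝ)
  /-- the sets `X_{K, a_i}` -/
  X : Fin n → Set ProperLorentz
  carrier_eq : carrier = ⋂ i, ⋂ A ∈ X i, closure (wedgeAt (vertex i) A)
  vertex_extreme : ∀ i, vertex i ∈ carrier.extremePoints ℝ
  X_closed : ∀ i, IsClosed (X i)
  X_full : ∀ i, (interior (X i)).Nonempty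

/-! ### The mass shell, its complexification, and the sets `M⁺` and `T⁺` -/

/-- The mass hyperboloid `Γ_P⁺`. -/
def massShell (P : ℝ) : Set (Fin 4 → ℝ) := {p | mink p p = P ∧ 0 < p 0}

/-- The complex mass hyperboloid `Γ_P^{(c)}`. -/
def complexMassShell (P : ℝ) : Set (Fin 4 → ℂ) := {ζ | mink ζ ζ = (P : ℂ)}

/-- The point `ζ = A Λ(τ)⁻¹ A⁻¹ p`. -/
def zetaPoint (A : ProperLorentz) (τ : ℂ) (p : Fin 4 → ℝ) : Fin 4 → ℂ :=
  (A.1.map Complex.ofReal * (boostC τ)⁻¹ * (A.1.map Complex.ofReal)⁻¹) *ᵥ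
    fun k => (p k : ℂ)

/-- The set `M⁺` belonging to the vertex `a_i`; the interior of `X_{K, a_i}` is taken in the
homogeneous Lorentz group. -/
def Mplus (P : ℝ) (K : PolyhedralRegion) (i : Fin K.n) : Set (Fin 4 → ℂ) :=
  {ζ | ζ ∈ complexMassShell P ∧ ∃ A ∈ interior (K.X i), ∃ τ : ℂ, ∃ p ∈ massShell P,
    0 < τ.im ∧ τ.im < Real.pi ∧ ζ = zetaPoint A τ p}

/-- `Γ⁺ = {η : η⁻ < 0, η⁺ > 0, η¹ = η² = 0}` with the light cone coordinates `η^± = η⁰ ± η³`. -/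
def GammaPlus : Set (Fin 4 → ℝ) := {η | η 0 - η 3 < 0 ∧ 0 < η 0 + η 3 ∧ η 1 = 0 ∧ η 2 = 0}

/-- `Γ⁺_{K, a_i}`, the union of the sets `A Γ⁺` over `A` in the interior of `X_{K, a_i}`. -/
def GammaPlusK (K : PolyhedralRegion) (i : Fin K.n) : Set (Fin 4 → ℝ) :=
  {η | ∃ A ∈ interior (K.X i), ∃ η' ∈ GammaPlus, η = A.1 *ᵥ η'}

/-- The tube `T⁺_{K, a_i} = ℝ⁴ + i Γ⁺_{K, a_i}`. -/
def Tplus (K : PolyhedralRegion) (i : Fin K.n) : Set (Fin 4 → ℂ) :=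
  {ζ | (fun k => (ζ k).im) ∈ GammaPlusK K i}

/-! ### The representation of mass `P` and spin zero -/

/-- The Lorentz invariant measure `d³p / p⁰` on the mass hyperboloid, as a measure on `ℝ⁴`
concentrated on `massShell P`. -/
def massShellMeasure (P : ℝ) : Measure (Fin 4 → ℝ) :=
  ((volume : Measure (Fin 3 → ℝ)).withDensity
      (fun k => ENNReal.ofReal (1 / √(P + ∑ j, k j ^ 2)))).map
    (fun k => Fin.cons (√(P + ∑ j, k j ^ 2)) k)

/-- The Hilbert space `L²(Γ_P⁺)`. -/
abbrev L2Shell (P : ℝ) : Type := Lp ℂ 2 (massShellMeasure P)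

open Classical in
/-- The class in `L²(Γ_P⁺)` of a square integrable function. It is applied below only to functions
obtained from elements of `L²` by a Lorentz transformation of the argument, a factor of modulus one
and complex conjugation, which are square integrable as the measure is Lorentz invariant. -/
def toL2 (P : ℝ) (g : (Fin 4 → ℝ) → ℂ) : L2Shell P :=
  if h : MemLp g 2 (massShellMeasure P) then h.toLp g else 0

/-- `U(a, B) φ(p) = e^{i{p, a}} φ(B⁻¹ p)`. -/
def poincareRep (P : ℝ) (a : Fin 4 → ℝ) (B : Matrix (Fin 4) (Fin 4) ℝ) (φ : L2Shell P) :
    L2Shell P :=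
  toL2 P fun p => Complex.exp (Complex.I * (mink p a : ℝ)) * φ (B⁻¹ *ᵥ p)

/-- The antiunitary transformation `Θ φ(p) = conj (φ(p))`. -/
def pct (P : ℝ) (φ : L2Shell P) : L2Shell P :=
  toL2 P fun p => (starRingEnd ℂ) (φ p)

/-- The one-parameter group `U_L(t) = U((1 - A Λ(t) A⁻¹) a, A Λ(t) A⁻¹)`, `L = (a, A)`. -/
def boostRep (P : ℝ) (a : Fin 4 → ℝ) (A : ProperLorentz) (t : ℝ) (φ : L2Shell P) : L2Shell P :=
  poincareRep P ((1 - A.1 * boost t * A.1⁻¹) *ᵥ a) (A.1 * boost t * A.1⁻¹) φ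

/-- The antiunitary involution `j_L = T((1 + A Υ A⁻¹) a) d(A Υ A⁻¹) Θ`, `L = (a, A)`. -/
def modularConj (P : ℝ) (a : Fin 4 → ℝ) (A : ProperLorentz) (φ : L2Shell P) : L2Shell P :=
  poincareRep P ((1 + A.1 * rotPi * A.1⁻¹) *ᵥ a) (A.1 * rotPi * A.1⁻¹) (pct P φ)

/-- The graph of the closed operator `U(τ)`, `τ ∈ ℂ`, for a one-parameter unitary group `U(t)`: the
closure of the graph of `ψ ↦ U(τ) ψ` on the vectors `ψ` whose orbit `t ↦ U(t) ψ` extends to an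
entire function `τ ↦ U(τ) ψ`. -/
def complexGroupGraph {H : Type*} [NormedAddCommGroup H] [NormedSpace ℂ H]
    (U : ℝ → H → H) (τ : ℂ) : Set (H × H) :=
  closure {x | ∃ f : ℂ → H, Differentiable ℂ f ∧ (∀ t : ℝ, f t = U t x.1) ∧ f τ = x.2}

/-- The real subspace `H^R_{K,+}` of all `φ` with `s_{L,+} φ = φ` for all `L = (a_i, A)`,
`A ∈ X_{K, a_i}`, where `s_{L,+} = j_L U_L(iπ)`; this includes that `φ` is in the domain. -/
def HRplus (P : ℝ) (K : PolyhedralRegion) : Set (L2Shell P) :=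
  {φ | ∀ i, ∀ A ∈ K.X i, ∃ χ,
    (φ, χ) ∈ complexGroupGraph (boostRep P (K.vertex i) A) (Complex.I * Real.pi) ∧
      modularConj P (K.vertex i) A χ = φ}

/-! ### Complex submanifolds -/

/-- `M` is a (locally closed, embedded) complex submanifold of `ℂⁿ` of dimension `d`: around each of
its points there is a biholomorphic chart of `ℂⁿ` in which `M` is given by the vanishing of the
coordinates with index at least `d`. -/
def IsComplexSubmanifold {n : ℕ} (d : ℕ) (M : Set (Fin n → ℂ)) : Prop :=
  d ≤ n ∧ ∀ ζ ∈ M, ∃ e : OpenPartialHomeomorph (Fin n → ℂ) (Fin n → ℂ),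
    ζ ∈ e.source ∧ DifferentiableOn ℂ e e.source ∧ DifferentiableOn ℂ e.symm e.target ∧
      ∀ z ∈ e.source, z ∈ M ↔ ∀ j : Fin n, d ≤ (j : ℕ) → e z j = 0

/-- A function on a complex submanifold `M` of `ℂⁿ` is holomorphic if it is locally the restriction
of a holomorphic function on an open subset of `ℂⁿ`. -/
def IsHolomorphicOnSubmanifold {n : ℕ} (M : Set (Fin n → ℂ)) (v : M → ℂ) : Prop :=
  ∀ ζ : M, ∃ (O : Set (Fin n → ℂ)) (G : (Fin n → ℂ) → ℂ), IsOpen O ∧ (ζ : Fin n → ℂ) ∈ O ∧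
    DifferentiableOn ℂ G O ∧ ∀ z : M, (z : Fin n → ℂ) ∈ O → v z = G z

end

noncomputable section

/-! ### The Lorentz group as a topological group -/

/-! Light-cone coordinates turn everything about boosts into scalings. Where `w = z⁰ - z³ ≠ 0`, a
point with `{z, z} = P` is determined by `(w, z¹, z²)`; the boost `Λ(τ)` multiplies `w` by `e^τ` and
fixes `z¹, z²`. Hence in the frame `A` the points `ζ = A Λ(τ)⁻¹ A⁻¹ p` with `0 < Im τ < π` are those
with real transverse coordinates and `w` in the open lower half plane, which is the tube condition
(`Mplus_eq`). A real null rotation shifts `z¹, z²` by real multiples of `w`. As `w` is not real, a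
neighbouring point with complex transverse coordinates is reached from a frame that differs from `A`
by a small null rotation (`chartPoint_eq`). This gives openness, and `(w, z¹, z², {z, z} - P)` is a
submanifold chart.

For the continuity in the frame, the phase `e^{i{p, a}}` is split off, which moves the vertex to the
origin. The condition `j_L U_L(iπ) φ = φ` determines the boundary value at `Im τ = π` as `j_L φ`, so
both boundary values of the continued orbit depend continuously on the frame. The three lines
theorem with a Gaussian factor carries this into the strip (`exists_boostExtension`,
`continuousOn_strip_of_boundary`).

For the holomorphic function, let `F A τ` be the continued orbit without the phase. It is tested
against the exponentials `e^{-{z, q}}`. By Lorentz covariance `τ ↦ laplace (F A τ) (A Λ(τ) A⁻¹ z)`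
is invariant under real shifts, and since it is holomorphic it is locally constant. At `τ = 0` it is
the Laplace transform of one vector for all frames. Analytic continuation along paths of angles then
shows that `laplace (F A τ) (c p)` depends only on `c` and the complex point `ζ`
(`laplace_eq_of_zetaPoint`).

Normalised, `q ↦ e^{-c{p, q}}` is an approximate identity on the mass shell as `c → ∞`, uniformly on
compact sets of `L²` vectors (`eventually_meanOscillation_le`). In a chart the smoothings are
holomorphic. Their differences are small in `L²` on every slice that is a copy of the mass shell,
hence small in `L²` of the chart; the mean value inequality gives locally uniform convergence
(`exists_uniformCauchySeqOn_chartLaplace`). The limit is holomorphic, does not depend on the chart,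
and agrees almost everywhere with `F A τ`. Uniqueness holds because the invariant measure has full
support and the images of the mass shell cover `M⁺`. -/

theorem mink_comm {R : Type*} [CommRing R] (x y : Fin 4 → R) : mink x y = mink y x := by
  simp only [mink]; ring

theorem mink_add_left {R : Type*} [CommRing R] (x y z : Fin 4 → R) :
    mink (x + y) z = mink x z + mink y z := by
  simp only [mink, Pi.add_apply]; ring

theorem mink_smul_left {R : Type*} [CommRing R] (c : R) (x z : Fin 4 → R) :
    mink (c • x) z = c * mink x z := by
  simp only [mink, Pi.smul_apply, smul_eq_mul]; ring

theorem mink_smul_right {R : Type*} [CommRing R] (c : R) (x z : Fin 4 → R) :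
    mink x (c • z) = c * mink x z := by
  simp only [mink, Pi.smul_apply, smul_eq_mul]; ring

theorem mink_sub_right {R : Type*} [CommRing R] (x y z : Fin 4 → R) :
    mink x (y - z) = mink x y - mink x z := by
  simp only [mink, Pi.sub_apply]; ring

theorem mink_add_right {R : Type*} [CommRing R] (x y z : Fin 4 → R) :
    mink x (y + z) = mink x y + mink x z := by
  simp only [mink, Pi.add_apply]; ring

/-- The metric tensor over an arbitrary ring. -/
def metricTensor (R : Type*) [CommRing R] : Matrix (Fin 4) (Fin 4) R :=
  Matrix.diagonal ![1, -1, -1, -1]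

theorem mink_eq_dotProduct {R : Type*} [CommRing R] (x y : Fin 4 → R) :
    mink x y = x ⬝ᵥ (metricTensor R *ᵥ y) := by
  simp only [mink, metricTensor, dotProduct, Matrix.mulVec_diagonal, Fin.sum_univ_four,
    Matrix.cons_val_zero, Matrix.cons_val_one, Matrix.cons_val]
  ring

theorem mink_mulVec_mulVec {R : Type*} [CommRing R] {A : Matrix (Fin 4) (Fin 4) R}
    (hA : Aᵀ * metricTensor R * A = metricTensor R) (x y : Fin 4 → R) :
    mink (A *ᵥ x) (A *ᵥ y) = mink x y := by
  rw [mink_eq_dotProduct, mink_eq_dotProduct, Matrix.mulVec_mulVec, ← Matrix.vecMul_transpose,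
    ← Matrix.dotProduct_mulVec, Matrix.mulVec_mulVec, ← Matrix.mul_assoc, hA]

theorem metricTensor_mul_self (R : Type*) [CommRing R] :
    metricTensor R * metricTensor R = 1 := by
  rw [metricTensor, Matrix.diagonal_mul_diagonal, ← Matrix.diagonal_one]
  congr 1
  ext i
  fin_cases i <;> simp

theorem metricTensor_real : metricTensor ℝ = minkMetric := rfl

/-- The open forward light cone. -/
def forwardCone : Set (Fin 4 → ℝ) := {x | 0 < mink x x ∧ 0 < x 0}

/-- Two vectors of the forward cone have a positive Minkowski product. -/
theorem spatial_lt_of_cone {x y : Fin 4 → ℝ} (hx : x ∈ forwardCone) (hy : y ∈ forwardCone) :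
    0 < x 0 * y 0 - |x 1 * y 1 + x 2 * y 2 + x 3 * y 3| := by
  obtain ⟨h1, h2⟩ := hx
  obtain ⟨h3, h4⟩ := hy
  simp only [mink] at h1 h3
  have cs : (x 1 * y 1 + x 2 * y 2 + x 3 * y 3) ^ 2
      ≤ (x 1 ^ 2 + x 2 ^ 2 + x 3 ^ 2) * (y 1 ^ 2 + y 2 ^ 2 + y 3 ^ 2) := by
    -- Lagrange's identity: the two sides differ by the sum of these squares.
    nlinarith [sq_nonneg (x 1 * y 2 - x 2 * y 1), sq_nonneg (x 1 * y 3 - x 3 * y 1),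
      sq_nonneg (x 2 * y 3 - x 3 * y 2)]
  have : (x 1 ^ 2 + x 2 ^ 2 + x 3 ^ 2) * (y 1 ^ 2 + y 2 ^ 2 + y 3 ^ 2)
      < (x 0 * y 0) ^ 2 := by
    have e1 : x 1 ^ 2 + x 2 ^ 2 + x 3 ^ 2 < x 0 ^ 2 := by nlinarith
    have e2 : y 1 ^ 2 + y 2 ^ 2 + y 3 ^ 2 < y 0 ^ 2 := by nlinarith
    rw [mul_pow]
    exact mul_lt_mul'' e1 e2 (by positivity) (by positivity)
  have := abs_lt_of_sq_lt_sq (lt_of_le_of_lt cs this) (by positivity)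
  linarith

theorem massShell_subset_forwardCone {P : ℝ} (hP : 0 < P) : massShell P ⊆ forwardCone :=
  fun _ hp => ⟨by rw [hp.1]; exact hP, hp.2⟩

/-- The relation defining the proper orthochronous Lorentz group. -/
def IsProperLorentz (A : Matrix (Fin 4) (Fin 4) ℝ) : Prop :=
  Aᵀ * minkMetric * A = minkMetric ∧ A.det = 1 ∧ 0 < A 0 0

/-- The defining relation says that `minkMetric * Aᵀ * minkMetric` is a left inverse of `A`, hence
also a right inverse. So the rows are orthonormal for the metric just as the columns are. -/
theorem lorentz_mul_transpose {A : Matrix (Fin 4) (Fin 4) ℝ}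
    (hA : Aᵀ * minkMetric * A = minkMetric) : A * minkMetric * Aᵀ = minkMetric := by
  have h := metricTensor_mul_self ℝ
  rw [metricTensor_real] at h
  have h1 : minkMetric * Aᵀ * minkMetric * A = 1 := by
    rw [Matrix.mul_assoc, Matrix.mul_assoc, ← Matrix.mul_assoc Aᵀ, hA, h]
  have h2 : A * (minkMetric * Aᵀ * minkMetric) = 1 := mul_eq_one_comm.1 h1
  calc A * minkMetric * Aᵀ = A * minkMetric * Aᵀ * (minkMetric * minkMetric) := by
        rw [h, Matrix.mul_one]
    _ = (A * (minkMetric * Aᵀ * minkMetric)) * minkMetric := by simp only [Matrix.mul_assoc]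
    _ = minkMetric := by rw [h2, Matrix.one_mul]

theorem lorentz_inv_eq {A : Matrix (Fin 4) (Fin 4) ℝ}
    (hA : Aᵀ * minkMetric * A = minkMetric) : A⁻¹ = minkMetric * Aᵀ * minkMetric := by
  have h := metricTensor_mul_self ℝ
  rw [metricTensor_real] at h
  apply Matrix.inv_eq_left_inv
  rw [Matrix.mul_assoc, Matrix.mul_assoc, ← Matrix.mul_assoc Aᵀ, hA, h]

/-- The first row of a proper Lorentz matrix, up to the metric, is a forward time-like vector. -/
theorem mulVec_zero_pos {A : Matrix (Fin 4) (Fin 4) ℝ}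
    (hA : Aᵀ * minkMetric * A = minkMetric) (h0 : 0 < A 0 0) {x : Fin 4 → ℝ}
    (hx : x ∈ forwardCone) : 0 < (A *ᵥ x) 0 := by
  have hr := congrFun (congrFun (lorentz_mul_transpose hA) 0) 0
  have hc : (fun j => A 0 j) ∈ forwardCone := by
    refine ⟨?_, h0⟩
    simp [minkMetric, Matrix.mul_apply, Fin.sum_univ_four, Matrix.diagonal_apply] at hr
    simp only [mink]
    linarith
  -- In `(A x)⁰` the spatial part enters with a plus sign; the absolute value in the lemma covers
  -- both signs.
  have := spatial_lt_of_cone hc hx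
  have := neg_abs_le (A 0 1 * x 1 + A 0 2 * x 2 + A 0 3 * x 3)
  simp only [Matrix.mulVec, dotProduct, Fin.sum_univ_four]
  linarith

theorem IsProperLorentz.mulVec_mem_forwardCone {A : Matrix (Fin 4) (Fin 4) ℝ}
    (hA : IsProperLorentz A) {x : Fin 4 → ℝ} (hx : x ∈ forwardCone) : A *ᵥ x ∈ forwardCone :=
  ⟨by rw [mink_mulVec_mulVec hA.1]; exact hx.1, mulVec_zero_pos hA.1 hA.2.2 hx⟩

theorem IsProperLorentz.mul {A B : Matrix (Fin 4) (Fin 4) ℝ}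
    (hA : IsProperLorentz A) (hB : IsProperLorentz B) : IsProperLorentz (A * B) := by
  refine ⟨?_, by rw [Matrix.det_mul, hA.2.1, hB.2.1, one_mul], ?_⟩
  · rw [Matrix.transpose_mul]
    calc Bᵀ * Aᵀ * minkMetric * (A * B) = Bᵀ * (Aᵀ * minkMetric * A) * B := by
          simp only [Matrix.mul_assoc]
      _ = minkMetric := by rw [hA.1, hB.1]
  · have h1 : (Pi.single 0 1 : Fin 4 → ℝ) ∈ forwardCone := by simp [forwardCone, mink]
    -- The entry `(A B)₀₀` is the time component of `A B e₀`, and `e₀` lies in the forward cone.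
    have h2 := (hA.mulVec_mem_forwardCone (hB.mulVec_mem_forwardCone h1)).2
    rwa [Matrix.mulVec_mulVec, Matrix.mulVec_single_one] at h2

theorem IsProperLorentz.inv {A : Matrix (Fin 4) (Fin 4) ℝ}
    (hA : IsProperLorentz A) : IsProperLorentz A⁻¹ := by
  have hu : IsUnit A.det := by rw [hA.2.1]; exact isUnit_one
  refine ⟨?_, by rw [Matrix.det_nonsing_inv, hA.2.1, Ring.inverse_one], ?_⟩
  · have h := hA.1
    calc (A⁻¹)ᵀ * minkMetric * A⁻¹ = (A⁻¹)ᵀ * (Aᵀ * minkMetric * A) * A⁻¹ := by rw [h]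
      _ = (A * A⁻¹)ᵀ * minkMetric * (A * A⁻¹) := by
          rw [Matrix.transpose_mul]; simp only [Matrix.mul_assoc]
      _ = minkMetric := by rw [Matrix.mul_nonsing_inv _ hu]; simp
  · rw [lorentz_inv_eq hA.1]
    simpa [minkMetric] using hA.2.2

theorem isProperLorentz_one : IsProperLorentz 1 := by
  refine ⟨by simp, by simp, by simp⟩

instance : Group ProperLorentz where
  mul A B := ⟨A.1 * B.1, IsProperLorentz.mul A.2 B.2⟩
  one := ⟨1, isProperLorentz_one⟩
  inv A := ⟨A.1⁻¹, IsProperLorentz.inv A.2⟩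
  mul_assoc A B C := Subtype.ext (Matrix.mul_assoc _ _ _)
  one_mul A := Subtype.ext (Matrix.one_mul _)
  mul_one A := Subtype.ext (Matrix.mul_one _)
  inv_mul_cancel A := Subtype.ext (Matrix.nonsing_inv_mul _ (by rw [A.2.2.1]; exact isUnit_one))

theorem lorentz_coe_mul (A B : ProperLorentz) : (A * B).1 = A.1 * B.1 := rfl
theorem lorentz_coe_inv (A : ProperLorentz) : (A⁻¹).1 = A.1⁻¹ := rfl
theorem lorentz_coe_one : (1 : ProperLorentz).1 = 1 := rfl

instance : IsTopologicalGroup ProperLorentz where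
  continuous_mul := by
    refine Continuous.subtype_mk (Continuous.matrix_mul ?_ ?_) _
    · exact continuous_subtype_val.comp continuous_fst
    · exact continuous_subtype_val.comp continuous_snd
  continuous_inv := by
    refine Continuous.subtype_mk ?_ _
    have : (fun A : ProperLorentz => A.1⁻¹) =
        fun A : ProperLorentz => minkMetric * A.1ᵀ * minkMetric := by
      ext1 A; exact lorentz_inv_eq A.2.1
    rw [this]
    fun_prop

theorem lorentz_mulVec_mulVec (A B : ProperLorentz) (x : Fin 4 → ℝ) :
    A.1 *ᵥ (B.1 *ᵥ x) = (A * B).1 *ᵥ x := by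
  rw [Matrix.mulVec_mulVec, lorentz_coe_mul]

theorem lorentz_mink (A : ProperLorentz) (x y : Fin 4 → ℝ) :
    mink (A.1 *ᵥ x) (A.1 *ᵥ y) = mink x y := mink_mulVec_mulVec A.2.1 x y

theorem lorentz_mem_massShell (A : ProperLorentz) {P : ℝ} (hP : 0 < P) {p : Fin 4 → ℝ}
    (hp : p ∈ massShell P) : A.1 *ᵥ p ∈ massShell P :=
  ⟨by rw [lorentz_mink]; exact hp.1,
    (IsProperLorentz.mulVec_mem_forwardCone A.2 (massShell_subset_forwardCone hP hp)).2⟩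

theorem lorentz_mem_forwardCone (A : ProperLorentz) {x : Fin 4 → ℝ}
    (hx : x ∈ forwardCone) : A.1 *ᵥ x ∈ forwardCone :=
  IsProperLorentz.mulVec_mem_forwardCone A.2 hx

/-! ### Complexified Lorentz transformations -/

/-- A real vector as a complex vector. -/
def toC (p : Fin 4 → ℝ) : Fin 4 → ℂ := fun k => (p k : ℂ)

/-- The real part of a complex vector. -/
def reV (z : Fin 4 → ℂ) : Fin 4 → ℝ := fun k => (z k).re

/-- The imaginary part of a complex vector. -/
def imV (z : Fin 4 → ℂ) : Fin 4 → ℝ := fun k => (z k).im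

/-- A real Lorentz transformation as a complex matrix. -/
def lorentzC (A : ProperLorentz) : Matrix (Fin 4) (Fin 4) ℂ := A.1.map Complex.ofReal

theorem lorentzC_mul (A B : ProperLorentz) : lorentzC (A * B) = lorentzC A * lorentzC B := by
  rw [lorentzC, lorentz_coe_mul]
  exact Matrix.map_mul (f := Complex.ofRealHom)

theorem lorentzC_one : lorentzC 1 = 1 := by
  rw [lorentzC, lorentz_coe_one]
  exact Matrix.map_one _ Complex.ofReal_zero Complex.ofReal_one

theorem lorentzC_inv_mul (A : ProperLorentz) : lorentzC A⁻¹ * lorentzC A = 1 := by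
  rw [← lorentzC_mul, inv_mul_cancel, lorentzC_one]

theorem lorentzC_mul_inv (A : ProperLorentz) : lorentzC A * lorentzC A⁻¹ = 1 := by
  rw [← lorentzC_mul, mul_inv_cancel, lorentzC_one]

theorem lorentzC_inv (A : ProperLorentz) : (lorentzC A)⁻¹ = lorentzC A⁻¹ :=
  Matrix.inv_eq_left_inv (lorentzC_inv_mul A)

theorem lorentzC_mulVec_toC (A : ProperLorentz) (p : Fin 4 → ℝ) :
    lorentzC A *ᵥ toC p = toC (A.1 *ᵥ p) := by
  ext k
  simp [lorentzC, toC, Matrix.mulVec, dotProduct]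

theorem reV_lorentzC (A : ProperLorentz) (z : Fin 4 → ℂ) :
    reV (lorentzC A *ᵥ z) = A.1 *ᵥ reV z := by
  ext k
  simp [lorentzC, reV, Matrix.mulVec, dotProduct]

theorem imV_lorentzC (A : ProperLorentz) (z : Fin 4 → ℂ) :
    imV (lorentzC A *ᵥ z) = A.1 *ᵥ imV z := by
  ext k
  simp [lorentzC, imV, Matrix.mulVec, dotProduct]

theorem reV_toC (p : Fin 4 → ℝ) : reV (toC p) = p := by ext k; simp [reV, toC]

theorem mink_toC (p q : Fin 4 → ℝ) : mink (toC p) (toC q) = (mink p q : ℝ) := by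
  simp [mink, toC]

theorem lorentzC_mink (A : ProperLorentz) (z w : Fin 4 → ℂ) :
    mink (lorentzC A *ᵥ z) (lorentzC A *ᵥ w) = mink z w := by
  apply mink_mulVec_mulVec
  have h := congrArg (fun M : Matrix (Fin 4) (Fin 4) ℝ => M.map Complex.ofRealHom) A.2.1
  simp only [Matrix.map_mul] at h
  have hm : minkMetric.map Complex.ofRealHom = metricTensor ℂ := by
    rw [minkMetric, metricTensor, Matrix.diagonal_map (by simp)]
    congr 1; ext i; fin_cases i <;> simp
  rw [hm, Matrix.transpose_map] at h
  exact h

theorem boostC_add (σ τ : ℂ) : boostC (σ + τ) = boostC σ * boostC τ := by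
  ext i j
  fin_cases i <;> fin_cases j <;>
    simp [boostC, Matrix.mul_apply, Fin.sum_univ_four, Complex.cosh_add, Complex.sinh_add] <;> ring

theorem boostC_zero : boostC 0 = 1 := by
  ext i j
  fin_cases i <;> fin_cases j <;> simp [boostC]

theorem boostC_inv (τ : ℂ) : (boostC τ)⁻¹ = boostC (-τ) := by
  apply Matrix.inv_eq_left_inv
  rw [← boostC_add, neg_add_cancel, boostC_zero]

theorem boostC_mink (τ : ℂ) (z w : Fin 4 → ℂ) :
    mink (boostC τ *ᵥ z) (boostC τ *ᵥ w) = mink z w := by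
  have h := Complex.cosh_sq_sub_sinh_sq τ
  simp only [mink, boostC, Matrix.mulVec, dotProduct, Fin.sum_univ_four, Matrix.of_apply,
    Matrix.cons_val_zero, Matrix.cons_val_one, Matrix.cons_val, Matrix.cons_val']
  linear_combination (z 0 * w 0 - z 3 * w 3) * h

theorem isProperLorentz_boost (t : ℝ) : IsProperLorentz (boost t) := by
  have h := Real.cosh_sq_sub_sinh_sq t
  refine ⟨?_, ?_, ?_⟩
  · ext i j
    fin_cases i <;> fin_cases j <;>
      simp [boost, minkMetric, Matrix.mul_apply, Fin.sum_univ_four, Matrix.diagonal_apply] <;>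
      linarith
  · simp [boost, Matrix.det_succ_row_zero, Fin.sum_univ_succ, Fin.succAbove]
    linarith
  · simpa [boost] using Real.cosh_pos t

/-- The velocity transformation as an element of the Lorentz group. -/
def boostL (t : ℝ) : ProperLorentz := ⟨boost t, isProperLorentz_boost t⟩

theorem lorentzC_boostL (t : ℝ) : lorentzC (boostL t) = boostC t := by
  ext i j
  fin_cases i <;> fin_cases j <;> simp [lorentzC, boostL, boost, boostC]

theorem lorentzC_injective : Function.Injective lorentzC := by
  intro A B h
  apply Subtype.ext
  ext i j
  have := congrFun (congrFun h i) j
  simpa [lorentzC] using this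

theorem boostL_add (s t : ℝ) : boostL (s + t) = boostL s * boostL t := by
  apply lorentzC_injective
  rw [lorentzC_mul, lorentzC_boostL, lorentzC_boostL, lorentzC_boostL, Complex.ofReal_add,
    boostC_add]

theorem boostL_zero : boostL 0 = 1 := by
  apply lorentzC_injective
  rw [lorentzC_boostL, lorentzC_one, Complex.ofReal_zero, boostC_zero]

theorem boostL_inv (t : ℝ) : (boostL t)⁻¹ = boostL (-t) := by
  rw [inv_eq_iff_mul_eq_one, ← boostL_add, add_neg_cancel, boostL_zero]

/-- The one-parameter group `A Λ(t) A⁻¹`. -/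
def boostConj (A : ProperLorentz) (t : ℝ) : ProperLorentz := A * boostL t * A⁻¹

/-- The complexified one-parameter group `A Λ(τ) A⁻¹`. -/
def boostAt (A : ProperLorentz) (τ : ℂ) : Matrix (Fin 4) (Fin 4) ℂ :=
  lorentzC A * boostC τ * lorentzC A⁻¹

theorem zetaPoint_eq (A : ProperLorentz) (τ : ℂ) (p : Fin 4 → ℝ) :
    zetaPoint A τ p = boostAt A (-τ) *ᵥ toC p := by
  rw [zetaPoint, boostAt, ← lorentzC_inv, ← boostC_inv]; rfl

theorem boostAt_ofReal (A : ProperLorentz) (t : ℝ) : boostAt A t = lorentzC (boostConj A t) := by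
  rw [boostConj, lorentzC_mul, lorentzC_mul, lorentzC_boostL, boostAt]

theorem boostAt_add (A : ProperLorentz) (σ τ : ℂ) :
    boostAt A (σ + τ) = boostAt A σ * boostAt A τ := by
  rw [boostAt, boostAt, boostAt, boostC_add]
  calc _ = lorentzC A * boostC σ * 1 * (boostC τ * lorentzC A⁻¹) := by
        simp only [Matrix.mul_assoc, Matrix.mul_one]
    _ = _ := by rw [← lorentzC_inv_mul A]; simp only [Matrix.mul_assoc]

theorem boostAt_zero (A : ProperLorentz) : boostAt A 0 = 1 := by
  rw [boostAt, boostC_zero, Matrix.mul_one, lorentzC_mul_inv]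

theorem boostAt_mulVec_add (A : ProperLorentz) (σ τ : ℂ) (z : Fin 4 → ℂ) :
    boostAt A σ *ᵥ (boostAt A τ *ᵥ z) = boostAt A (σ + τ) *ᵥ z := by
  rw [Matrix.mulVec_mulVec, boostAt_add]

theorem boostAt_mink (A : ProperLorentz) (τ : ℂ) (z w : Fin 4 → ℂ) :
    mink (boostAt A τ *ᵥ z) (boostAt A τ *ᵥ w) = mink z w := by
  simp only [boostAt, ← Matrix.mulVec_mulVec, lorentzC_mink, boostC_mink]

/-- Boosts along one axis commute, so the frame may be changed by a factor `boostL t` at no cost.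
`laplace_eq_of_imag` uses this freedom to make the third component of a momentum vanish. -/
theorem boostAt_mul_boostL (A : ProperLorentz) (t : ℝ) (τ : ℂ) :
    boostAt (A * boostL t) τ = boostAt A τ := by
  rw [boostAt, boostAt, mul_inv_rev, lorentzC_mul, lorentzC_mul, boostL_inv, lorentzC_boostL,
    lorentzC_boostL]
  calc _ = lorentzC A * (boostC t * boostC τ * boostC ((-t : ℝ) : ℂ)) * lorentzC A⁻¹ := by
        simp only [Matrix.mul_assoc]
    _ = _ := by rw [← boostC_add, ← boostC_add]; congr 3; push_cast; ring

theorem boostConj_add (A : ProperLorentz) (s t : ℝ) :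
    boostConj A (s + t) = boostConj A s * boostConj A t := by
  rw [boostConj, boostConj, boostConj, boostL_add]; group

theorem boostConj_zero (A : ProperLorentz) : boostConj A 0 = 1 := by
  rw [boostConj, boostL_zero]; group

theorem continuous_boostL : Continuous boostL := by
  refine Continuous.subtype_mk ?_ _
  refine continuous_matrix fun i j => ?_
  fin_cases i <;> fin_cases j <;> simp [boost] <;> fun_prop

theorem continuous_boostConj : Continuous fun x : ProperLorentz × ℝ => boostConj x.1 x.2 :=
  (continuous_fst.mul (continuous_boostL.comp continuous_snd)).mul continuous_fst.inv

theorem differentiable_boostC_mulVec (z : Fin 4 → ℂ) :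
    Differentiable ℂ fun τ => boostC τ *ᵥ z := by
  rw [differentiable_pi]
  intro i
  fin_cases i <;>
    simp [boostC, Matrix.mulVec, dotProduct, Fin.sum_univ_four]

theorem differentiable_mulVec (M : Matrix (Fin 4) (Fin 4) ℂ) :
    Differentiable ℂ fun z : Fin 4 → ℂ => M *ᵥ z :=
  (Matrix.mulVecLin M).toContinuousLinearMap.differentiable

theorem differentiable_boostAt_mulVec (A : ProperLorentz) (z : Fin 4 → ℂ) :
    Differentiable ℂ fun τ => boostAt A τ *ᵥ z := by
  have : (fun τ => boostAt A τ *ᵥ z) =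
      (fun z => lorentzC A *ᵥ z) ∘ fun τ => boostC τ *ᵥ (lorentzC A⁻¹ *ᵥ z) := by
    ext1 τ; simp [boostAt, Matrix.mulVec_mulVec, Matrix.mul_assoc]
  rw [this]
  exact (differentiable_mulVec _).comp (differentiable_boostC_mulVec _)

theorem continuous_boostC : Continuous boostC := by
  refine continuous_matrix fun i j => ?_
  fin_cases i <;> fin_cases j <;> simp [boostC] <;> fun_prop

theorem continuous_boostAt (A : ProperLorentz) : Continuous (boostAt A) := by
  unfold boostAt
  exact (continuous_const.matrix_mul continuous_boostC).matrix_mul continuous_const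

/-! ### Light-cone coordinates -/

/-- The point `z` with `z⁰ - z³ = w`, `z¹ = v₁`, `z² = v₂` and `{z, z} = Q`. -/
def lcPoint {F : Type*} [Field F] (Q w v₁ v₂ : F) : Fin 4 → F :=
  ![((Q + v₁ ^ 2 + v₂ ^ 2) / w + w) / 2, v₁, v₂, ((Q + v₁ ^ 2 + v₂ ^ 2) / w - w) / 2]

theorem lcPoint_one {F : Type*} [Field F] (Q w v₁ v₂ : F) : lcPoint Q w v₁ v₂ 1 = v₁ := rfl

theorem lcPoint_two {F : Type*} [Field F] (Q w v₁ v₂ : F) : lcPoint Q w v₁ v₂ 2 = v₂ := rfl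

theorem lcPoint_mink {F : Type*} [Field F] [CharZero F] (Q : F) {w : F} (hw : w ≠ 0) (v₁ v₂ : F) :
    mink (lcPoint Q w v₁ v₂) (lcPoint Q w v₁ v₂) = Q := by
  simp [lcPoint, mink]; field_simp; ring

theorem lcPoint_minus {F : Type*} [Field F] [CharZero F] (Q w v₁ v₂ : F) :
    lcPoint Q w v₁ v₂ 0 - lcPoint Q w v₁ v₂ 3 = w := by
  simp [lcPoint]; ring

theorem lcPoint_plus {F : Type*} [Field F] [CharZero F] (Q w v₁ v₂ : F) :
    lcPoint Q w v₁ v₂ 0 + lcPoint Q w v₁ v₂ 3 = (Q + v₁ ^ 2 + v₂ ^ 2) / w := by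
  simp [lcPoint]; ring

/-- Since `(z⁰ - z³)(z⁰ + z³) = {z, z} + z₁² + z₂²`, the missing coordinate `z⁰ + z³` is recovered
by a division. -/
theorem lcPoint_eta {F : Type*} [Field F] [CharZero F] {z : Fin 4 → F} (hz : z 0 - z 3 ≠ 0) :
    lcPoint (mink z z) (z 0 - z 3) (z 1) (z 2) = z := by
  have key : (mink z z + z 1 ^ 2 + z 2 ^ 2) / (z 0 - z 3) = z 0 + z 3 := by
    rw [div_eq_iff hz, mink]; ring
  ext i
  fin_cases i <;> simp [lcPoint, key]

theorem toC_lcPoint (Q w v₁ v₂ : ℝ) : toC (lcPoint Q w v₁ v₂) = lcPoint (Q : ℂ) w v₁ v₂ := by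
  ext i
  fin_cases i <;> simp [lcPoint, toC]

theorem toC_injective : Function.Injective toC := fun p q h => by
  ext k; have := congrFun h k; simpa [toC] using this

/-- The combinations `z⁰ - z³` and `z⁰ + z³` are eigencoordinates of the boost with eigenvalues
`e^τ` and `e^{-τ}`. -/
theorem boostC_lcPoint (τ Q w v₁ v₂ : ℂ) :
    boostC τ *ᵥ lcPoint Q w v₁ v₂ = lcPoint Q (Complex.exp τ * w) v₁ v₂ := by
  have h1 := Complex.cosh_add_sinh τ
  have h2 := Complex.cosh_sub_sinh τ
  have key : (Q + v₁ ^ 2 + v₂ ^ 2) / (Complex.exp τ * w)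
      = Complex.exp (-τ) * ((Q + v₁ ^ 2 + v₂ ^ 2) / w) := by
    rw [Complex.exp_neg, div_mul_eq_div_div_swap, div_eq_inv_mul]
  ext i
  fin_cases i <;>
    simp [lcPoint, boostC, Matrix.mulVec, dotProduct, Fin.sum_univ_four, key] <;>
    rw [← h1, ← h2] <;> ring

theorem boostL_lcPoint (t Q w v₁ v₂ : ℝ) :
    (boostL t).1 *ᵥ lcPoint Q w v₁ v₂ = lcPoint Q (Real.exp t * w) v₁ v₂ := by
  apply toC_injective
  rw [← lorentzC_mulVec_toC, lorentzC_boostL, toC_lcPoint, boostC_lcPoint, toC_lcPoint]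
  push_cast; rfl

/-- The null rotation which fixes the light-like vector `(1, 0, 0, 1)`. -/
def nullRot (b₁ b₂ : ℝ) : Matrix (Fin 4) (Fin 4) ℝ :=
  !![1 + (b₁ ^ 2 + b₂ ^ 2) / 2, b₁, b₂, -((b₁ ^ 2 + b₂ ^ 2) / 2);
     b₁, 1, 0, -b₁;
     b₂, 0, 1, -b₂;
     (b₁ ^ 2 + b₂ ^ 2) / 2, b₁, b₂, 1 - (b₁ ^ 2 + b₂ ^ 2) / 2]

theorem isProperLorentz_nullRot (b₁ b₂ : ℝ) : IsProperLorentz (nullRot b₁ b₂) := by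
  refine ⟨?_, ?_, ?_⟩
  · ext i j
    fin_cases i <;> fin_cases j <;>
      simp [nullRot, minkMetric, Matrix.mul_apply, Fin.sum_univ_four, Matrix.diagonal_apply] <;>
      ring
  · simp [nullRot, Matrix.det_succ_row_zero, Fin.sum_univ_succ, Fin.succAbove]
    ring
  · simp only [nullRot, Matrix.of_apply, Matrix.cons_val_zero, Matrix.cons_val']
    positivity

/-- The null rotation as an element of the Lorentz group. -/
def nullRotL (b₁ b₂ : ℝ) : ProperLorentz := ⟨nullRot b₁ b₂, isProperLorentz_nullRot b₁ b₂⟩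

theorem nullRotL_mul (b₁ b₂ c₁ c₂ : ℝ) :
    nullRotL b₁ b₂ * nullRotL c₁ c₂ = nullRotL (b₁ + c₁) (b₂ + c₂) := by
  apply Subtype.ext
  rw [lorentz_coe_mul]
  ext i j
  fin_cases i <;> fin_cases j <;>
    simp [nullRotL, nullRot, Matrix.mul_apply, Fin.sum_univ_four] <;> ring

theorem nullRotL_zero : nullRotL 0 0 = 1 := by
  apply Subtype.ext
  rw [lorentz_coe_one]
  ext i j
  fin_cases i <;> fin_cases j <;> simp [nullRotL, nullRot]

theorem nullRotL_inv (b₁ b₂ : ℝ) : (nullRotL b₁ b₂)⁻¹ = nullRotL (-b₁) (-b₂) := by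
  rw [inv_eq_iff_mul_eq_one, nullRotL_mul, add_neg_cancel, add_neg_cancel, nullRotL_zero]

theorem continuous_nullRotL : Continuous fun b : ℝ × ℝ => nullRotL b.1 b.2 := by
  refine Continuous.subtype_mk ?_ _
  refine continuous_matrix fun i j => ?_
  fin_cases i <;> fin_cases j <;> simp [nullRot] <;> fun_prop

/-- A real null rotation adds real multiples of `w` to the transverse coordinates. If `w` is not
real, their imaginary parts can be prescribed in this way, so real frames reach points with non-real
`v`. -/
theorem nullRotL_lcPoint_complex (b₁ b₂ : ℝ) (Q : ℂ) {w : ℂ} (hw : w ≠ 0) (v₁ v₂ : ℂ) :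
    lorentzC (nullRotL b₁ b₂) *ᵥ lcPoint Q w v₁ v₂ =
      lcPoint Q w (v₁ + b₁ * w) (v₂ + b₂ * w) := by
  ext i
  fin_cases i <;>
    simp [lcPoint, lorentzC, nullRotL, nullRot, Matrix.mulVec, dotProduct, Fin.sum_univ_four] <;>
    field_simp <;> ring

theorem nullRotL_lcPoint (b₁ b₂ Q : ℝ) {w : ℝ} (hw : w ≠ 0) (v₁ v₂ : ℝ) :
    (nullRotL b₁ b₂).1 *ᵥ lcPoint Q w v₁ v₂ = lcPoint Q w (v₁ + b₁ * w) (v₂ + b₂ * w) := by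
  apply toC_injective
  rw [← lorentzC_mulVec_toC, toC_lcPoint, nullRotL_lcPoint_complex _ _ _ (by exact_mod_cast hw),
    toC_lcPoint]
  push_cast; rfl

theorem lcPoint_mem_massShell {P : ℝ} (hP : 0 < P) {w : ℝ} (hw : 0 < w) (v₁ v₂ : ℝ) :
    lcPoint P w v₁ v₂ ∈ massShell P := by
  refine ⟨lcPoint_mink P hw.ne' v₁ v₂, ?_⟩
  simp only [lcPoint, Matrix.cons_val_zero]
  positivity

theorem minus_pos_of_mem_forwardCone {p : Fin 4 → ℝ} (hp : p ∈ forwardCone) : 0 < p 0 - p 3 := by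
  obtain ⟨h1, h2⟩ := hp
  simp only [mink] at h1
  by_contra h
  nlinarith [sq_nonneg (p 1), sq_nonneg (p 2)]

theorem eq_lcPoint_of_mem_massShell {P : ℝ} (hP : 0 < P) {p : Fin 4 → ℝ} (hp : p ∈ massShell P) :
    p = lcPoint P (p 0 - p 3) (p 1) (p 2) := by
  have h := lcPoint_eta (z := p)
    (minus_pos_of_mem_forwardCone (massShell_subset_forwardCone hP hp)).ne'
  rw [hp.1] at h
  exact h.symm

theorem exists_eq_lcPoint {P : ℝ} (hP : 0 < P) {p : Fin 4 → ℝ} (hp : p ∈ massShell P) :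
    ∃ t x₁ x₂ : ℝ, p = lcPoint P (Real.exp (-t)) x₁ x₂ := by
  refine ⟨-Real.log (p 0 - p 3), p 1, p 2, ?_⟩
  rw [neg_neg, Real.exp_log
    (minus_pos_of_mem_forwardCone (massShell_subset_forwardCone hP hp))]
  exact eq_lcPoint_of_mem_massShell hP hp

theorem differentiableAt_lcPoint {E : Type*} [NormedAddCommGroup E] [NormedSpace ℂ E]
    {Q w v₁ v₂ : E → ℂ} {x : E} (hQ : DifferentiableAt ℂ Q x) (hw : DifferentiableAt ℂ w x)
    (h₁ : DifferentiableAt ℂ v₁ x) (h₂ : DifferentiableAt ℂ v₂ x) (h : w x ≠ 0) :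
    DifferentiableAt ℂ (fun y => lcPoint (Q y) (w y) (v₁ y) (v₂ y)) x := by
  rw [differentiableAt_pi]
  intro i
  fin_cases i <;> simp [lcPoint] <;> fun_prop (disch := assumption)

/-! ### The sets `M⁺` in light-cone coordinates -/

/-- The parameter of the null rotation belonging to the light-cone coordinates `(s, v)`. -/
def nullParam (s v : ℂ) : ℝ := -v.im * Real.exp s.re / Real.sin s.im

/-- The transverse coordinate of the real point belonging to the light-cone coordinates `(s, v)`. -/
def realParam (s v : ℂ) : ℝ :=
  v.re + nullParam s v * Real.exp (-s.re) * (1 - Real.cos s.im)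

theorem exp_neg_eq (s : ℂ) : Complex.exp (-s) =
    Complex.exp (-(Complex.I * s.im)) * (Real.exp (-s.re) : ℝ) := by
  rw [Complex.ofReal_exp, ← Complex.exp_add]
  congr 1
  apply Complex.ext <;> simp

/-- As `Im e^{-s} = -e^{-Re s} sin(Im s)`, `nullParam` is the real `b` that makes `v - b e^{-s}`
real. `realParam` adds back `b e^{-Re s}`, the shift of the same null rotation at the real point. -/
theorem coord_eq_of_params {s : ℂ} (hs : Real.sin s.im ≠ 0) (v : ℂ) :
    v = (realParam s v - nullParam s v * (Real.exp (-s.re) : ℝ) : ℂ) +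
      nullParam s v * Complex.exp (-s) := by
  have hexp : Complex.exp (-s) = (Real.exp (-s.re) * Real.cos s.im : ℝ) -
      (Real.exp (-s.re) * Real.sin s.im : ℝ) * Complex.I := by
    rw [Complex.exp_eq_exp_re_mul_sin_add_cos]
    simp only [Complex.neg_re, Complex.neg_im, Complex.cos_neg, Complex.ofReal_neg,
      Complex.sin_neg]
    push_cast
    ring
  rw [hexp]
  have h1 : nullParam s v * (Real.exp (-s.re) * Real.sin s.im) = -v.im := by
    rw [nullParam, Real.exp_neg]
    field_simp
  rw [realParam]
  generalize nullParam s v = n at h1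
  generalize Real.exp (-s.re) = a at h1
  generalize Real.cos s.im = c
  generalize Real.sin s.im = d at h1
  apply Complex.ext
  · simp; ring
  · simp; linarith

/-- Conjugation by the null rotation: remove the shift by `b w`, scale `w` by `e^τ`, and shift by
`b` times the new `w`. -/
theorem boostAt_mul_nullRotL_lcPoint (A : ProperLorentz) (b₁ b₂ : ℝ) (τ Q : ℂ) {w : ℂ} (hw : w ≠ 0)
    (v₁ v₂ : ℂ) :
    boostAt (A * nullRotL b₁ b₂) τ *ᵥ (lorentzC A *ᵥ lcPoint Q w v₁ v₂) =
      lorentzC A *ᵥ lcPoint Q (Complex.exp τ * w) (v₁ - b₁ * w + b₁ * (Complex.exp τ * w))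
        (v₂ - b₂ * w + b₂ * (Complex.exp τ * w)) := by
  have h1 : lorentzC (A * nullRotL b₁ b₂)⁻¹ *ᵥ (lorentzC A *ᵥ lcPoint Q w v₁ v₂) =
      lcPoint Q w (v₁ - b₁ * w) (v₂ - b₂ * w) := by
    rw [Matrix.mulVec_mulVec, ← lorentzC_mul, mul_inv_rev, inv_mul_cancel_right, nullRotL_inv,
      nullRotL_lcPoint_complex _ _ _ hw]
    congr 1 <;> push_cast <;> ring
  rw [boostAt, ← Matrix.mulVec_mulVec, h1, ← Matrix.mulVec_mulVec, boostC_lcPoint, lorentzC_mul,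
    ← Matrix.mulVec_mulVec, nullRotL_lcPoint_complex _ _ _ (by simp [hw])]

theorem boostAt_lcPoint (A : ProperLorentz) (τ Q w v₁ v₂ : ℂ) :
    boostAt A τ *ᵥ (lorentzC A *ᵥ lcPoint Q w v₁ v₂) =
      lorentzC A *ᵥ lcPoint Q (Complex.exp τ * w) v₁ v₂ := by
  rw [boostAt, Matrix.mulVec_mulVec, Matrix.mul_assoc, lorentzC_inv_mul, Matrix.mul_one,
    ← Matrix.mulVec_mulVec, boostC_lcPoint]

/-- The point of the complex mass shell with the light-cone coordinates `(s, v₁, v₂)` in the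
frame `A`. -/
def chartPoint (P : ℝ) (A : ProperLorentz) (s v₁ v₂ : ℂ) : Fin 4 → ℂ :=
  lorentzC A *ᵥ lcPoint (P : ℂ) (Complex.exp (-s)) v₁ v₂

/-- The real point belonging to `chartPoint P A s v₁ v₂`. -/
def realPoint (P : ℝ) (A : ProperLorentz) (t x₁ x₂ : ℝ) : Fin 4 → ℝ :=
  A.1 *ᵥ lcPoint P (Real.exp (-t)) x₁ x₂

theorem realPoint_mem {P : ℝ} (hP : 0 < P) (A : ProperLorentz) (t x₁ x₂ : ℝ) :
    realPoint P A t x₁ x₂ ∈ massShell P :=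
  lorentz_mem_massShell A hP (lcPoint_mem_massShell hP (Real.exp_pos _) _ _)

/-- Complex transverse coordinates in the frame `A` are traded for real ones in a null-rotated
frame. A chart point therefore lies in `M⁺` as long as `0 < Im s < π` and the rotated frame stays in
the interior of `X`. -/
theorem chartPoint_eq {P : ℝ} (A : ProperLorentz) {s : ℂ} (hs : Real.sin s.im ≠ 0) (v₁ v₂ : ℂ) :
    chartPoint P A s v₁ v₂ = boostAt (A * nullRotL (nullParam s v₁) (nullParam s v₂))
      (-(Complex.I * s.im)) *ᵥ toC (realPoint P A s.re (realParam s v₁) (realParam s v₂)) := by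
  rw [realPoint, ← lorentzC_mulVec_toC, toC_lcPoint,
    boostAt_mul_nullRotL_lcPoint _ _ _ _ _ (by exact_mod_cast (Real.exp_pos _).ne'),
    ← exp_neg_eq, ← coord_eq_of_params hs, ← coord_eq_of_params hs, chartPoint]

theorem exists_massShell_eq {P : ℝ} (hP : 0 < P) (A : ProperLorentz) {p : Fin 4 → ℝ}
    (hp : p ∈ massShell P) : ∃ t x₁ x₂ : ℝ, p = realPoint P A t x₁ x₂ := by
  obtain ⟨t, x₁, x₂, h⟩ := exists_eq_lcPoint hP (lorentz_mem_massShell A⁻¹ hP hp)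
  refine ⟨t, x₁, x₂, ?_⟩
  rw [realPoint, ← h, lorentz_mulVec_mulVec, mul_inv_cancel, lorentz_coe_one, Matrix.one_mulVec]

/-- The real part of `τ` can be moved into the point `p`, so that only imaginary `τ` need be
considered. -/
theorem zetaPoint_mul_add (A : ProperLorentz) (τ : ℂ) (t : ℝ) (p : Fin 4 → ℝ) :
    zetaPoint A (τ + t) ((boostConj A t).1 *ᵥ p) = zetaPoint A τ p := by
  rw [zetaPoint_eq, zetaPoint_eq, ← lorentzC_mulVec_toC, ← boostAt_ofReal, boostAt_mulVec_add]
  congr 2; ring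

theorem zetaPoint_mem_complexMassShell {P : ℝ} (A : ProperLorentz) (τ : ℂ) {p : Fin 4 → ℝ}
    (hp : p ∈ massShell P) : zetaPoint A τ p ∈ complexMassShell P := by
  rw [complexMassShell, Set.mem_ofPred_eq, zetaPoint_eq, boostAt_mink, mink_toC, hp.1]

theorem zetaPoint_realPoint {P : ℝ} (A : ProperLorentz) (σ t x₁ x₂ : ℝ) :
    zetaPoint A (Complex.I * σ) (realPoint P A t x₁ x₂) =
      chartPoint P A (t + Complex.I * σ) x₁ x₂ := by
  rw [zetaPoint_eq, realPoint, ← lorentzC_mulVec_toC, toC_lcPoint, boostAt_lcPoint, chartPoint,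
    Complex.ofReal_exp, ← Complex.exp_add]
  congr 3; push_cast; ring

theorem Mplus_subset (P : ℝ) (K : PolyhedralRegion) (i : Fin K.n) :
    Mplus P K i ⊆ complexMassShell P := fun _ h => h.1

theorem zetaPoint_mem_Mplus {P : ℝ} {K : PolyhedralRegion} {i : Fin K.n} {A : ProperLorentz}
    (hA : A ∈ interior (K.X i)) {τ : ℂ} (h0 : 0 < τ.im) (h1 : τ.im < Real.pi) {p : Fin 4 → ℝ}
    (hp : p ∈ massShell P) : zetaPoint A τ p ∈ Mplus P K i :=
  ⟨zetaPoint_mem_complexMassShell A τ hp, A, hA, τ, p, hp, h0, h1, rfl⟩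

theorem mem_Mplus_iff_exists_chart {P : ℝ} (hP : 0 < P) {K : PolyhedralRegion} {i : Fin K.n}
    {ζ : Fin 4 → ℂ} : ζ ∈ Mplus P K i ↔ ∃ A ∈ interior (K.X i), ∃ σ t x₁ x₂ : ℝ, 0 < σ ∧
      σ < Real.pi ∧ ζ = zetaPoint A (Complex.I * σ) (realPoint P A t x₁ x₂) := by
  constructor
  · rintro ⟨-, A, hA, τ, p, hp, h0, h1, rfl⟩
    obtain ⟨t, x₁, x₂, h⟩ := exists_massShell_eq hP A
      (lorentz_mem_massShell (boostConj A (-τ.re)) hP hp)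
    refine ⟨A, hA, τ.im, t, x₁, x₂, h0, h1, ?_⟩
    rw [← h, ← zetaPoint_mul_add A τ (-τ.re) p]
    congr 1
    apply Complex.ext <;> simp
  · rintro ⟨A, hA, σ, t, x₁, x₂, h0, h1, rfl⟩
    exact zetaPoint_mem_Mplus hA (by simpa using h0) (by simpa using h1) (realPoint_mem hP _ _ _ _)

/-- In the frame `A` both conditions say that `z¹, z²` are real and `w = z⁰ - z³` lies in the open
lower half plane. With `w = e^{-(t + iσ)}` the latter is `0 < σ < π`, and `z⁰ + z³` is then a
positive multiple of `e^{t + iσ}`. -/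
theorem Mplus_eq {P : ℝ} (hP : 0 < P) (K : PolyhedralRegion) (i : Fin K.n) :
    Mplus P K i = complexMassShell P ∩ Tplus K i := by
  ext ζ
  constructor
  · intro h
    refine ⟨h.1, ?_⟩
    obtain ⟨A, hA, σ, t, x₁, x₂, h0, h1, rfl⟩ := (mem_Mplus_iff_exists_chart hP).1 h
    have hsin := Real.sin_pos_of_pos_of_lt_pi h0 h1
    rw [zetaPoint_realPoint]
    set z := lcPoint (P : ℂ) (Complex.exp (-(t + Complex.I * σ))) x₁ x₂ with hz
    refine ⟨A, hA, imV z, ?_, imV_lorentzC A z⟩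
    have e1 : z 0 - z 3 = _ := lcPoint_minus _ _ _ _
    have e2 : z 0 + z 3 = _ := lcPoint_plus _ _ _ _
    rw [div_eq_mul_inv, ← Complex.exp_neg, neg_neg] at e2
    have f1 := congrArg Complex.im e1
    have f2 := congrArg Complex.im e2
    have hc : ((P : ℂ) + (x₁ : ℂ) ^ 2 + (x₂ : ℂ) ^ 2) = ((P + x₁ ^ 2 + x₂ ^ 2 : ℝ) : ℂ) := by
      push_cast; ring
    rw [hc, Complex.im_ofReal_mul] at f2
    simp only [Complex.sub_im, Complex.add_im, Complex.exp_im, Complex.neg_re, Complex.neg_im,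
      Complex.add_re, Complex.ofReal_re, Complex.ofReal_im, Complex.mul_re, Complex.mul_im,
      Complex.I_re, Complex.I_im, Real.sin_neg, zero_mul, zero_add, one_mul, mul_zero, sub_zero]
      at f1 f2
    refine ⟨?_, ?_, by simp [imV, hz, lcPoint_one], by simp [imV, hz, lcPoint_two]⟩
    · simp only [imV]
      rw [f1]
      have := mul_pos (Real.exp_pos (-(t + 0))) hsin
      linarith
    · simp only [imV]
      rw [f2]
      positivity
  · rintro ⟨hζ, A, hA, η, ⟨h1, h2, h3, h4⟩, h⟩
    rw [mem_Mplus_iff_exists_chart hP]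
    set z := lorentzC A⁻¹ *ᵥ ζ with hz
    have hzζ : lorentzC A *ᵥ z = ζ := by
      rw [hz, Matrix.mulVec_mulVec, lorentzC_mul_inv, Matrix.one_mulVec]
    have him : imV z = η := by
      rw [hz, imV_lorentzC]
      change A⁻¹.1 *ᵥ (fun k => (ζ k).im) = η
      rw [h, lorentz_mulVec_mulVec, inv_mul_cancel, lorentz_coe_one, Matrix.one_mulVec]
    have hmk : mink z z = P := by rw [hz, lorentzC_mink]; exact hζ
    have g : ∀ k, (z k).im = η k := fun k => congrFun him k
    have hw : (z 0 - z 3).im < 0 := by rw [Complex.sub_im, g, g]; exact h1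
    have hw0 : z 0 - z 3 ≠ 0 := fun h0 => by simp [h0] at hw
    have eta := lcPoint_eta hw0
    rw [hmk] at eta
    set W := z 0 - z 3
    have r1 : z 1 = ((z 1).re : ℂ) := by apply Complex.ext <;> simp [g, h3]
    have r2 : z 2 = ((z 2).re : ℂ) := by apply Complex.ext <;> simp [g, h4]
    have ha : W.arg < 0 := Complex.arg_neg_iff.2 hw
    -- These are the imaginary and real parts of `-log W`; the argument of `W` lies in `(-π, 0)`.
    refine ⟨A, hA, -W.arg, -Real.log ‖W‖, (z 1).re, (z 2).re, by linarith,
      by linarith [Complex.neg_pi_lt_arg W], ?_⟩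
    rw [zetaPoint_realPoint, chartPoint, ← r1, ← r2]
    have : Complex.exp (-(((-Real.log ‖W‖ : ℝ) : ℂ) + Complex.I * ((-W.arg : ℝ) : ℂ))) = W := by
      rw [← Complex.exp_log hw0]
      congr 1
      apply Complex.ext <;> simp [Complex.log_re, Complex.log_im]
      all_goals rw [Complex.exp_log hw0]
    rw [this, eta, hzζ]

/-! ### Openness of `M⁺` and its structure of a complex submanifold -/

/-- The light-cone coordinate `z⁰ - z³` of `z = A⁻¹ ζ`. -/
def chartW (A : ProperLorentz) (ζ : Fin 4 → ℂ) : ℂ :=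
  (lorentzC A⁻¹ *ᵥ ζ) 0 - (lorentzC A⁻¹ *ᵥ ζ) 3

/-- The coordinate `z¹` of `z = A⁻¹ ζ`. -/
def chartV₁ (A : ProperLorentz) (ζ : Fin 4 → ℂ) : ℂ := (lorentzC A⁻¹ *ᵥ ζ) 1

/-- The coordinate `z²` of `z = A⁻¹ ζ`. -/
def chartV₂ (A : ProperLorentz) (ζ : Fin 4 → ℂ) : ℂ := (lorentzC A⁻¹ *ᵥ ζ) 2

/-- The logarithmic light-cone coordinate, on the branch through `s₀`. -/
def chartS (A : ProperLorentz) (s₀ : ℂ) (ζ : Fin 4 → ℂ) : ℂ :=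
  s₀ - Complex.log (chartW A ζ * Complex.exp s₀)

theorem differentiable_chartW (A : ProperLorentz) : Differentiable ℂ (chartW A) := by
  have := differentiable_pi.1 (differentiable_mulVec (lorentzC A⁻¹))
  exact (this 0).sub (this 3)

theorem differentiable_chartV₁ (A : ProperLorentz) : Differentiable ℂ (chartV₁ A) :=
  differentiable_pi.1 (differentiable_mulVec (lorentzC A⁻¹)) 1

theorem differentiable_chartV₂ (A : ProperLorentz) : Differentiable ℂ (chartV₂ A) :=
  differentiable_pi.1 (differentiable_mulVec (lorentzC A⁻¹)) 2

theorem lorentzC_lcPoint_chart (A : ProperLorentz) {ζ : Fin 4 → ℂ} (h : chartW A ζ ≠ 0) :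
    lorentzC A *ᵥ lcPoint (mink ζ ζ) (chartW A ζ) (chartV₁ A ζ) (chartV₂ A ζ) = ζ := by
  have := lcPoint_eta h
  rw [lorentzC_mink] at this
  rw [chartW, chartV₁, chartV₂, this, Matrix.mulVec_mulVec, lorentzC_mul_inv, Matrix.one_mulVec]

theorem chart_lorentzC (A : ProperLorentz) (Q w v₁ v₂ : ℂ) :
    chartW A (lorentzC A *ᵥ lcPoint Q w v₁ v₂) = w ∧
    chartV₁ A (lorentzC A *ᵥ lcPoint Q w v₁ v₂) = v₁ ∧
    chartV₂ A (lorentzC A *ᵥ lcPoint Q w v₁ v₂) = v₂ := by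
  rw [chartW, chartV₁, chartV₂, Matrix.mulVec_mulVec, lorentzC_inv_mul, Matrix.one_mulVec]
  exact ⟨lcPoint_minus _ _ _ _, rfl, rfl⟩

theorem exp_neg_chartS (A : ProperLorentz) (s₀ : ℂ) {ζ : Fin 4 → ℂ} (h : chartW A ζ ≠ 0) :
    Complex.exp (-chartS A s₀ ζ) = chartW A ζ := by
  rw [chartS, neg_sub, Complex.exp_sub, Complex.exp_log (mul_ne_zero h (Complex.exp_ne_zero _)),
    mul_div_assoc, div_self (Complex.exp_ne_zero _), mul_one]

theorem chartPoint_chart {P : ℝ} (A : ProperLorentz) (s₀ : ℂ) {ζ : Fin 4 → ℂ}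
    (h : chartW A ζ ≠ 0) (hζ : ζ ∈ complexMassShell P) :
    chartPoint P A (chartS A s₀ ζ) (chartV₁ A ζ) (chartV₂ A ζ) = ζ := by
  have := lorentzC_lcPoint_chart A h
  rw [show mink ζ ζ = (P : ℂ) from hζ] at this
  rw [chartPoint, exp_neg_chartS A s₀ h, this]

theorem chart_chartPoint (P : ℝ) (A : ProperLorentz) (s v₁ v₂ : ℂ) :
    chartW A (chartPoint P A s v₁ v₂) = Complex.exp (-s) ∧
    chartS A s (chartPoint P A s v₁ v₂) = s ∧
    chartV₁ A (chartPoint P A s v₁ v₂) = v₁ ∧ chartV₂ A (chartPoint P A s v₁ v₂) = v₂ := by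
  obtain ⟨h1, h2, h3⟩ := chart_lorentzC A P (Complex.exp (-s)) v₁ v₂
  refine ⟨h1, ?_, h2, h3⟩
  rw [chartS, show chartW A (chartPoint P A s v₁ v₂) = _ from h1, ← Complex.exp_add]
  simp

theorem differentiableAt_chartS (A : ProperLorentz) (s₀ : ℂ) {ζ : Fin 4 → ℂ}
    (h : chartW A ζ * Complex.exp s₀ ∈ Complex.slitPlane) :
    DifferentiableAt ℂ (chartS A s₀) ζ :=
  (((differentiable_chartW A).differentiableAt.mul_const _).clog h).const_sub _

/-- At the centre `chartW * exp s = 1`, so the principal logarithm in `chartS` is holomorphic near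
it, whatever branch `s` lies on. -/
theorem eventually_chart_slitPlane (P : ℝ) (A : ProperLorentz) (s v₁ v₂ : ℂ) :
    ∀ᶠ ζ in nhds (chartPoint P A s v₁ v₂), chartW A ζ ≠ 0 ∧
      chartW A ζ * Complex.exp s ∈ Complex.slitPlane := by
  have h := (chart_chartPoint P A s v₁ v₂).1
  have hc := (differentiable_chartW A).continuous
  refine Filter.Eventually.and ?_ ?_
  · exact hc.continuousAt.eventually_ne (by rw [h]; exact Complex.exp_ne_zero _)
  · refine (hc.mul continuous_const).continuousAt.eventually
      (Complex.isOpen_slitPlane.mem_nhds ?_)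
    change chartW A (chartPoint P A s v₁ v₂) * Complex.exp s ∈ _
    rw [h, ← Complex.exp_add, neg_add_cancel, Complex.exp_zero]
    exact Complex.one_mem_slitPlane

theorem tendsto_chart (P : ℝ) (A : ProperLorentz) (s v₁ v₂ : ℂ) :
    Filter.Tendsto (fun ζ => (chartS A s ζ, chartV₁ A ζ, chartV₂ A ζ))
      (nhds (chartPoint P A s v₁ v₂)) (nhds (s, v₁, v₂)) := by
  obtain ⟨h1, h2, h3, h4⟩ := chart_chartPoint P A s v₁ v₂
  have hS : ContinuousAt (chartS A s) (chartPoint P A s v₁ v₂) :=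
    (differentiableAt_chartS A s (eventually_chart_slitPlane P A s v₁ v₂).self_of_nhds.2).continuousAt
  have := hS.prodMk ((differentiable_chartV₁ A).continuous.continuousAt.prodMk
    (differentiable_chartV₂ A).continuous.continuousAt (x := chartPoint P A s v₁ v₂))
  unfold ContinuousAt at this
  beta_reduce at this
  rwa [h2, h3, h4] at this

theorem continuousAt_nullParam {X : Type*} [TopologicalSpace X] {f g : X → ℂ} {x : X}
    (hf : ContinuousAt f x) (hg : ContinuousAt g x) (hs : Real.sin (f x).im ≠ 0) :
    ContinuousAt (fun y => nullParam (f y) (g y)) x := by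
  unfold nullParam
  refine ContinuousAt.div ?_ ?_ hs <;> fun_prop

/-- Near a point of the mass shell with real transverse coordinates, the null rotations belonging to
the light-cone coordinates are near `1`. -/
theorem eventually_nullRot_mem {X : Set ProperLorentz} {A : ProperLorentz} (hA : A ∈ interior X)
    {s : ℂ} (h0 : 0 < s.im) (h1 : s.im < Real.pi) (x₁ x₂ : ℝ) :
    ∀ᶠ y : ℂ × ℂ × ℂ in nhds (s, (x₁ : ℂ), (x₂ : ℂ)), 0 < y.1.im ∧ y.1.im < Real.pi ∧
      A * nullRotL (nullParam y.1 y.2.1) (nullParam y.1 y.2.2) ∈ interior X := by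
  have hs := (Real.sin_pos_of_pos_of_lt_pi h0 h1).ne'
  have hc : ContinuousAt (fun y : ℂ × ℂ × ℂ => y.1.im) (s, (x₁ : ℂ), (x₂ : ℂ)) := by fun_prop
  refine (hc.eventually (lt_mem_nhds h0)).and ((hc.eventually (gt_mem_nhds h1)).and ?_)
  have e1 : ContinuousAt (fun y : ℂ × ℂ × ℂ => nullParam y.1 y.2.1) (s, (x₁ : ℂ), (x₂ : ℂ)) :=
    continuousAt_nullParam (by fun_prop) (by fun_prop) hs
  have e2 : ContinuousAt (fun y : ℂ × ℂ × ℂ => nullParam y.1 y.2.2) (s, (x₁ : ℂ), (x₂ : ℂ)) :=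
    continuousAt_nullParam (by fun_prop) (by fun_prop) hs
  have e3 : ContinuousAt (fun y : ℂ × ℂ × ℂ =>
      A * nullRotL (nullParam y.1 y.2.1) (nullParam y.1 y.2.2)) (s, (x₁ : ℂ), (x₂ : ℂ)) :=
    continuousAt_const.mul (ContinuousAt.comp (f := fun y : ℂ × ℂ × ℂ =>
      (nullParam y.1 y.2.1, nullParam y.1 y.2.2)) continuous_nullRotL.continuousAt (e1.prodMk e2))
  refine e3.eventually (isOpen_interior.mem_nhds ?_)
  -- For real transverse coordinates the null parameters vanish, so at the centre the frame is `A`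
  -- itself.
  have hz : ∀ x : ℝ, nullParam s x = 0 := fun x => by simp [nullParam]
  simpa [hz, nullRotL_zero] using hA

theorem chartPoint_mem_Mplus {P : ℝ} (hP : 0 < P) {K : PolyhedralRegion} {i : Fin K.n}
    {A : ProperLorentz} {s v₁ v₂ : ℂ} (h0 : 0 < s.im) (h1 : s.im < Real.pi)
    (hA : A * nullRotL (nullParam s v₁) (nullParam s v₂) ∈ interior (K.X i)) :
    chartPoint P A s v₁ v₂ ∈ Mplus P K i := by
  rw [chartPoint_eq A (Real.sin_pos_of_pos_of_lt_pi h0 h1).ne', ← zetaPoint_eq]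
  exact zetaPoint_mem_Mplus hA (by simpa using h0) (by simpa using h1) (realPoint_mem hP _ _ _ _)

/-- The chart of `A` covers a neighbourhood of `ζ₀` in the mass shell, and the frames of the
neighbours are small null rotations of `A`, hence still in the open set `interior (K.X i)`. -/
theorem Mplus_nhds {P : ℝ} (hP : 0 < P) (K : PolyhedralRegion) (i : Fin K.n) {ζ₀ : Fin 4 → ℂ}
    (h : ζ₀ ∈ Mplus P K i) :
    ∀ᶠ ζ in nhds ζ₀, ζ ∈ complexMassShell P → ζ ∈ Mplus P K i := by
  obtain ⟨A, hA, σ, t, x₁, x₂, h0, h1, rfl⟩ := (mem_Mplus_iff_exists_chart hP).1 h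
  rw [zetaPoint_realPoint]
  filter_upwards [(tendsto_chart P A _ _ _).eventually (eventually_nullRot_mem hA
    (s := t + Complex.I * σ) (by simpa using h0) (by simpa using h1) x₁ x₂),
    eventually_chart_slitPlane P A (t + Complex.I * σ) x₁ x₂] with ζ h2 h3 h4
  rw [← chartPoint_chart A (t + Complex.I * σ) h3.1 h4]
  exact chartPoint_mem_Mplus hP h2.1 h2.2.1 h2.2.2

theorem isOpen_Mplus {P : ℝ} (hP : 0 < P) (K : PolyhedralRegion) (i : Fin K.n) :
    IsOpen ((↑) ⁻¹' Mplus P K i : Set (complexMassShell P)) := by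
  rw [isOpen_iff_mem_nhds]
  intro ζ hζ
  have := continuous_subtype_val.continuousAt.eventually (Mplus_nhds hP K i hζ)
  filter_upwards [this] with z hz using hz z.2

/-- Leaving the value of `{z, z}` free, the light-cone coordinates are biholomorphic on the open set
`w ≠ 0` of `ℂ⁴`; `{z, z} - P` is the coordinate that has to vanish. -/
theorem isComplexSubmanifold_Mplus {P : ℝ} (hP : 0 < P) (K : PolyhedralRegion) (i : Fin K.n) :
    IsComplexSubmanifold 3 (Mplus P K i) := by
  refine ⟨by norm_num, fun ζ₀ h => ?_⟩
  -- Inside `O` the set `M⁺` coincides with the mass shell, so the quadric equation alone describes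
  -- it.
  set O := interior {ζ : Fin 4 → ℂ | ζ ∈ complexMassShell P → ζ ∈ Mplus P K i} with hO
  have hOo : IsOpen O := isOpen_interior
  have hζO : ζ₀ ∈ O := mem_interior_iff_mem_nhds.2 (Mplus_nhds hP K i h)
  obtain ⟨A, hA, σ, t, x₁, x₂, h0, h1, rfl⟩ := (mem_Mplus_iff_exists_chart hP).1 h
  set e : (Fin 4 → ℂ) → (Fin 4 → ℂ) :=
    fun ζ => ![chartW A ζ, chartV₁ A ζ, chartV₂ A ζ, mink ζ ζ - P] with he
  set g : (Fin 4 → ℂ) → (Fin 4 → ℂ) :=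
    fun y => lorentzC A *ᵥ lcPoint (y 3 + P) (y 0) (y 1) (y 2) with hg
  have hge : ∀ ζ, chartW A ζ ≠ 0 → g (e ζ) = ζ := fun ζ hζ => by
    simp only [hg, he, Matrix.cons_val_zero, Matrix.cons_val_one, Matrix.cons_val, sub_add_cancel]
    exact lorentzC_lcPoint_chart A hζ
  have heg : ∀ y : Fin 4 → ℂ, y 0 ≠ 0 → e (g y) = y := fun y hy => by
    obtain ⟨h1, h2, h3⟩ := chart_lorentzC A (y 3 + P) (y 0) (y 1) (y 2)
    have h4 : mink (g y) (g y) = y 3 + P := by rw [hg, lorentzC_mink, lcPoint_mink _ hy]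
    ext k
    fin_cases k
    · simpa [he] using h1
    · simpa [he] using h2
    · simpa [he] using h3
    · simp [he, h4]
  have hgW : ∀ y, chartW A (g y) = y 0 := fun y => (chart_lorentzC A _ _ _ _).1
  have hed : Differentiable ℂ e := by
    have a0 := differentiable_chartW A
    have a1 := differentiable_chartV₁ A
    have a2 := differentiable_chartV₂ A
    rw [differentiable_pi]
    intro k
    fin_cases k <;> simp [he, mink] <;> fun_prop
  have hgd : DifferentiableOn ℂ g {y | y 0 ≠ 0} := fun y hy => by
    apply DifferentiableAt.differentiableWithinAt
    exact (differentiable_mulVec _).differentiableAt.comp _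
      (differentiableAt_lcPoint (by fun_prop) (by fun_prop) (by fun_prop) (by fun_prop) hy)
  have ho : IsOpen {y : Fin 4 → ℂ | y 0 ≠ 0} :=
    isOpen_ne.preimage (continuous_apply (0 : Fin 4))
  refine ⟨{ toFun := e, invFun := g, source := O ∩ {ζ | chartW A ζ ≠ 0},
            target := {y | y 0 ≠ 0} ∩ g ⁻¹' O
            map_source' := fun ζ hζ => ⟨hζ.2, by
              rw [Set.mem_preimage, hge ζ hζ.2]; exact hζ.1⟩
            map_target' := fun y hy => ⟨hy.2, by
              change chartW A (g y) ≠ 0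
              rw [hgW]; exact hy.1⟩
            left_inv' := fun ζ hζ => hge ζ hζ.2
            right_inv' := fun y hy => heg y hy.1
            open_source := hOo.inter (isOpen_ne.preimage (differentiable_chartW A).continuous)
            open_target := hgd.continuousOn.isOpen_inter_preimage ho hOo
            continuousOn_toFun := hed.continuous.continuousOn
            continuousOn_invFun := hgd.continuousOn.mono Set.inter_subset_left },
    ⟨hζO, ?_⟩, hed.differentiableOn, hgd.mono Set.inter_subset_left, ?_⟩
  · change chartW A _ ≠ 0
    rw [zetaPoint_realPoint, (chart_chartPoint _ _ _ _ _).1]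
    exact Complex.exp_ne_zero _
  · rintro z ⟨hz, -⟩
    have hz' := interior_subset hz
    have key : (∀ j : Fin 4, 3 ≤ (j : ℕ) → e z j = 0) ↔ mink z z = P := by
      constructor
      · intro hh; simpa [he, sub_eq_zero] using hh 3 (by norm_num)
      · intro hh j hj
        have : j = 3 := by omega
        subst this
        simp [he, hh]
    change z ∈ Mplus P K i ↔ ∀ j : Fin 4, 3 ≤ (j : ℕ) → e z j = 0
    rw [key]
    exact ⟨fun hm => hm.1, fun hm => hz' hm⟩

/-! ### The invariant measure on the mass shell -/

/-- The energy on the mass shell as a function of the momentum. -/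
def energy (P : ℝ) (k : Fin 3 → ℝ) : ℝ := √(P + ∑ j, k j ^ 2)

/-- The parametrization of the mass shell by the momentum. -/
def shellPoint (P : ℝ) (k : Fin 3 → ℝ) : Fin 4 → ℝ := Fin.cons (energy P k) k

theorem continuous_energy (P : ℝ) : Continuous (energy P) := by
  unfold energy; fun_prop

theorem continuous_shellPoint (P : ℝ) : Continuous (shellPoint P) := by
  refine continuous_pi fun j => ?_
  refine Fin.cases ?_ (fun j => ?_) j
  · simpa [shellPoint] using continuous_energy P
  · simpa [shellPoint] using continuous_apply j

theorem energy_pos {P : ℝ} (hP : 0 < P) (k : Fin 3 → ℝ) : 0 < energy P k := by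
  unfold energy; positivity

theorem energy_sq {P : ℝ} (hP : 0 < P) (k : Fin 3 → ℝ) :
    energy P k ^ 2 = P + (k 0 ^ 2 + k 1 ^ 2 + k 2 ^ 2) := by
  rw [energy, Real.sq_sqrt (by positivity), Fin.sum_univ_three]

theorem shellPoint_mem {P : ℝ} (hP : 0 < P) (k : Fin 3 → ℝ) : shellPoint P k ∈ massShell P := by
  refine ⟨?_, by simpa [shellPoint] using energy_pos hP k⟩
  have := energy_sq hP k
  change energy P k * energy P k - k 0 * k 0 - k 1 * k 1 - k 2 * k 2 = P
  linarith

theorem shellPoint_tail {P : ℝ} {p : Fin 4 → ℝ} (hp : p ∈ massShell P) :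
    shellPoint P (fun j => p j.succ) = p := by
  ext j
  refine Fin.cases ?_ (fun j => ?_) j
  · obtain ⟨h1, h2⟩ := hp
    simp only [mink] at h1
    simp only [shellPoint, Fin.cons_zero, energy, Fin.sum_univ_three]
    rw [show P + ((p (Fin.succ 0)) ^ 2 + (p (Fin.succ 1)) ^ 2 + (p (Fin.succ 2)) ^ 2) = p 0 ^ 2 from by
      rw [← h1]
      change p 0 * p 0 - p 1 * p 1 - p 2 * p 2 - p 3 * p 3 + (p 1 ^ 2 + p 2 ^ 2 + p 3 ^ 2) = _
      ring]
    exact Real.sqrt_sq h2.le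
  · simp [shellPoint]

theorem massShellMeasure_eq (P : ℝ) : massShellMeasure P =
    ((volume : Measure (Fin 3 → ℝ)).withDensity
      (fun k => ENNReal.ofReal (1 / energy P k))).map (shellPoint P) := rfl

theorem lintegral_massShellMeasure (P : ℝ) {f : (Fin 4 → ℝ) → ENNReal} (hf : Measurable f) :
    ∫⁻ p, f p ∂(massShellMeasure P) =
      ∫⁻ k : Fin 3 → ℝ, ENNReal.ofReal (1 / energy P k) * f (shellPoint P k) := by
  have hs := (continuous_shellPoint P).measurable
  rw [massShellMeasure_eq, lintegral_map hf hs, lintegral_withDensity_eq_lintegral_mul]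
  · rfl
  · exact ((continuous_energy P).measurable.const_div 1).ennreal_ofReal
  · exact hf.comp hs

theorem ae_mem_massShell {P : ℝ} (hP : 0 < P) : ∀ᵐ p ∂(massShellMeasure P), p ∈ massShell P := by
  have hc : Continuous fun p : Fin 4 → ℝ => mink p p := by unfold mink; fun_prop
  have hm : MeasurableSet (massShell P) :=
    (isClosed_eq hc continuous_const).measurableSet.inter
      (isOpen_lt continuous_const (continuous_apply 0)).measurableSet
  rw [massShellMeasure_eq]
  refine (ae_map_iff (continuous_shellPoint P).measurable.aemeasurable hm).2 ?_
  exact Filter.Eventually.of_forall fun k => shellPoint_mem hP k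

theorem ae_shellPoint {P : ℝ} (hP : 0 < P) {q : (Fin 4 → ℝ) → Prop}
    (h : ∀ᵐ p ∂(massShellMeasure P), q p) : ∀ᵐ k : Fin 3 → ℝ, q (shellPoint P k) := by
  rw [massShellMeasure_eq] at h
  have h1 := ae_of_ae_map (continuous_shellPoint P).measurable.aemeasurable h
  rw [ae_withDensity_iff (((continuous_energy P).measurable.const_div 1).ennreal_ofReal)] at h1
  filter_upwards [h1] with k hk
  exact hk (by simpa using energy_pos hP k)

/-- The invariant measure has full support in the mass shell. -/
theorem eqOn_massShell_of_ae_eq {P : ℝ} (hP : 0 < P) {f g : (Fin 4 → ℝ) → ℂ}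
    (hf : ContinuousOn f (massShell P)) (hg : ContinuousOn g (massShell P))
    (h : ∀ᵐ p ∂(massShellMeasure P), f p = g p) : Set.EqOn f g (massShell P) := by
  have h1 := ae_shellPoint hP h
  have hfc : Continuous fun k => f (shellPoint P k) :=
    hf.comp_continuous (continuous_shellPoint P) (shellPoint_mem hP)
  have hgc : Continuous fun k => g (shellPoint P k) :=
    hg.comp_continuous (continuous_shellPoint P) (shellPoint_mem hP)
  have h2 := (Continuous.ae_eq_iff_eq volume hfc hgc).1 h1
  intro p hp
  have := congrFun h2 (fun j => p j.succ)
  simpa only [shellPoint_tail hp] using this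

/-- This is `x⁴ / 4! ≤ e^x` at `x = c (1 + r)`. The power `4` exceeds the dimension `3`, which makes
the bound integrable. -/
theorem exp_neg_mul_norm_le {c : ℝ} (hc : 0 < c) {r : ℝ} (hr : 0 ≤ r) :
    Real.exp (-(c * r)) ≤ 24 * Real.exp c / c ^ 4 * (1 + r) ^ (-4 : ℝ) := by
  have h := Real.pow_div_factorial_le_exp (c * (1 + r)) (by positivity) 4
  have h4 : (1 + r) ^ (-4 : ℝ) = ((1 + r) ^ 4)⁻¹ := by
    rw [Real.rpow_neg (by positivity)]; norm_cast
  have h2 : Real.exp (c * (1 + r)) = Real.exp c * Real.exp (c * r) := by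
    rw [← Real.exp_add]; ring_nf
  rw [h2, mul_pow, show ((Nat.factorial 4 : ℕ) : ℝ) = 24 by norm_num [Nat.factorial]] at h
  rw [h4, Real.exp_neg]
  have he := Real.exp_pos (c * r)
  rw [inv_le_iff_one_le_mul₀ he]
  rw [div_le_iff₀ (by norm_num)] at h
  rw [show 24 * Real.exp c / c ^ 4 * ((1 + r) ^ 4)⁻¹ * Real.exp (c * r)
    = (Real.exp c * Real.exp (c * r) * 24) / (c ^ 4 * (1 + r) ^ 4) by field_simp]
  rwa [one_le_div (by positivity)]

theorem integrable_exp_neg_mul_norm {c : ℝ} (hc : 0 < c) :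
    Integrable fun k : Fin 3 → ℝ => Real.exp (-(c * ‖k‖)) := by
  have h := (integrable_one_add_norm (E := Fin 3 → ℝ) (μ := volume) (r := 4)
    (by simp; norm_num)).const_mul (24 * Real.exp c / c ^ 4)
  refine h.mono' (by fun_prop) (Filter.Eventually.of_forall fun k => ?_)
  rw [Real.norm_eq_abs, abs_of_pos (Real.exp_pos _)]
  exact exp_neg_mul_norm_le hc (norm_nonneg k)

theorem norm_le_energy {P : ℝ} (hP : 0 < P) (k : Fin 3 → ℝ) : ‖k‖ ≤ energy P k := by
  rw [pi_norm_le_iff_of_nonneg (energy_pos hP k).le]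
  intro j
  rw [Real.norm_eq_abs, energy]
  apply Real.abs_le_sqrt
  have := Finset.single_le_sum (f := fun j => k j ^ 2) (fun i _ => sq_nonneg _) (Finset.mem_univ j)
  linarith

/-- The density `1 / p⁰` is at most `1 / √P` and `p⁰` dominates the norm of the momentum, so
exponential decay on `ℝ³` suffices. -/
theorem lintegral_exp_neg_lt_top {P : ℝ} (hP : 0 < P) {c : ℝ} (hc : 0 < c) :
    ∫⁻ p, ENNReal.ofReal (Real.exp (-(c * p 0))) ∂(massShellMeasure P) < ⊤ := by
  rw [lintegral_massShellMeasure P (by fun_prop)]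
  have h1 : ∀ k : Fin 3 → ℝ, ENNReal.ofReal (1 / energy P k) *
      ENNReal.ofReal (Real.exp (-(c * shellPoint P k 0))) ≤
      ENNReal.ofReal (1 / √P) * ENNReal.ofReal (Real.exp (-(c * ‖k‖))) := by
    intro k
    have h2 : √P ≤ energy P k := by
      unfold energy
      apply Real.sqrt_le_sqrt
      have : 0 ≤ ∑ j, k j ^ 2 := Finset.sum_nonneg fun j _ => sq_nonneg _
      linarith
    have h3 := norm_le_energy hP k
    have h4 : 0 < √P := Real.sqrt_pos.2 hP
    gcongr
    exact h3
  refine lt_of_le_of_lt (lintegral_mono h1) ?_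
  rw [lintegral_const_mul _ (by fun_prop)]
  refine ENNReal.mul_lt_top ENNReal.ofReal_lt_top ?_
  have := (integrable_exp_neg_mul_norm hc).hasFiniteIntegral
  rw [hasFiniteIntegral_iff_ofReal (Filter.Eventually.of_forall fun k => (Real.exp_pos _).le)]
    at this
  exact this

/-- On a compact set `e^{-p⁰}` is bounded below by a positive constant, and its integral is finite.
-/
theorem massShellMeasure_compact_lt_top {P : ℝ} (hP : 0 < P) {S : Set (Fin 4 → ℝ)}
    (hS : IsCompact S) : massShellMeasure P S < ⊤ := by
  obtain ⟨R, hR⟩ := hS.exists_bound_of_continuousOn (f := fun p : Fin 4 → ℝ => p 0)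
    (continuous_apply 0).continuousOn
  have h1 : ∀ p ∈ S, ENNReal.ofReal (Real.exp (-R)) ≤ ENNReal.ofReal (Real.exp (-(1 * p 0))) := by
    intro p hp
    gcongr
    have := le_trans (le_abs_self _) (hR p hp)
    linarith
  have h2 := setLIntegral_mono' hS.measurableSet h1 (μ := massShellMeasure P)
  rw [setLIntegral_const] at h2
  have h3 : ENNReal.ofReal (Real.exp (-R)) * massShellMeasure P S < ⊤ :=
    lt_of_le_of_lt (h2.trans (setLIntegral_le_lintegral _ _))
      (lintegral_exp_neg_lt_top hP one_pos)
  by_contra h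
  rw [not_lt, top_le_iff] at h
  rw [h, ENNReal.mul_top (by simpa using Real.exp_pos _)] at h3
  exact lt_irrefl _ h3

instance (P : ℝ) [h : Fact (0 < P)] : IsFiniteMeasureOnCompacts (massShellMeasure P) :=
  ⟨fun _ hS => massShellMeasure_compact_lt_top h.out hS⟩

instance (P : ℝ) [Fact (0 < P)] : SigmaFinite (massShellMeasure P) := inferInstance

instance (P : ℝ) [Fact (0 < P)] : (massShellMeasure P).Regular := inferInstance

/-! ### The invariant measure in light-cone coordinates -/

/-- The substitution `a = (m e^t - e^{-t}) / 2` is a bijection of `ℝ` with `da/dt = √(m + a²)`,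
which cancels the density. Its inverse comes from `e^{-t} = √(m + a²) - a`. -/
theorem lintegral_rapidity {m : ℝ} (hm : 0 < m) (g : ℝ → ENNReal) :
    ∫⁻ a, ENNReal.ofReal (1 / √(m + a ^ 2)) * g a =
      ∫⁻ t, g ((m * Real.exp t - Real.exp (-t)) / 2) := by
  set γ : ℝ → ℝ := fun t => (m * Real.exp t - Real.exp (-t)) / 2 with hγ
  set γ' : ℝ → ℝ := fun t => (m * Real.exp t + Real.exp (-t)) / 2 with hγ'
  have hpos : ∀ t, 0 < γ' t := fun t => by
    simp only [hγ']; positivity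
  have hd : ∀ t, HasDerivAt γ (γ' t) t := fun t => by
    have h1 := ((Real.hasDerivAt_exp t).const_mul m).sub ((Real.hasDerivAt_exp (-t)).comp t
      (hasDerivAt_neg t))
    convert! h1.div_const 2 using 1
    simp only [hγ']; ring
  have hmono : StrictMono γ := strictMono_of_hasDerivAt_pos hd hpos
  have hsq : ∀ t, √(m + γ t ^ 2) = γ' t := fun t => by
    rw [Real.sqrt_eq_iff_mul_self_eq (by positivity) (hpos t).le]
    have : Real.exp t * Real.exp (-t) = 1 := by rw [← Real.exp_add]; simp
    simp only [hγ, hγ']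
    linear_combination (-m) * this
  have hsurj : γ '' Set.univ = Set.univ := by
    rw [Set.image_univ, Set.range_eq_univ]
    intro a
    have h1 : 0 < √(m + a ^ 2) - a := by
      have : |a| < √(m + a ^ 2) := Real.lt_sqrt_of_sq_lt (by rw [sq_abs]; linarith)
      linarith [le_abs_self a]
    have h2 : (√(m + a ^ 2)) ^ 2 = m + a ^ 2 := Real.sq_sqrt (by positivity)
    refine ⟨-Real.log (√(m + a ^ 2) - a), ?_⟩
    simp only [hγ, Real.exp_neg, Real.exp_log h1]
    field_simp
    nlinarith
  have h := lintegral_image_eq_lintegral_abs_deriv_mul MeasurableSet.univ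
    (fun t _ => (hd t).hasDerivWithinAt) hmono.injective.injOn
    (fun a => ENNReal.ofReal (1 / √(m + a ^ 2)) * g a)
  rw [hsurj, Measure.restrict_univ] at h
  rw [h]
  refine lintegral_congr fun t => ?_
  rw [hsq, abs_of_pos (hpos t), ← mul_assoc, ← ENNReal.ofReal_mul (hpos t).le,
    mul_one_div_cancel (hpos t).ne', ENNReal.ofReal_one, one_mul]

theorem shellPoint_eq_lcPoint {P : ℝ} (hP : 0 < P) (x₁ x₂ t : ℝ) :
    shellPoint P ![x₁, x₂, ((P + x₁ ^ 2 + x₂ ^ 2) * Real.exp t - Real.exp (-t)) / 2] =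
      lcPoint P (Real.exp (-t)) x₁ x₂ := by
  have h := lcPoint_mem_massShell hP (Real.exp_pos (-t)) x₁ x₂
  rw [← shellPoint_tail h]
  congr 1
  ext j
  fin_cases j
  · rfl
  · rfl
  · simp [lcPoint, Real.exp_neg]

theorem measurable_lcPoint (P : ℝ) :
    Measurable fun y : (ℝ × ℝ) × ℝ => lcPoint P (Real.exp (-y.2)) y.1.1 y.1.2 := by
  rw [measurable_pi_iff]
  intro j
  fin_cases j <;> simp [lcPoint] <;> fun_prop

/-- In the coordinates `(t, x₁, x₂)` the invariant measure is Lebesgue measure. Boosts translate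
`t`, and null rotations translate `x` at fixed `t`, so both preserve it. -/
theorem lintegral_lightCone {P : ℝ} (hP : 0 < P) {f : (Fin 4 → ℝ) → ENNReal} (hf : Measurable f) :
    ∫⁻ p, f p ∂(massShellMeasure P) =
      ∫⁻ x : ℝ × ℝ, ∫⁻ t, f (lcPoint P (Real.exp (-t)) x.1 x.2) := by
  rw [lintegral_massShellMeasure P hf]
  set g : (Fin 3 → ℝ) → ENNReal :=
    fun k => ENNReal.ofReal (1 / energy P k) * f (shellPoint P k) with hg
  have hgm : Measurable g := by
    have := (continuous_energy P).measurable
    have h2 := hf.comp (continuous_shellPoint P).measurable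
    exact (this.const_div 1).ennreal_ofReal.mul h2
  have h1 := (volume_preserving_piFinSuccAbove (fun _ : Fin 3 => ℝ) 2).symm.lintegral_comp hgm
  rw [← h1]
  have hgm' := hgm.comp (MeasurableEquiv.piFinSuccAbove (fun _ : Fin 3 => ℝ) 2).symm.measurable
  change ∫⁻ y : ℝ × (Fin 2 → ℝ), (g ∘ (MeasurableEquiv.piFinSuccAbove (fun _ => ℝ) 2).symm) y = _
  rw [Measure.volume_eq_prod, lintegral_prod_symm' _ hgm']
  have h2 := (volume_preserving_finTwoArrow ℝ).symm.lintegral_comp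
    (hgm'.lintegral_prod_left' (μ := (volume : Measure ℝ)))
  rw [← h2]
  refine lintegral_congr fun x => ?_
  have h3 := lintegral_rapidity (m := P + x.1 ^ 2 + x.2 ^ 2) (by positivity)
    (fun a => f (shellPoint P ![x.1, x.2, a]))
  simp only [shellPoint_eq_lcPoint hP] at h3
  rw [← h3]
  refine lintegral_congr fun a => ?_
  have e : (MeasurableEquiv.piFinSuccAbove (fun _ : Fin 3 => ℝ) 2).symm
      (a, (MeasurableEquiv.finTwoArrow).symm x) = ![x.1, x.2, a] := by
    ext j
    fin_cases j <;> rfl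
  rw [Function.comp_apply, e, hg]
  simp only [energy, Fin.sum_univ_three, Matrix.cons_val_zero, Matrix.cons_val_one,
    Matrix.cons_val, ← add_assoc]

/-! ### Lorentz invariance -/

theorem measurable_mulVec (A : Matrix (Fin 4) (Fin 4) ℝ) :
    Measurable fun p : Fin 4 → ℝ => A *ᵥ p :=
  (Continuous.matrix_mulVec continuous_const continuous_id).measurable

theorem measurePreserving_of_lintegral {P : ℝ} (A : ProperLorentz)
    (h : ∀ f : (Fin 4 → ℝ) → ENNReal, Measurable f →
      ∫⁻ p, f (A.1 *ᵥ p) ∂(massShellMeasure P) = ∫⁻ p, f p ∂(massShellMeasure P)) :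
    MeasurePreserving (fun p => A.1 *ᵥ p) (massShellMeasure P) (massShellMeasure P) := by
  refine ⟨measurable_mulVec _, Measure.ext_of_lintegral _ fun f hf => ?_⟩
  rw [lintegral_map hf (measurable_mulVec _), h f hf]

theorem measurePreserving_boostL {P : ℝ} (hP : 0 < P) (s : ℝ) :
    MeasurePreserving (fun p => (boostL s).1 *ᵥ p) (massShellMeasure P) (massShellMeasure P) := by
  refine measurePreserving_of_lintegral _ fun f hf => ?_
  have hf' : Measurable fun p => f ((boostL s).1 *ᵥ p) := hf.comp (measurable_mulVec _)
  rw [lintegral_lightCone hP hf, lintegral_lightCone hP hf']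
  refine lintegral_congr fun x => ?_
  rw [← lintegral_sub_right_eq_self (fun t => f (lcPoint P (Real.exp (-t)) x.1 x.2)) s]
  refine lintegral_congr fun t => ?_
  rw [boostL_lcPoint, ← Real.exp_add]
  congr 3; ring

theorem measurePreserving_nullRotL {P : ℝ} (hP : 0 < P) (b₁ b₂ : ℝ) :
    MeasurePreserving (fun p => (nullRotL b₁ b₂).1 *ᵥ p) (massShellMeasure P)
      (massShellMeasure P) := by
  refine measurePreserving_of_lintegral _ fun f hf => ?_
  have hf' : Measurable fun p => f ((nullRotL b₁ b₂).1 *ᵥ p) := hf.comp (measurable_mulVec _)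
  rw [lintegral_lightCone hP hf, lintegral_lightCone hP hf',
    lintegral_lintegral_swap (f := fun (x : ℝ × ℝ) (t : ℝ) =>
      f ((nullRotL b₁ b₂).1 *ᵥ lcPoint P (Real.exp (-t)) x.1 x.2))
      (hf'.comp (measurable_lcPoint P)).aemeasurable,
    lintegral_lintegral_swap (f := fun (x : ℝ × ℝ) (t : ℝ) => f (lcPoint P (Real.exp (-t)) x.1 x.2))
      (hf.comp (measurable_lcPoint P)).aemeasurable]
  refine lintegral_congr fun t => ?_
  rw [← lintegral_add_right_eq_self (fun x : ℝ × ℝ => f (lcPoint P (Real.exp (-t)) x.1 x.2))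
    (b₁ * Real.exp (-t), b₂ * Real.exp (-t))]
  refine lintegral_congr fun x => ?_
  simp only [nullRotL_lcPoint _ _ _ (Real.exp_pos _).ne', Prod.fst_add,
    Prod.snd_add]

/-- Fixing the time axis forces the first row and column to be trivial. What remains is a spatial
matrix of determinant one that preserves the energy, hence preserves Lebesgue measure and the
density. -/
theorem measurePreserving_of_fix {P : ℝ} (hP : 0 < P) {A : ProperLorentz}
    (hA : A.1 *ᵥ ![1, 0, 0, 0] = ![1, 0, 0, 0]) :
    MeasurePreserving (fun p => A.1 *ᵥ p) (massShellMeasure P) (massShellMeasure P) := by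
  have hcol : ∀ j, A.1 j 0 = (![1, 0, 0, 0] : Fin 4 → ℝ) j := fun j => by
    rw [← hA]; simp [Matrix.mulVec, dotProduct, Fin.sum_univ_four]
  have c0 := hcol 0
  have c1 := hcol 1
  have c2 := hcol 2
  have c3 := hcol 3
  simp only [Matrix.cons_val_zero, Matrix.cons_val_one, Matrix.cons_val] at c0 c1 c2 c3
  have hrow : ∀ j, j ≠ 0 → A.1 0 j = 0 := fun j hj => by
    have h := congrFun (congrFun A.2.1 0) j
    simpa [minkMetric, Matrix.mul_apply, Fin.sum_univ_four, Matrix.diagonal_apply, c0, c1, c2, c3,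
      hj.symm] using h
  set R : Matrix (Fin 3) (Fin 3) ℝ := A.1.submatrix Fin.succ Fin.succ with hR
  have hdet : R.det = 1 := by
    have h := A.2.2.1
    rw [Matrix.det_succ_row_zero, Fin.sum_univ_succ] at h
    rw [Finset.sum_eq_zero (fun j _ => by rw [hrow _ (Fin.succ_ne_zero j)]; simp)] at h
    simpa [c0, hR] using h
  have htail : ∀ k : Fin 3 → ℝ, (fun j : Fin 3 => (A.1 *ᵥ shellPoint P k) j.succ) = R *ᵥ k := by
    intro k
    ext j
    simp only [Matrix.mulVec, dotProduct, Fin.sum_univ_succ (n := 3), shellPoint, Fin.cons_zero,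
      Fin.cons_succ, hR, Matrix.submatrix_apply]
    have : A.1 j.succ 0 = 0 := by rw [hcol]; fin_cases j <;> rfl
    rw [this, zero_mul, zero_add]
  have hact : ∀ k : Fin 3 → ℝ, A.1 *ᵥ shellPoint P k = shellPoint P (R *ᵥ k) := fun k => by
    rw [← htail, shellPoint_tail (lorentz_mem_massShell A hP (shellPoint_mem hP k))]
  have hen : ∀ k : Fin 3 → ℝ, energy P (R *ᵥ k) = energy P k := fun k => by
    have h := congrFun (hact k) 0
    have h2 : (A.1 *ᵥ shellPoint P k) 0 = energy P k := by
      simp only [Matrix.mulVec, dotProduct, Fin.sum_univ_succ (n := 3), shellPoint, Fin.cons_zero,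
        Fin.cons_succ, c0, one_mul]
      rw [Finset.sum_eq_zero (fun j _ => by rw [hrow _ (Fin.succ_ne_zero j), zero_mul]), add_zero]
    rw [h2] at h
    simpa [shellPoint] using h.symm
  have hvol : MeasurePreserving (fun k : Fin 3 → ℝ => R *ᵥ k) volume volume := by
    have h := Real.map_matrix_volume_pi_eq_smul_volume_pi (M := R) (by rw [hdet]; norm_num)
    rw [hdet] at h
    refine ⟨(Continuous.matrix_mulVec continuous_const continuous_id).measurable, ?_⟩
    convert! h using 1
    simp
  refine measurePreserving_of_lintegral _ fun f hf => ?_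
  have hf' : Measurable fun p => f (A.1 *ᵥ p) := hf.comp (measurable_mulVec _)
  rw [lintegral_massShellMeasure P hf, lintegral_massShellMeasure P hf']
  have hm : Measurable fun k => ENNReal.ofReal (1 / energy P k) * f (shellPoint P k) :=
    ((continuous_energy P).measurable.const_div 1).ennreal_ofReal.mul
      (hf.comp (continuous_shellPoint P).measurable)
  rw [← hvol.lintegral_comp hm]
  refine lintegral_congr fun k => ?_
  simp only [hact, hen]

/-- Boosts and null rotations already act transitively on the mass shell: the boost adjusts `w`, the
null rotation the transverse coordinates. -/
theorem lcPoint_eq_mulVec (P : ℝ) {w w₀ : ℝ} (hw : 0 < w) (hw₀ : 0 < w₀) (x₁ x₂ : ℝ) :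
    (nullRotL (x₁ / w) (x₂ / w) * boostL (Real.log (w / w₀))).1 *ᵥ lcPoint P w₀ 0 0 =
      lcPoint P w x₁ x₂ := by
  rw [← lorentz_mulVec_mulVec, boostL_lcPoint, Real.exp_log (by positivity),
    div_mul_cancel₀ _ hw₀.ne', nullRotL_lcPoint _ _ _ hw.ne']
  congr 1 <;> field_simp <;> ring

/-- The measure on the mass shell is Lorentz invariant. -/
theorem measurePreserving_lorentz {P : ℝ} (hP : 0 < P) (A : ProperLorentz) :
    MeasurePreserving (fun p => A.1 *ᵥ p) (massShellMeasure P) (massShellMeasure P) := by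
  have he : lcPoint (1 : ℝ) 1 0 0 = ![1, 0, 0, 0] := by
    simp [lcPoint]
  have hmem : A.1 *ᵥ lcPoint (1 : ℝ) 1 0 0 ∈ massShell 1 :=
    lorentz_mem_massShell A one_pos (lcPoint_mem_massShell one_pos one_pos _ _)
  obtain ⟨t, x₁, x₂, h⟩ := exists_eq_lcPoint one_pos hmem
  rw [← lcPoint_eq_mulVec 1 (Real.exp_pos _) one_pos] at h
  set b₁ := x₁ / Real.exp (-t)
  set b₂ := x₂ / Real.exp (-t)
  set s := Real.log (Real.exp (-t) / 1)
  -- The null rotation and the boost already move `e₀` to `A e₀`, so the remaining factor `C` fixes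
  -- `e₀`. This is an Iwasawa decomposition of `A`.
  set C := (nullRotL b₁ b₂ * boostL s)⁻¹ * A with hC
  have hfix : C.1 *ᵥ ![1, 0, 0, 0] = ![1, 0, 0, 0] := by
    rw [← he, hC, ← lorentz_mulVec_mulVec, h, lorentz_mulVec_mulVec, inv_mul_cancel,
      lorentz_coe_one, Matrix.one_mulVec]
  have hA : A = nullRotL b₁ b₂ * boostL s * C := by rw [hC, mul_inv_cancel_left]
  have := ((measurePreserving_nullRotL hP b₁ b₂).comp (measurePreserving_boostL hP s)).comp
    (measurePreserving_of_fix hP hfix)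
  convert! this using 1
  ext1 p
  simp only [Function.comp_apply, lorentz_mulVec_mulVec]
  rw [hA, mul_assoc]

theorem exists_mulVec_eq {P : ℝ} (hP : 0 < P) {p q : Fin 4 → ℝ} (hp : p ∈ massShell P)
    (hq : q ∈ massShell P) : ∃ A : ProperLorentz, A.1 *ᵥ p = q := by
  have key : ∀ {p : Fin 4 → ℝ}, p ∈ massShell P →
      ∃ A : ProperLorentz, A.1 *ᵥ lcPoint P 1 0 0 = p := by
    intro p hp
    obtain ⟨t, x₁, x₂, h⟩ := exists_eq_lcPoint hP hp
    exact ⟨_, (lcPoint_eq_mulVec P (Real.exp_pos (-t)) one_pos x₁ x₂).trans h.symm⟩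
  obtain ⟨A, hA⟩ := key hp
  obtain ⟨B, hB⟩ := key hq
  refine ⟨B * A⁻¹, ?_⟩
  rw [← hA, lorentz_mulVec_mulVec, inv_mul_cancel_right, hB]

/-! ### The representation without phases -/

/-- Agreement with an element of `L²` shows that the integrable branch of `toL2` applies and not its
default value `0`. -/
theorem toL2_eq {P : ℝ} {g : (Fin 4 → ℝ) → ℂ} {F : L2Shell P} (h : g =ᵐ[massShellMeasure P] F) :
    toL2 P g = F := by
  have hm : MemLp g 2 (massShellMeasure P) := (Lp.memLp F).ae_eq h.symm
  rw [toL2, dif_pos hm]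
  exact Lp.ext (hm.coeFn_toLp.trans h)

section rep
variable {P : ℝ} [hP : Fact (0 < P)]

/-- The natural representation of the Lorentz group on the mass shell. -/
def rep (B : ProperLorentz) : L2Shell P →ₗᵢ[ℂ] L2Shell P :=
  Lp.compMeasurePreservingₗᵢ ℂ (fun p => (B⁻¹).1 *ᵥ p) (measurePreserving_lorentz hP.out B⁻¹)

theorem rep_coeFn (B : ProperLorentz) (F : L2Shell P) :
    rep B F =ᵐ[massShellMeasure P] fun p => F ((B⁻¹).1 *ᵥ p) :=
  Lp.coeFn_compMeasurePreserving F (measurePreserving_lorentz hP.out B⁻¹)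

theorem ae_lorentz {q : (Fin 4 → ℝ) → Prop} (B : ProperLorentz)
    (h : ∀ᵐ p ∂(massShellMeasure P), q p) : ∀ᵐ p ∂(massShellMeasure P), q (B.1 *ᵥ p) :=
  (measurePreserving_lorentz hP.out B).quasiMeasurePreserving.ae h

theorem rep_mul (A B : ProperLorentz) (F : L2Shell P) : rep (A * B) F = rep A (rep B F) := by
  apply Lp.ext
  filter_upwards [rep_coeFn (A * B) F, rep_coeFn A (rep B F), ae_lorentz A⁻¹ (rep_coeFn B F)]
    with p h1 h2 h3
  rw [h1, h2, h3, lorentz_mulVec_mulVec, mul_inv_rev]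

theorem rep_one (F : L2Shell P) : rep 1 F = F := by
  apply Lp.ext
  filter_upwards [rep_coeFn 1 F] with p h1
  rw [h1, inv_one, lorentz_coe_one, Matrix.one_mulVec]

theorem rep_inv_rep (A : ProperLorentz) (F : L2Shell P) : rep A⁻¹ (rep A F) = F := by
  rw [← rep_mul, inv_mul_cancel, rep_one]

/-- The representation is strongly continuous. -/
theorem continuous_rep : Continuous fun x : ProperLorentz × L2Shell P => rep x.1 x.2 := by
  -- The linear maps depend continuously on the group element in the compact-open topology;
  -- composition with measure preserving maps is then jointly continuous on `L²`.
  have hg : Continuous fun x : ProperLorentz × L2Shell P =>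
      (⟨fun p => (x.1⁻¹).1 *ᵥ p, Continuous.matrix_mulVec continuous_const continuous_id⟩ :
        C(Fin 4 → ℝ, Fin 4 → ℝ)) := by
    apply ContinuousMap.continuous_of_continuous_uncurry
    refine Continuous.matrix_mulVec (A := fun y : (ProperLorentz × L2Shell P) × (Fin 4 → ℝ) =>
      (y.1.1⁻¹).1) ?_ continuous_snd
    exact continuous_subtype_val.comp (continuous_fst.fst.inv)
  exact continuous_snd.compMeasurePreservingLp hg
    (fun x => measurePreserving_lorentz hP.out x.1⁻¹) (by simp)

end rep

/-! ### Phase factors and the reduction to a vertex at the origin -/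

/-- The phase factor `e^{i{p, a}}`. -/
def phaseFactor (a p : Fin 4 → ℝ) : ℂ := Complex.exp (Complex.I * (mink p a : ℝ))

theorem norm_phaseFactor (a p : Fin 4 → ℝ) : ‖phaseFactor a p‖ = 1 := by
  rw [phaseFactor, mul_comm, Complex.norm_exp_ofReal_mul_I]

theorem continuous_phaseFactor (a : Fin 4 → ℝ) : Continuous (phaseFactor a) := by
  unfold phaseFactor mink; fun_prop

theorem phaseFactor_mul_neg (a p : Fin 4 → ℝ) : phaseFactor a p * phaseFactor (-a) p = 1 := by
  rw [phaseFactor, phaseFactor, ← Complex.exp_add]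
  have : mink p (-a) = -mink p a := by simp [mink]; ring
  rw [this]; push_cast; simp

theorem memLp_phase {P : ℝ} (a : Fin 4 → ℝ) (F : L2Shell P) :
    MemLp (fun p => phaseFactor a p * F p) 2 (massShellMeasure P) :=
  (Lp.memLp F).of_le ((continuous_phaseFactor a).aestronglyMeasurable.mul
    (Lp.aestronglyMeasurable F)) (Filter.Eventually.of_forall fun p => by
      rw [norm_mul, norm_phaseFactor, one_mul])

/-- Multiplication with the phase factor `e^{i{p, a}}`. -/
def phase (P : ℝ) (a : Fin 4 → ℝ) : L2Shell P →ₗᵢ[ℂ] L2Shell P where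
  toFun F := (memLp_phase a F).toLp _
  map_add' F G := by
    apply Lp.ext
    filter_upwards [(memLp_phase a (F + G)).coeFn_toLp, (memLp_phase a F).coeFn_toLp,
      (memLp_phase a G).coeFn_toLp, Lp.coeFn_add F G,
      Lp.coeFn_add ((memLp_phase a F).toLp _) ((memLp_phase a G).toLp _)] with p h1 h2 h3 h4 h5
    rw [h1, h5, Pi.add_apply, h2, h3, h4, Pi.add_apply, mul_add]
  map_smul' c F := by
    apply Lp.ext
    filter_upwards [(memLp_phase a (c • F)).coeFn_toLp, (memLp_phase a F).coeFn_toLp,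
      Lp.coeFn_smul c F, Lp.coeFn_smul c ((memLp_phase a F).toLp _)] with p h1 h2 h3 h4
    rw [RingHom.id_apply, h1, h4, Pi.smul_apply, h2, h3, Pi.smul_apply, smul_eq_mul, smul_eq_mul,
      mul_left_comm]
  norm_map' F := by
    change ‖(memLp_phase a F).toLp _‖ = ‖F‖
    apply le_antisymm <;> apply Lp.norm_le_norm_of_ae_le <;>
      filter_upwards [(memLp_phase a F).coeFn_toLp] with p h1 <;>
      rw [h1, norm_mul, norm_phaseFactor, one_mul]

theorem phase_coeFn {P : ℝ} (a : Fin 4 → ℝ) (F : L2Shell P) :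
    phase P a F =ᵐ[massShellMeasure P] fun p => phaseFactor a p * F p :=
  (memLp_phase a F).coeFn_toLp

theorem phase_phase_neg {P : ℝ} (a : Fin 4 → ℝ) (F : L2Shell P) :
    phase P a (phase P (-a) F) = F := by
  apply Lp.ext
  filter_upwards [phase_coeFn a (phase P (-a) F), phase_coeFn (-a) F] with p h1 h2
  rw [h1, h2, ← mul_assoc, phaseFactor_mul_neg, one_mul]

theorem phase_neg_phase {P : ℝ} (a : Fin 4 → ℝ) (F : L2Shell P) :
    phase P (-a) (phase P a F) = F := by
  have := phase_phase_neg (-a) F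
  rwa [neg_neg] at this

section boostRep
variable {P : ℝ} [hP : Fact (0 < P)]

theorem mink_inv_mulVec (B : ProperLorentz) (p a : Fin 4 → ℝ) :
    mink p (B.1 *ᵥ a) = mink ((B⁻¹).1 *ᵥ p) a := by
  rw [← lorentz_mink B ((B⁻¹).1 *ᵥ p) a, lorentz_mulVec_mulVec, mul_inv_cancel, lorentz_coe_one,
    Matrix.one_mulVec]

/-- Conjugation by the translation to `a` reduces the group to the one at the origin. This is the
source of the factor `e^{i{p, a}}` in the final formula. -/
theorem boostRep_eq (a : Fin 4 → ℝ) (A : ProperLorentz) (t : ℝ) (φ : L2Shell P) :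
    boostRep P a A t φ = phase P a (rep (boostConj A t) (phase P (-a) φ)) := by
  set B := boostConj A t with hB
  change toL2 P (fun p => Complex.exp (Complex.I * (mink p ((1 - B.1) *ᵥ a) : ℝ)) *
    φ (B.1⁻¹ *ᵥ p)) = _
  apply toL2_eq
  filter_upwards [phase_coeFn a (rep B (phase P (-a) φ)), rep_coeFn B (phase P (-a) φ),
    ae_lorentz B⁻¹ (phase_coeFn (-a) φ)] with p h1 h2 h3
  rw [h1, h2, h3, ← mul_assoc, phaseFactor, phaseFactor, ← Complex.exp_add, ← lorentz_coe_inv]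
  congr 2
  rw [Matrix.sub_mulVec, Matrix.one_mulVec, mink_sub_right, mink_inv_mulVec]
  have : mink ((B⁻¹).1 *ᵥ p) (-a) = -mink ((B⁻¹).1 *ᵥ p) a := by simp [mink]; ring
  rw [this]; push_cast; ring

theorem isProperLorentz_rotPi : IsProperLorentz rotPi := by
  refine ⟨?_, ?_, ?_⟩
  · simp only [rotPi, minkMetric, Matrix.diagonal_transpose, Matrix.diagonal_mul_diagonal]
    congr 1; ext i; fin_cases i <;> simp
  · simp [rotPi, Matrix.det_diagonal, Fin.prod_univ_four]
  · simp [rotPi]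

/-- The rotation by `π` as an element of the Lorentz group. -/
def rotPiL : ProperLorentz := ⟨rotPi, isProperLorentz_rotPi⟩

/-- Complex conjugation turns the inner phase `e^{-i{·, a}}` into `e^{i{·, a}}`. Therefore the
translation part carries `1 + A Υ A⁻¹`, with a plus sign. -/
theorem modularConj_eq (a : Fin 4 → ℝ) (A : ProperLorentz) (φ : L2Shell P) :
    modularConj P a A φ = phase P a (star (rep (A * rotPiL * A⁻¹) (phase P (-a) φ))) := by
  set B := A * rotPiL * A⁻¹ with hB
  have hpct : pct P φ = star φ := by
    apply toL2_eq
    filter_upwards [Lp.coeFn_star φ] with p h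
    rw [h]; rfl
  change toL2 P (fun p => Complex.exp (Complex.I * (mink p ((1 + B.1) *ᵥ a) : ℝ)) *
    (pct P φ) (B.1⁻¹ *ᵥ p)) = _
  apply toL2_eq
  rw [hpct]
  filter_upwards [phase_coeFn a (star (rep B (phase P (-a) φ))), rep_coeFn B (phase P (-a) φ),
    Lp.coeFn_star (rep B (phase P (-a) φ)),
    ae_lorentz B⁻¹ (phase_coeFn (-a) φ), ae_lorentz B⁻¹ (Lp.coeFn_star φ)] with p h1 h2 h3 h4 h5
  rw [h1, h3, Pi.star_apply, h2, h4, ← lorentz_coe_inv, h5, Pi.star_apply, star_mul', ← mul_assoc]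
  congr 1
  have h6 : star (phaseFactor (-a) ((B⁻¹).1 *ᵥ p)) =
      Complex.exp (Complex.I * (mink ((B⁻¹).1 *ᵥ p) a : ℝ)) := by
    have : mink ((B⁻¹).1 *ᵥ p) (-a) = -mink ((B⁻¹).1 *ᵥ p) a := by simp [mink]; ring
    rw [phaseFactor, this, Complex.star_def, ← Complex.exp_conj]
    simp
  rw [h6, phaseFactor, ← Complex.exp_add, Matrix.add_mulVec, Matrix.one_mulVec, mink_add_right,
    mink_inv_mulVec]
  congr 1; push_cast; ring

end boostRep

/-! ### Analytic continuation of one-parameter groups of isometries -/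

open Filter in
/-- A bounded holomorphic function on a closed strip is bounded by its boundary values. -/
theorem norm_le_of_strip {E : Type*} [NormedAddCommGroup E] [NormedSpace ℂ E] {f : ℂ → E} {b C B : ℝ}
    (hb : 0 < b) (hc : ContinuousOn f {z | 0 ≤ z.im ∧ z.im ≤ b})
    (hd : DifferentiableOn ℂ f {z | 0 < z.im ∧ z.im < b})
    (hB : ∀ z : ℂ, 0 ≤ z.im → z.im ≤ b → ‖f z‖ ≤ B) (h0 : ∀ t : ℝ, ‖f t‖ ≤ C)
    (h1 : ∀ t : ℝ, ‖f (t + Complex.I * b)‖ ≤ C) {z : ℂ} (hz0 : 0 ≤ z.im) (hz1 : z.im ≤ b) :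
    ‖f z‖ ≤ C := by
  have hcl : closure (Complex.im ⁻¹' Set.Ioo 0 b) ⊆ {z | 0 ≤ z.im ∧ z.im ≤ b} :=
    closure_minimal (fun z hz => ⟨hz.1.le, hz.2.le⟩)
      ((isClosed_le continuous_const Complex.continuous_im).inter
        (isClosed_le Complex.continuous_im continuous_const))
  -- The function is bounded, so the growth condition holds with exponent zero.
  refine PhragmenLindelof.horizontal_strip (a := 0) (b := b) ⟨hd, hc.mono hcl⟩
    ⟨0, by rw [sub_zero]; positivity, 0, ?_⟩ ?_ ?_ hz0 hz1
  · apply Asymptotics.IsBigO.of_bound B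
    refine eventually_inf_principal.2 (Eventually.of_forall fun w hw => ?_)
    simpa using hB w hw.1.le hw.2.le
  · intro w hw
    have : w = (w.re : ℂ) := by apply Complex.ext <;> simp [hw]
    rw [this]; exact h0 _
  · intro w hw
    have : w = (w.re : ℂ) + Complex.I * b := by apply Complex.ext <;> simp [hw]
    rw [this]; exact h1 _

section Group
variable {H : Type*} [NormedAddCommGroup H] [NormedSpace ℂ H]

/-- `f` is an entire extension of an orbit of the one-parameter group `U`. -/
structure IsEntireOrbit (U : ℝ → H →ₗᵢ[ℂ] H) (f : ℂ → H) : Prop where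
  differentiable : Differentiable ℂ f
  apply_real : ∀ t : ℝ, f t = U t (f 0)

variable {U : ℝ → H →ₗᵢ[ℂ] H}

theorem IsEntireOrbit.sub {f g : ℂ → H} (hf : IsEntireOrbit U f) (hg : IsEntireOrbit U g) :
    IsEntireOrbit U (fun z => f z - g z) :=
  ⟨hf.differentiable.sub hg.differentiable, fun t => by
    rw [hf.apply_real, hg.apply_real, map_sub]⟩

theorem mem_graph_of_orbits {τ : ℂ} {x y : H} {f : ℕ → ℂ → H} (hf : ∀ n, IsEntireOrbit U (f n))
    (h0 : Filter.Tendsto (fun n => f n 0) Filter.atTop (nhds x))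
    (h1 : Filter.Tendsto (fun n => f n τ) Filter.atTop (nhds y)) :
    (x, y) ∈ complexGroupGraph (fun t v => U t v) τ :=
  mem_closure_iff_seq_limit.2 ⟨fun n => (f n 0, f n τ),
    fun n => ⟨f n, (hf n).differentiable, (hf n).apply_real, rfl⟩, h0.prodMk_nhds h1⟩

open Filter Topology in
theorem exists_orbits_of_mem_graph {τ : ℂ} {x y : H}
    (h : (x, y) ∈ complexGroupGraph (fun t v => U t v) τ) (hU0 : ∀ v, U 0 v = v) :
    ∃ f : ℕ → ℂ → H, (∀ n, IsEntireOrbit U (f n)) ∧ Tendsto (fun n => f n 0) atTop (𝓝 x) ∧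
      Tendsto (fun n => f n τ) atTop (𝓝 y) := by
  obtain ⟨a, ha, hlim⟩ := mem_closure_iff_seq_limit.1 h
  choose f hf1 hf2 hf3 using ha
  have h0 : ∀ n, f n 0 = (a n).1 := fun n => by
    have := hf2 n 0; rw [Complex.ofReal_zero] at this; exact this.trans (hU0 _)
  refine ⟨f, fun n => ⟨hf1 n, fun t => by rw [hf2, h0]⟩, ?_, ?_⟩
  · simp only [h0]; exact (continuous_fst.tendsto _).comp hlim
  · simp only [hf3]; exact (continuous_snd.tendsto _).comp hlim

variable [CompleteSpace H]

/-- Both sides are entire in `τ` and agree on the real axis, which accumulates at `0`. -/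
theorem IsEntireOrbit.add_real (hU : ∀ s t x, U (s + t) x = U s (U t x)) {f : ℂ → H}
    (hf : IsEntireOrbit U f) (τ : ℂ) (t : ℝ) : f (τ + t) = U t (f τ) := by
  have h1 : AnalyticOnNhd ℂ (fun τ : ℂ => f (τ + t)) Set.univ :=
    (hf.differentiable.comp (differentiable_id.add_const _)).differentiableOn.analyticOnNhd isOpen_univ
  have h2 : AnalyticOnNhd ℂ (fun τ : ℂ => U t (f τ)) Set.univ :=
    ((U t).toContinuousLinearMap.differentiable.comp
      hf.differentiable).differentiableOn.analyticOnNhd isOpen_univ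
  have hfr : ∃ᶠ z in nhdsWithin (0 : ℂ) {0}ᶜ, f (z + t) = U t (f z) := by
    have hreal : ∀ s : ℝ, f ((s : ℂ) + t) = U t (f s) := fun s => by
      rw [← Complex.ofReal_add, hf.apply_real, add_comm, hU, ← hf.apply_real s]
    have ht : Filter.Tendsto (fun n : ℕ => (((1 : ℝ) / ((n : ℝ) + 1) : ℝ) : ℂ)) Filter.atTop
        (nhdsWithin (0 : ℂ) {0}ᶜ) := by
      rw [tendsto_nhdsWithin_iff]
      constructor
      · have := (Complex.continuous_ofReal.tendsto 0).comp
          (tendsto_one_div_add_atTop_nhds_zero_nat (𝕜 := ℝ))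
        rw [Complex.ofReal_zero] at this
        exact this
      · refine Filter.Eventually.of_forall fun n => ?_
        simp only [Set.mem_compl_iff, Set.mem_singleton_iff, Complex.ofReal_eq_zero]
        positivity
    exact ht.frequently (Filter.Frequently.of_forall fun n => hreal _)
  exact congrFun (AnalyticOnNhd.eq_of_frequently_eq h1 h2 hfr) τ

/-- Real translations act isometrically. So the norm depends only on `Im τ`, and an entire orbit is
bounded on every closed horizontal strip of finite width. -/
theorem IsEntireOrbit.norm_eq (hU : ∀ s t x, U (s + t) x = U s (U t x)) {f : ℂ → H}
    (hf : IsEntireOrbit U f) (τ : ℂ) : ‖f τ‖ = ‖f (Complex.I * τ.im)‖ := by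
  rw [show τ = Complex.I * τ.im + τ.re by apply Complex.ext <;> simp, hf.add_real hU,
    LinearIsometry.norm_map]
  simp

theorem IsEntireOrbit.exists_bound (hU : ∀ s t x, U (s + t) x = U s (U t x)) {f : ℂ → H}
    (hf : IsEntireOrbit U f) (b : ℝ) : ∃ B, ∀ z : ℂ, 0 ≤ z.im → z.im ≤ b → ‖f z‖ ≤ B := by
  have hc : Continuous fun s : ℝ => f (Complex.I * s) :=
    hf.differentiable.continuous.comp (by fun_prop)
  obtain ⟨B, hB⟩ := (isCompact_Icc (a := (0 : ℝ)) (b := b)).exists_bound_of_continuousOn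
    hc.continuousOn
  exact ⟨B, fun z h0 h1 => by rw [hf.norm_eq hU]; exact hB _ ⟨h0, h1⟩⟩

theorem IsEntireOrbit.norm_le (hU : ∀ s t x, U (s + t) x = U s (U t x)) {f : ℂ → H}
    (hf : IsEntireOrbit U f) {b C : ℝ} (hb : 0 < b) (h0 : ‖f 0‖ ≤ C) (h1 : ‖f (Complex.I * b)‖ ≤ C)
    {z : ℂ} (hz0 : 0 ≤ z.im) (hz1 : z.im ≤ b) : ‖f z‖ ≤ C := by
  obtain ⟨B, hB⟩ := hf.exists_bound hU b
  refine norm_le_of_strip hb hf.differentiable.continuous.continuousOn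
    hf.differentiable.differentiableOn hB (fun t => ?_) (fun t => ?_) hz0 hz1
  · rw [hf.norm_eq hU]; simpa using h0
  · rw [hf.norm_eq hU]; simpa using h1

/-- Hadamard's three lines theorem, with the horizontal strip turned into a vertical one by `z ↦ i
z`. -/
theorem IsEntireOrbit.norm_interp (hU : ∀ s t x, U (s + t) x = U s (U t x)) {f : ℂ → H}
    (hf : IsEntireOrbit U f) {b s : ℝ} (hb : 0 < b) (h0 : 0 ≤ s) (h1 : s ≤ b) :
    ‖f (Complex.I * s)‖ ≤ ‖f 0‖ ^ (1 - s / b) * ‖f (Complex.I * b)‖ ^ (s / b) := by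
  have hg : Differentiable ℂ fun z : ℂ => f (Complex.I * z) :=
    hf.differentiable.comp (by fun_prop)
  have him : ∀ z : ℂ, (Complex.I * z).im = z.re := fun z => by simp
  have key := Complex.HadamardThreeLines.norm_le_interp_of_mem_verticalClosedStrip'
    (f := fun z : ℂ => f (Complex.I * z)) (z := s) (a := ‖f 0‖) (b := ‖f (Complex.I * b)‖) hb
    (by simp [Complex.HadamardThreeLines.verticalClosedStrip, h0, h1]) hg.diffContOnCl ?_ ?_ ?_
  · simpa using key
  · obtain ⟨B, hB⟩ := hf.exists_bound hU b
    refine ⟨B, ?_⟩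
    rintro _ ⟨z, hz, rfl⟩
    exact hB _ (by rw [him]; exact hz.1) (by rw [him]; exact hz.2)
  · intro z hz
    rw [hf.norm_eq hU, him, show z.re = 0 from hz]; simp
  · intro z hz
    rw [hf.norm_eq hU, him, show z.re = b from hz]

open Filter Topology in
/-- The closure of the graph of `U(i b)` is the graph of a map. -/
theorem limit_eq_zero_of_orbits (hU : ∀ s t x, U (s + t) x = U s (U t x)) {d : ℕ → ℂ → H}
    (hd : ∀ n, IsEntireOrbit U (d n)) {b : ℝ} (hb : 0 ≤ b) {w : H}
    (h0 : Tendsto (fun n => d n 0) atTop (𝓝 0))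
    (h1 : Tendsto (fun n => d n (Complex.I * b)) atTop (𝓝 w)) : w = 0 := by
  rcases hb.eq_or_lt with rfl | hb
  · simp only [Complex.ofReal_zero, mul_zero] at h1
    exact tendsto_nhds_unique h1 h0
  rw [← norm_le_zero_iff]
  refine le_of_forall_pos_le_add fun ε hε => ?_
  have c0 := Metric.cauchySeq_iff.1 h0.cauchySeq (ε / 4) (by positivity)
  have c1 := Metric.cauchySeq_iff.1 h1.cauchySeq (ε / 4) (by positivity)
  obtain ⟨N0, hN0⟩ := c0
  obtain ⟨N1, hN1⟩ := c1
  set N := max N0 N1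
  -- Values at `0` and at `i b` control the whole closed segment, so convergence at the ends gives a
  -- uniform Cauchy property.
  have hclose : ∀ m ≥ N, ∀ s : ℝ, 0 ≤ s → s ≤ b →
      ‖d m (Complex.I * s) - d N (Complex.I * s)‖ ≤ ε / 4 := by
    intro m hm s hs0 hs1
    refine ((hd m).sub (hd N)).norm_le hU hb ?_ ?_ (by simpa) (by simpa)
    · rw [← dist_eq_norm]
      exact (hN0 m ((le_max_left _ _).trans hm) N (le_max_left _ _)).le
    · rw [← dist_eq_norm]
      exact (hN1 m ((le_max_right _ _).trans hm) N (le_max_right _ _)).le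
  have hcont : Continuous fun s : ℝ => d N (Complex.I * s) :=
    (hd N).differentiable.continuous.comp (by fun_prop)
  -- At a height `s` strictly below `b` the interpolation exponent `1 - s / b` of `‖d n 0‖` is
  -- positive, so `d n (i s)` tends to zero. The choice of `s` near `b` makes the fixed orbit `d N`
  -- change little between `s` and `b`.
  obtain ⟨s, hs0, hsb, hs⟩ : ∃ s : ℝ, 0 ≤ s ∧ s < b ∧
      ‖d N (Complex.I * (b : ℂ)) - d N (Complex.I * s)‖ ≤ ε / 4 := by
    have e1 : ∀ᶠ s : ℝ in 𝓝[<] b, dist (d N (Complex.I * s)) (d N (Complex.I * b)) < ε / 4 :=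
      (hcont.continuousAt.mono_left nhdsWithin_le_nhds).eventually
        (Metric.ball_mem_nhds _ (by positivity))
    have e2 : ∀ᶠ s in 𝓝[<] b, 0 ≤ s ∧ s < b := by
      filter_upwards [Ioo_mem_nhdsLT hb] with s hs using ⟨hs.1.le, hs.2⟩
    obtain ⟨s, h1, h2, h3⟩ := (e1.and e2).exists
    exact ⟨s, h2, h3, by rw [← dist_eq_norm, dist_comm]; exact h1.le⟩
  have hlim : Tendsto (fun n => ‖d n (Complex.I * s)‖) atTop (𝓝 0) := by
    have hp : 0 < 1 - s / b := by rw [sub_pos, div_lt_one hb]; exact hsb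
    have e1 : Tendsto (fun n => ‖d n 0‖ ^ (1 - s / b)) atTop (𝓝 0) := by
      have := h0.norm.rpow_const (p := 1 - s / b) (Or.inr hp.le)
      rwa [norm_zero, Real.zero_rpow hp.ne'] at this
    have e2 : Tendsto (fun n => ‖d n (Complex.I * b)‖ ^ (s / b)) atTop (𝓝 (‖w‖ ^ (s / b))) :=
      h1.norm.rpow_const (Or.inr (by positivity))
    have e3 := e1.mul e2
    rw [zero_mul] at e3
    exact squeeze_zero (fun _ => norm_nonneg _) (fun n => (hd n).norm_interp hU hb hs0 hsb.le) e3
  have hle : ∀ᶠ n in atTop, ‖d n (Complex.I * b)‖ ≤ ‖d n (Complex.I * s)‖ + 3 * (ε / 4) := by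
    filter_upwards [eventually_ge_atTop N] with n hn
    have a1 := hclose n hn b hb.le le_rfl
    have a2 := hclose n hn s hs0 hsb.le
    have a3 : d n (Complex.I * b) = d n (Complex.I * s) + ((d n (Complex.I * b) - d N (Complex.I * b))
      + (d N (Complex.I * b) - d N (Complex.I * s)) - (d n (Complex.I * s) - d N (Complex.I * s))) := by
      abel
    calc ‖d n (Complex.I * b)‖ ≤ ‖d n (Complex.I * s)‖ + (‖d n (Complex.I * b) - d N (Complex.I * b)‖
      + ‖d N (Complex.I * b) - d N (Complex.I * s)‖ + ‖d n (Complex.I * s) - d N (Complex.I * s)‖) := by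
          conv_lhs => rw [a3]
          refine (norm_add_le _ _).trans ?_
          gcongr
          refine (norm_sub_le _ _).trans ?_
          gcongr
          exact norm_add_le _ _
      _ ≤ _ := by linarith
  have := le_of_tendsto_of_tendsto h1.norm (hlim.add_const (3 * (ε / 4))) hle
  linarith

/-- `U(τ)` is a well-defined closed operator. -/
theorem complexGroupGraph_unique (hU0 : ∀ v, U 0 v = v) (hU : ∀ s t x, U (s + t) x = U s (U t x))
    {τ : ℂ} (hτ : 0 ≤ τ.im) {x y y' : H} (h : (x, y) ∈ complexGroupGraph (fun t v => U t v) τ)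
    (h' : (x, y') ∈ complexGroupGraph (fun t v => U t v) τ) : y = y' := by
  obtain ⟨f, hf, hf0, hf1⟩ := exists_orbits_of_mem_graph h hU0
  obtain ⟨g, hg, hg0, hg1⟩ := exists_orbits_of_mem_graph h' hU0
  have hd : ∀ n, IsEntireOrbit U (fun z => f n z - g n z) := fun n => (hf n).sub (hg n)
  -- The isometry `U(-Re τ)` brings the value at `τ` to the imaginary axis.
  have h2 : ∀ n, f n (Complex.I * τ.im) - g n (Complex.I * τ.im) = U (-τ.re) (f n τ - g n τ) := by
    intro n
    rw [← (hd n).add_real hU]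
    congr 2 <;> apply Complex.ext <;> simp
  have h3 := limit_eq_zero_of_orbits hU hd hτ (w := U (-τ.re) (y - y'))
    (by have := hf0.sub hg0; rwa [sub_self] at this) (by
      simp only [h2]
      exact ((U (-τ.re)).continuous.tendsto _).comp (hf1.sub hg1))
  rw [← sub_eq_zero, ← norm_eq_zero, ← (U (-τ.re)).norm_map, h3, norm_zero]

open Filter Topology in
/-- If `x` is in the domain of `U(i b)` then the orbit of `x` extends to the strip of width `b`. -/
theorem exists_strip_extension (hU0 : ∀ v, U 0 v = v) (hU : ∀ s t x, U (s + t) x = U s (U t x))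
    {b : ℝ} (hb : 0 < b) {x y : H}
    (h : (x, y) ∈ complexGroupGraph (fun t v => U t v) (Complex.I * b)) :
    ∃ F : ℂ → H, ContinuousOn F {z | 0 ≤ z.im ∧ z.im ≤ b} ∧
      DifferentiableOn ℂ F {z | 0 < z.im ∧ z.im < b} ∧ (∀ t : ℝ, F t = U t x) ∧
      (∀ t : ℝ, F (t + Complex.I * b) = U t y) ∧
      (∀ z : ℂ, 0 ≤ z.im → z.im ≤ b → ∀ t : ℝ, F (z + t) = U t (F z)) ∧
      (∀ z : ℂ, 0 ≤ z.im → z.im ≤ b → (x, F z) ∈ complexGroupGraph (fun t v => U t v) z) ∧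
      ∀ z : ℂ, 0 ≤ z.im → z.im ≤ b → ‖F z‖ ≤ max ‖x‖ ‖y‖ := by
  obtain ⟨f, hf, hf0, hf1⟩ := exists_orbits_of_mem_graph h hU0
  set S : Set ℂ := {z | 0 ≤ z.im ∧ z.im ≤ b} with hS
  -- Differences of entire orbits are bounded on the closed strip by their values at `0` and `i b`,
  -- and both sequences of values converge.
  have huc : UniformCauchySeqOn f atTop S := by
    rw [Metric.uniformCauchySeqOn_iff]
    intro ε hε
    obtain ⟨N0, hN0⟩ := Metric.cauchySeq_iff.1 hf0.cauchySeq (ε / 2) (by positivity)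
    obtain ⟨N1, hN1⟩ := Metric.cauchySeq_iff.1 hf1.cauchySeq (ε / 2) (by positivity)
    refine ⟨max N0 N1, fun m hm n hn z hz => ?_⟩
    have := ((hf m).sub (hf n)).norm_le hU hb (C := ε / 2)
      (by rw [← dist_eq_norm]
          exact (hN0 m ((le_max_left _ _).trans hm) n ((le_max_left _ _).trans hn)).le)
      (by rw [← dist_eq_norm]
          exact (hN1 m ((le_max_right _ _).trans hm) n ((le_max_right _ _).trans hn)).le) hz.1 hz.2
    rw [dist_eq_norm]; linarith
  have hex : ∀ z, ∃ w, z ∈ S → Tendsto (fun n => f n z) atTop (𝓝 w) := by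
    intro z
    by_cases hz : z ∈ S
    · obtain ⟨w, hw⟩ := cauchySeq_tendsto_of_complete (huc.cauchySeq hz)
      exact ⟨w, fun _ => hw⟩
    · exact ⟨0, fun h => absurd h hz⟩
  choose F hF using hex
  have hunif : TendstoUniformlyOn f F atTop S :=
    huc.tendstoUniformlyOn_of_tendsto fun z hz => hF z hz
  have hadd : ∀ z ∈ S, ∀ t : ℝ, F (z + t) = U t (F z) := by
    intro z hz t
    have hzt : z + t ∈ S := by simpa [hS] using hz
    refine tendsto_nhds_unique (hF _ hzt) ?_
    simp only [(hf _).add_real hU]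
    exact ((U t).continuous.tendsto _).comp (hF z hz)
  have m0 : (0 : ℂ) ∈ S := by simp [hS, hb.le]
  have mb : (Complex.I * b : ℂ) ∈ S := by simp [hS, hb.le]
  have hF0 : F 0 = x := tendsto_nhds_unique (hF 0 m0) hf0
  have hFb : F (Complex.I * b) = y := tendsto_nhds_unique (hF _ mb) hf1
  refine ⟨F, ?_, ?_, ?_, ?_, fun z h0 h1 => hadd z ⟨h0, h1⟩, ?_, ?_⟩
  · exact hunif.continuousOn (Frequently.of_forall fun n =>
      (hf n).differentiable.continuous.continuousOn)
  · have ho : IsOpen {z : ℂ | 0 < z.im ∧ z.im < b} :=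
      (isOpen_lt continuous_const Complex.continuous_im).inter
        (isOpen_lt Complex.continuous_im continuous_const)
    exact (hunif.mono fun z hz => ⟨hz.1.le, hz.2.le⟩).tendstoLocallyUniformlyOn.differentiableOn
      (Eventually.of_forall fun n => (hf n).differentiable.differentiableOn) ho
  · intro t
    rw [← hF0, ← hadd 0 m0 t, zero_add]
  · intro t
    rw [← hFb, ← hadd _ mb t, add_comm]
  · intro z h0 h1
    exact mem_graph_of_orbits hf hf0 (hF z ⟨h0, h1⟩)
  · intro z h0 h1
    refine le_of_tendsto_of_tendsto (hF z ⟨h0, h1⟩).norm (hf0.norm.max hf1.norm)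
      (Eventually.of_forall fun n => ?_)
    exact (hf n).norm_le hU hb (le_max_left _ _) (le_max_right _ _) h0 h1

end Group

open Filter Topology in
/-- Continuity in a parameter on the boundary of a strip implies continuity in the strip. -/
theorem continuousOn_strip_of_boundary {H Y : Type*} [NormedAddCommGroup H] [NormedSpace ℂ H]
    [TopologicalSpace Y] {X : Set Y} {b C : ℝ} (hb : 0 < b) {F : Y → ℂ → H} {u₀ u₁ : Y → ℝ → H}
    (hc : ∀ A ∈ X, ContinuousOn (F A) {z | 0 ≤ z.im ∧ z.im ≤ b})
    (hd : ∀ A ∈ X, DifferentiableOn ℂ (F A) {z | 0 < z.im ∧ z.im < b})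
    (hB : ∀ A ∈ X, ∀ z : ℂ, 0 ≤ z.im → z.im ≤ b → ‖F A z‖ ≤ C)
    (h0 : ∀ A ∈ X, ∀ t : ℝ, F A t = u₀ A t)
    (h1 : ∀ A ∈ X, ∀ t : ℝ, F A (t + Complex.I * b) = u₁ A t)
    (hu₀ : Continuous fun x : Y × ℝ => u₀ x.1 x.2) (hu₁ : Continuous fun x : Y × ℝ => u₁ x.1 x.2) :
    ContinuousOn (fun x : Y × ℂ => F x.1 x.2) {x | x.1 ∈ X ∧ 0 ≤ x.2.im ∧ x.2.im ≤ b} := by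
  rintro ⟨A₀, τ₀⟩ ⟨hA₀, hτ0, hτ1⟩
  have hC : 0 ≤ C := (norm_nonneg _).trans (hB A₀ hA₀ τ₀ hτ0 hτ1)
  -- Joint continuity of the boundary values is uniform only on compact intervals of `t`; the tails
  -- need separate treatment.
  have hunif : ∀ {u : Y → ℝ → H}, Continuous (fun x : Y × ℝ => u x.1 x.2) → ∀ R ε : ℝ, 0 < ε →
      ∀ᶠ A in 𝓝 A₀, ∀ t ∈ Set.Icc (-R) R, ‖u A t - u A₀ t‖ ≤ ε := by
    intro u hu R ε hε
    refine isCompact_Icc.eventually_forall_of_forall_eventually fun t _ => ?_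
    have hcont : Continuous fun x : Y × ℝ => ‖u x.1 x.2 - u A₀ x.2‖ :=
      (hu.sub (hu.comp (by fun_prop : Continuous fun x : Y × ℝ => (A₀, x.2)))).norm
    have : ‖u A₀ t - u A₀ t‖ < ε := by simpa using hε
    have h := (hcont.tendsto (A₀, t)).eventually (gt_mem_nhds this)
    filter_upwards [h] with z hz using hz.le
  have key : ∀ ε : ℝ, 0 < ε → ∀ᶠ A in 𝓝 A₀, A ∈ X → ∀ τ : ℂ, 0 ≤ τ.im → τ.im ≤ b →
      |τ.re - τ₀.re| ≤ 1 → ‖F A τ - F A₀ τ‖ ≤ ε := by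
    intro ε hε
    set t₀ := τ₀.re
    -- The Gaussian `exp(-(z - t₀)²)` makes the boundary contribution outside `[-R, R]` negligible,
    -- because the functions themselves are bounded by `C`.
    obtain ⟨R, hR0, hR⟩ : ∃ R : ℝ, 0 ≤ R ∧ ∀ t : ℝ, t ∉ Set.Icc (-R) R →
        Real.exp (-(t - t₀) ^ 2 + b ^ 2) * (2 * C) ≤ Real.exp (-1) * ε := by
      have hlim : Tendsto (fun t : ℝ => Real.exp (-(t - t₀) ^ 2 + b ^ 2) * (2 * C))
          (cocompact ℝ) (𝓝 0) := by
        have e1 : Tendsto (fun t : ℝ => (t - t₀) ^ 2) (cocompact ℝ) atTop := by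
          have e2 : Tendsto (fun t : ℝ => t - t₀) (cocompact ℝ) (cocompact ℝ) :=
            (Homeomorph.subRight t₀).isClosedEmbedding.tendsto_cocompact
          have e3 : Tendsto (fun t : ℝ => |t| ^ 2) (cocompact ℝ) atTop :=
            (tendsto_pow_atTop two_ne_zero).comp tendsto_norm_cocompact_atTop
          simp only [sq_abs] at e3
          exact e3.comp e2
        have e4 : Tendsto (fun t : ℝ => -(t - t₀) ^ 2 + b ^ 2) (cocompact ℝ) atBot :=
          tendsto_atBot_add_const_right _ _ (tendsto_neg_atTop_atBot.comp e1)
        have := (Real.tendsto_exp_atBot.comp e4).mul_const (2 * C)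
        simpa using this
      have hev := hlim.eventually (gt_mem_nhds (show (0 : ℝ) < Real.exp (-1) * ε by positivity))
      rw [Filter.Eventually, mem_cocompact] at hev
      obtain ⟨S, hS, hSsub⟩ := hev
      obtain ⟨R, hR⟩ := hS.isBounded.exists_norm_le
      refine ⟨max R 0, le_max_right _ _, fun t ht => (hSsub (fun hts => ht ?_) :).le⟩
      have := abs_le.1 ((hR t hts).trans (le_max_left R 0))
      exact ⟨this.1, this.2⟩
    -- On both boundary lines the Gaussian has modulus at most `e^{b²}`; at the points of interest,
    -- where `|Re τ - t₀| ≤ 1`, it has modulus at least `e^{-1}`.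
    set δ := Real.exp (-1) * ε / Real.exp (b ^ 2) with hδ
    have hδ0 : 0 < δ := by positivity
    filter_upwards [hunif hu₀ R δ hδ0, hunif hu₁ R δ hδ0] with A hA0 hA1 hAX τ hτ0 hτ1 hτ
    have hbound : ∀ (u : Y → ℝ → H), (∀ t ∈ Set.Icc (-R) R, ‖u A t - u A₀ t‖ ≤ δ) →
        (∀ t, ‖u A t - u A₀ t‖ ≤ 2 * C) → ∀ t : ℝ, ∀ c : ℝ, c ^ 2 ≤ b ^ 2 →
        Real.exp (-(t - t₀) ^ 2 + c ^ 2) * ‖u A t - u A₀ t‖ ≤ Real.exp (-1) * ε := by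
      intro u h1 h2 t c hc
      by_cases ht : t ∈ Set.Icc (-R) R
      · calc Real.exp (-(t - t₀) ^ 2 + c ^ 2) * ‖u A t - u A₀ t‖ ≤ Real.exp (b ^ 2) * δ := by
              gcongr
              · nlinarith [sq_nonneg (t - t₀)]
              · exact h1 t ht
          _ = _ := by rw [hδ]; field_simp
      · refine le_trans ?_ (hR t ht)
        gcongr
        exact h2 t
    have hdiff : ∀ z : ℂ, 0 ≤ z.im → z.im ≤ b → ‖F A z - F A₀ z‖ ≤ 2 * C := fun z h0 h1 => by
      have := norm_sub_le (F A z) (F A₀ z)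
      linarith [hB A hAX z h0 h1, hB A₀ hA₀ z h0 h1]
    have hnorm : ∀ z : ℂ, ‖Complex.exp (-(z - t₀) ^ 2)‖ =
        Real.exp (-(z.re - t₀) ^ 2 + z.im ^ 2) := fun z => by
      rw [Complex.norm_exp]
      congr 1
      simp [pow_two]
      ring
    have hle : ‖Complex.exp (-(τ - t₀) ^ 2) • (F A τ - F A₀ τ)‖ ≤ Real.exp (-1) * ε := by
      refine norm_le_of_strip (f := fun z => Complex.exp (-(z - t₀) ^ 2) • (F A z - F A₀ z))
        (B := Real.exp (b ^ 2) * (2 * C)) hb ?_ ?_ ?_ ?_ ?_ hτ0 hτ1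
      · exact (Continuous.continuousOn (by fun_prop)).smul ((hc A hAX).sub (hc A₀ hA₀))
      · exact (Differentiable.differentiableOn (by fun_prop)).smul ((hd A hAX).sub (hd A₀ hA₀))
      · intro z h0 h1
        rw [norm_smul, hnorm]
        have := hdiff z h0 h1
        have h3 : z.im ^ 2 ≤ b ^ 2 := pow_le_pow_left₀ h0 h1 2
        gcongr
        nlinarith [sq_nonneg (z.re - t₀)]
      · intro t
        have h2C : ∀ t : ℝ, ‖u₀ A t - u₀ A₀ t‖ ≤ 2 * C := fun t => by
          rw [← h0 A hAX, ← h0 A₀ hA₀]; exact hdiff t (by simp) (by simpa using hb.le)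
        rw [norm_smul, hnorm, h0 A hAX, h0 A₀ hA₀]
        simpa using hbound u₀ hA0 h2C t 0 (by rw [zero_pow two_ne_zero]; positivity)
      · intro t
        have h2C : ∀ t : ℝ, ‖u₁ A t - u₁ A₀ t‖ ≤ 2 * C := fun t => by
          rw [← h1 A hAX, ← h1 A₀ hA₀]
          exact hdiff _ (by simpa using hb.le) (by simp)
        rw [norm_smul, hnorm, h1 A hAX, h1 A₀ hA₀]
        simpa using hbound u₁ hA1 h2C t b le_rfl
    rw [norm_smul, hnorm] at hle
    have h3 : Real.exp (-1) ≤ Real.exp (-(τ.re - t₀) ^ 2 + τ.im ^ 2) := by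
      apply Real.exp_le_exp.2
      have : (τ.re - t₀) ^ 2 ≤ 1 := by rw [← sq_abs]; exact pow_le_one₀ (abs_nonneg _) hτ
      nlinarith [sq_nonneg τ.im]
    have h4 := (mul_le_mul_of_nonneg_right h3 (norm_nonneg (F A τ - F A₀ τ))).trans hle
    exact le_of_mul_le_mul_left h4 (Real.exp_pos _)
  rw [ContinuousWithinAt, Metric.tendsto_nhds]
  intro ε hε
  have e1 := hc A₀ hA₀ τ₀ ⟨hτ0, hτ1⟩
  rw [ContinuousWithinAt, Metric.tendsto_nhds] at e1
  have e2 := e1 (ε / 2) (by positivity)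
  rw [eventually_nhdsWithin_iff] at e2 ⊢
  have hre : ∀ᶠ τ : ℂ in 𝓝 τ₀, |τ.re - τ₀.re| ≤ 1 := by
    have : Continuous fun τ : ℂ => |τ.re - τ₀.re| := by fun_prop
    have h := (this.tendsto τ₀).eventually
      (gt_mem_nhds (show |τ₀.re - τ₀.re| < 1 by simp))
    filter_upwards [h] with τ hτ using hτ.le
  rw [nhds_prod_eq]
  filter_upwards [(key (ε / 3) (by positivity)).prod_mk (e2.and hre)] with x hx hxS
  obtain ⟨hx1, hx2, hx3⟩ := hx
  have a1 := hx1 hxS.1 x.2 hxS.2.1 hxS.2.2 hx3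
  have a2 := hx2 hxS.2
  calc dist (F x.1 x.2) (F A₀ τ₀) ≤ dist (F x.1 x.2) (F A₀ x.2) + dist (F A₀ x.2) (F A₀ τ₀) :=
        dist_triangle _ _ _
    _ < ε := by rw [dist_eq_norm (F x.1 x.2)]; linarith

/-! ### Continuation of the boost orbits of a vector in `H^R`, jointly continuous in the frame -/

section Extension
variable {P : ℝ} [hP : Fact (0 < P)]

theorem continuous_rep_apply {Y : Type*} [TopologicalSpace Y] {f : Y → ProperLorentz}
    {g : Y → L2Shell P} (hf : Continuous f) (hg : Continuous g) :
    Continuous fun y => rep (f y) (g y) :=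
  Continuous.comp (g := fun x : ProperLorentz × L2Shell P => rep x.1 x.2)
    (f := fun y => (f y, g y)) continuous_rep (hf.prodMk hg)

/-- `F A` is the analytic continuation of the orbit `t ↦ rep (A Λ(t) A⁻¹) ψ` to the strip of
width `π`, for all `A` in `X`, jointly continuous. -/
structure BoostExtension (X : Set ProperLorentz) (ψ : L2Shell P)
    (F : ProperLorentz → ℂ → L2Shell P) : Prop where
  continuousOn : ContinuousOn (fun x : ProperLorentz × ℂ => F x.1 x.2)
    {x | x.1 ∈ X ∧ 0 ≤ x.2.im ∧ x.2.im ≤ Real.pi}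
  differentiableOn : ∀ A ∈ X, DifferentiableOn ℂ (F A) {z | 0 < z.im ∧ z.im < Real.pi}
  apply_real : ∀ A ∈ X, ∀ t : ℝ, F A t = rep (boostConj A t) ψ
  add_real : ∀ A ∈ X, ∀ z : ℂ, 0 ≤ z.im → z.im ≤ Real.pi → ∀ t : ℝ,
    F A (z + t) = rep (boostConj A t) (F A z)

/-- The one-parameter group `U_L` as a group of linear isometries. -/
def boostRepₗᵢ (a : Fin 4 → ℝ) (A : ProperLorentz) (t : ℝ) : L2Shell P →ₗᵢ[ℂ] L2Shell P :=
  (phase P a).comp ((rep (boostConj A t)).comp (phase P (-a)))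

theorem boostRepₗᵢ_apply (a : Fin 4 → ℝ) (A : ProperLorentz) (t : ℝ) (φ : L2Shell P) :
    boostRepₗᵢ a A t φ = phase P a (rep (boostConj A t) (phase P (-a) φ)) := rfl

theorem boostRep_eq_boostRepₗᵢ (a : Fin 4 → ℝ) (A : ProperLorentz) :
    boostRep P a A = fun t v => boostRepₗᵢ a A t v := by
  funext t v
  rw [boostRep_eq, boostRepₗᵢ_apply]

/-- The upper boundary value is known: solving `j_L U_L(iπ) φ = φ` for `U_L(iπ) φ` gives `j_L φ`, an
isometric image of the conjugate vector that depends continuously on the frame. With both boundary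
values continuous and a bound independent of the frame, `continuousOn_strip_of_boundary` applies.
`F` belongs to the vector without the phase. -/
theorem exists_boostExtension {K : PolyhedralRegion} {φ : L2Shell P} (hφ : φ ∈ HRplus P K)
    (i : Fin K.n) : ∃ F : ProperLorentz → ℂ → L2Shell P,
      BoostExtension (K.X i) (phase P (-K.vertex i) φ) F ∧
      ∀ A ∈ K.X i, ∀ τ : ℂ, 0 ≤ τ.im → τ.im ≤ Real.pi → ∀ χ : L2Shell P,
        (φ, χ) ∈ complexGroupGraph (boostRep P (K.vertex i) A) τ ↔
          χ = phase P (K.vertex i) (F A τ) := by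
  set a := K.vertex i with ha
  set ψ := phase P (-a) φ with hψ
  have hU0 : ∀ A : ProperLorentz, ∀ v : L2Shell P, boostRepₗᵢ a A 0 v = v := fun A v => by
    rw [boostRepₗᵢ_apply, boostConj_zero, rep_one, phase_phase_neg]
  have hUa : ∀ A : ProperLorentz, ∀ s t : ℝ, ∀ v : L2Shell P,
      boostRepₗᵢ a A (s + t) v = boostRepₗᵢ a A s (boostRepₗᵢ a A t v) := fun A s t v => by
    rw [boostRepₗᵢ_apply, boostRepₗᵢ_apply, boostRepₗᵢ_apply, phase_neg_phase, boostConj_add,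
      rep_mul]
  -- The upper boundary value with the phase removed.
  set top : ProperLorentz → L2Shell P := fun A => rep (A * rotPiL * A⁻¹)⁻¹ (star ψ) with htop
  have hcont : Continuous top := continuous_rep_apply
    (f := fun A : ProperLorentz => (A * rotPiL * A⁻¹)⁻¹) (g := fun _ => star ψ)
    (((continuous_id.mul continuous_const).mul continuous_inv).inv) continuous_const
  have hgraph : ∀ A ∈ K.X i, (φ, phase P a (top A)) ∈
      complexGroupGraph (fun t v => boostRepₗᵢ (P := P) a A t v) (Complex.I * Real.pi) := by
    intro A hA
    obtain ⟨χ, h1, h2⟩ := hφ i A hA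
    rw [boostRep_eq_boostRepₗᵢ, ← ha] at h1
    rw [modularConj_eq, ← ha] at h2
    have h3 : star (rep (A * rotPiL * A⁻¹) (phase P (-a) χ)) = ψ := by
      rw [hψ, ← h2, phase_neg_phase]
    have h4 : phase P a (top A) = χ := by
      rw [htop, ← h3]
      simp only [star_star]
      rw [rep_inv_rep, phase_phase_neg]
    rwa [h4]
  have hex : ∀ A, ∃ G : ℂ → L2Shell P, A ∈ K.X i →
      ContinuousOn G {z | 0 ≤ z.im ∧ z.im ≤ Real.pi} ∧
      DifferentiableOn ℂ G {z | 0 < z.im ∧ z.im < Real.pi} ∧ (∀ t : ℝ, G t = boostRepₗᵢ a A t φ) ∧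
      (∀ t : ℝ, G (t + Complex.I * Real.pi) = boostRepₗᵢ a A t (phase P a (top A))) ∧
      (∀ z : ℂ, 0 ≤ z.im → z.im ≤ Real.pi → ∀ t : ℝ, G (z + t) = boostRepₗᵢ a A t (G z)) ∧
      (∀ z : ℂ, 0 ≤ z.im → z.im ≤ Real.pi →
        (φ, G z) ∈ complexGroupGraph (fun t v => boostRepₗᵢ (P := P) a A t v) z) ∧
      ∀ z : ℂ, 0 ≤ z.im → z.im ≤ Real.pi → ‖G z‖ ≤ max ‖φ‖ ‖phase P a (top A)‖ := by
    intro A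
    by_cases hA : A ∈ K.X i
    · obtain ⟨G, hG⟩ := exists_strip_extension (hU0 A) (hUa A) Real.pi_pos (hgraph A hA)
      exact ⟨G, fun _ => hG⟩
    · exact ⟨fun _ => 0, fun h => absurd h hA⟩
  choose G hG using hex
  refine ⟨fun A τ => phase P (-a) (G A τ), ⟨?_, ?_, ?_, ?_⟩, ?_⟩
  · refine continuousOn_strip_of_boundary (X := K.X i) (C := max ‖φ‖ ‖star ψ‖) Real.pi_pos
      (F := fun A τ => phase P (-a) (G A τ)) (u₀ := fun A t => rep (boostConj A t) ψ)
      (u₁ := fun A t => rep (boostConj A t) (top A)) ?_ ?_ ?_ ?_ ?_ ?_ ?_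
    · intro A hA
      exact (phase P (-a)).continuous.comp_continuousOn (hG A hA).1
    · intro A hA
      exact (phase P (-a)).toContinuousLinearMap.differentiable.comp_differentiableOn (hG A hA).2.1
    · intro A hA z h0 h1
      rw [LinearIsometry.norm_map]
      have := (hG A hA).2.2.2.2.2.2 z h0 h1
      rwa [LinearIsometry.norm_map, LinearIsometry.norm_map] at this
    · intro A hA t
      rw [(hG A hA).2.2.1, boostRepₗᵢ_apply, phase_neg_phase]
    · intro A hA t
      rw [(hG A hA).2.2.2.1, boostRepₗᵢ_apply, phase_neg_phase, phase_neg_phase]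
    · exact continuous_rep_apply (f := fun x : ProperLorentz × ℝ => boostConj x.1 x.2)
        (g := fun _ => ψ) continuous_boostConj continuous_const
    · exact continuous_rep_apply (f := fun x : ProperLorentz × ℝ => boostConj x.1 x.2)
        (g := fun x => top x.1) continuous_boostConj (hcont.comp continuous_fst)
  · intro A hA
    exact (phase P (-a)).toContinuousLinearMap.differentiable.comp_differentiableOn (hG A hA).2.1
  · intro A hA t
    rw [(hG A hA).2.2.1, boostRepₗᵢ_apply, phase_neg_phase]
  · intro A hA z h0 h1 t
    rw [(hG A hA).2.2.2.2.1 z h0 h1, boostRepₗᵢ_apply, phase_neg_phase]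
  · intro A hA τ h0 h1 χ
    rw [boostRep_eq_boostRepₗᵢ, phase_phase_neg]
    constructor
    · intro h
      exact complexGroupGraph_unique (hU0 A) (hUa A) h0 h ((hG A hA).2.2.2.2.2.1 τ h0 h1)
    · rintro rfl
      exact (hG A hA).2.2.2.2.2.1 τ h0 h1

end Extension

/-! ### The Laplace pairing -/

/-- Cauchy–Schwarz in the spatial components bounds the product below by the time component minus
the spatial length of `x`, times `q⁰`. It yields exponential decay in the energy. -/
theorem exists_mul_le_mink {x : Fin 4 → ℝ} (hx : x ∈ forwardCone) :
    ∃ ε > 0, ∀ q ∈ forwardCone, ε * q 0 ≤ mink x q := by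
  obtain ⟨h1, h2⟩ := hx
  simp only [mink] at h1
  set r := √(x 1 ^ 2 + x 2 ^ 2 + x 3 ^ 2) with hr
  have hr0 : 0 ≤ r := Real.sqrt_nonneg _
  have hr2 : r ^ 2 = x 1 ^ 2 + x 2 ^ 2 + x 3 ^ 2 := Real.sq_sqrt (by positivity)
  refine ⟨x 0 - r, by nlinarith, fun q hq => ?_⟩
  obtain ⟨h3, h4⟩ := hq
  simp only [mink] at h3 ⊢
  have cs : (x 1 * q 1 + x 2 * q 2 + x 3 * q 3) ^ 2 ≤ (r * q 0) ^ 2 := by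
    have e : (x 1 * q 1 + x 2 * q 2 + x 3 * q 3) ^ 2
        ≤ (x 1 ^ 2 + x 2 ^ 2 + x 3 ^ 2) * (q 1 ^ 2 + q 2 ^ 2 + q 3 ^ 2) := by
      nlinarith [sq_nonneg (x 1 * q 2 - x 2 * q 1), sq_nonneg (x 1 * q 3 - x 3 * q 1),
        sq_nonneg (x 2 * q 3 - x 3 * q 2)]
    rw [mul_pow, hr2]
    refine e.trans (mul_le_mul_of_nonneg_left (by nlinarith) (by positivity))
  have := (abs_le.1 (abs_le_of_sq_le_sq cs (by positivity))).2
  nlinarith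

/-- The exponential function `q ↦ e^{-{z, q}}`. -/
def expFun (z : Fin 4 → ℂ) (q : Fin 4 → ℝ) : ℂ := Complex.exp (-mink z (toC q))

theorem mink_toC_re (z : Fin 4 → ℂ) (q : Fin 4 → ℝ) : (mink z (toC q)).re = mink (reV z) q := by
  simp [mink, toC, reV]

theorem norm_expFun (z : Fin 4 → ℂ) (q : Fin 4 → ℝ) :
    ‖expFun z q‖ = Real.exp (-mink (reV z) q) := by
  rw [expFun, Complex.norm_exp, Complex.neg_re, mink_toC_re]

theorem continuous_expFun (z : Fin 4 → ℂ) : Continuous (expFun z) := by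
  unfold expFun mink toC; fun_prop

theorem expFun_lorentz (B : ProperLorentz) (z : Fin 4 → ℂ) (q : Fin 4 → ℝ) :
    expFun (lorentzC B *ᵥ z) (B.1 *ᵥ q) = expFun z q := by
  rw [expFun, ← lorentzC_mulVec_toC, lorentzC_mink, expFun]

/-- The bilinear pairing on `L²`. -/
def pairing (P : ℝ) : L2Shell P →L[ℂ] L2Shell P →L[ℂ] ℂ :=
  ContinuousLinearMap.lpPairing (massShellMeasure P) 2 2 (ContinuousLinearMap.mul ℂ ℂ)

theorem pairing_apply {P : ℝ} (F G : L2Shell P) :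
    pairing P F G = ∫ q, F q * G q ∂(massShellMeasure P) :=
  ContinuousLinearMap.lpPairing_eq_integral _ F G

section Laplace
variable {P : ℝ} [hP : Fact (0 < P)]

theorem memLp_exp_neg {c : ℝ} (hc : 0 < c) :
    MemLp (fun q : Fin 4 → ℝ => Real.exp (-(c * q 0))) 2 (massShellMeasure P) := by
  rw [memLp_two_iff_integrable_sq
    (Continuous.aestronglyMeasurable (by fun_prop))]
  refine ⟨Continuous.aestronglyMeasurable (by fun_prop), ?_⟩
  rw [hasFiniteIntegral_iff_ofReal (Filter.Eventually.of_forall fun q => by positivity)]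
  convert! lintegral_exp_neg_lt_top hP.out (c := 2 * c) (by positivity) using 4 with q
  rw [← Real.exp_nat_mul]
  push_cast
  ring_nf

theorem memLp_of_le_exp {c C : ℝ} (hc : 0 < c) {f : (Fin 4 → ℝ) → ℂ} (hf : Continuous f)
    (h : ∀ q ∈ massShell P, ‖f q‖ ≤ C * Real.exp (-(c * q 0))) :
    MemLp f 2 (massShellMeasure P) := by
  refine ((memLp_exp_neg (P := P) hc).const_mul C).of_le hf.aestronglyMeasurable ?_
  filter_upwards [ae_mem_massShell hP.out] with q hq
  exact (h q hq).trans (le_abs_self _)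

theorem memLp_expFun {z : Fin 4 → ℂ} (hz : reV z ∈ forwardCone) :
    MemLp (expFun z) 2 (massShellMeasure P) := by
  obtain ⟨ε, hε, h⟩ := exists_mul_le_mink hz
  refine memLp_of_le_exp (C := 1) hε (continuous_expFun z) fun q hq => ?_
  rw [norm_expFun, one_mul, Real.exp_le_exp, neg_le_neg_iff]
  exact h q (massShell_subset_forwardCone hP.out hq)

/-- The exponential function as an element of `L²`. -/
def expVec (P : ℝ) (z : Fin 4 → ℂ) : L2Shell P := toL2 P (expFun z)

theorem expVec_coeFn {z : Fin 4 → ℂ} (hz : reV z ∈ forwardCone) :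
    expVec P z =ᵐ[massShellMeasure P] expFun z := by
  rw [expVec, toL2, dif_pos (memLp_expFun hz)]
  exact (memLp_expFun hz).coeFn_toLp

/-- The Laplace transform `z ↦ ∫ F(q) e^{-{z, q}}`. -/
def laplace (F : L2Shell P) (z : Fin 4 → ℂ) : ℂ := pairing P F (expVec P z)

theorem laplace_eq (F : L2Shell P) {z : Fin 4 → ℂ} (hz : reV z ∈ forwardCone) :
    laplace F z = ∫ q, F q * expFun z q ∂(massShellMeasure P) := by
  rw [laplace, pairing_apply]
  refine integral_congr_ae ?_
  filter_upwards [expVec_coeFn (P := P) hz] with q h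
  rw [h]

theorem expVec_lorentz (B : ProperLorentz) {z : Fin 4 → ℂ} (hz : reV z ∈ forwardCone) :
    expVec P (lorentzC B *ᵥ z) = rep B (expVec P z) := by
  have hz' : reV (lorentzC B *ᵥ z) ∈ forwardCone := by
    rw [reV_lorentzC]; exact lorentz_mem_forwardCone B hz
  apply Lp.ext
  filter_upwards [expVec_coeFn (P := P) hz', rep_coeFn B (expVec P z),
    ae_lorentz B⁻¹ (expVec_coeFn (P := P) hz)] with q h1 h2 h3
  rw [h1, h2, h3, ← expFun_lorentz B z, lorentz_mulVec_mulVec, mul_inv_cancel, lorentz_coe_one,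
    Matrix.one_mulVec]

theorem pairing_rep (B : ProperLorentz) (F G : L2Shell P) :
    pairing P (rep B F) (rep B G) = pairing P F G := by
  rw [pairing_apply, pairing_apply]
  have e : MeasurableEmbedding fun p : Fin 4 → ℝ => (B⁻¹).1 *ᵥ p := by
    refine (Continuous.matrix_mulVec continuous_const continuous_id).measurableEmbedding
      fun p q h => ?_
    have := congrArg (fun x => B.1 *ᵥ x) h
    simpa only [lorentz_mulVec_mulVec, mul_inv_cancel, lorentz_coe_one, Matrix.one_mulVec, id_eq]
      using this
  rw [← (measurePreserving_lorentz hP.out B⁻¹).integral_comp e fun q => F q * G q]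
  refine integral_congr_ae ?_
  filter_upwards [rep_coeFn B F, rep_coeFn B G] with p h1 h2
  rw [h1, h2]

/-- The measure and the Minkowski product are both invariant. This covariance is the only property
of the representation that the comparison of frames uses. -/
theorem laplace_rep (B : ProperLorentz) (F : L2Shell P) {z : Fin 4 → ℂ}
    (hz : reV z ∈ forwardCone) : laplace (rep B F) (lorentzC B *ᵥ z) = laplace F z := by
  rw [laplace, expVec_lorentz B hz, pairing_rep, laplace]

theorem norm_exp_neg_sub_le (w : ℂ) :
    ‖Complex.exp (-w) - 1 + w‖ ≤ ‖w‖ ^ 2 * Real.exp ‖w‖ := by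
  have h := Complex.norm_exp_sub_sum_le_norm_mul_exp (-w) 2
  simp only [Finset.sum_range_succ, Finset.range_zero, Finset.sum_empty, pow_zero, pow_one,
    Nat.factorial, norm_neg] at h
  convert! h using 2
  push_cast; ring

/-- Each component of a forward vector is at most `q⁰` in modulus, and there are four of them. -/
theorem norm_mink_toC_le (δ : Fin 4 → ℂ) {q : Fin 4 → ℝ} (hq : q ∈ forwardCone) :
    ‖mink δ (toC q)‖ ≤ 4 * ‖δ‖ * q 0 := by
  obtain ⟨h3, h4⟩ := hq
  simp only [mink] at h3
  have hj : ∀ j, ‖δ j * toC q j‖ ≤ ‖δ‖ * q 0 := fun j => by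
    rw [norm_mul]
    refine mul_le_mul (norm_le_pi_norm δ j) ?_ (norm_nonneg _) (norm_nonneg _)
    rw [toC, Complex.norm_real, Real.norm_eq_abs]
    refine abs_le_of_sq_le_sq ?_ h4.le
    fin_cases j <;> simp <;> nlinarith [sq_nonneg (q 1), sq_nonneg (q 2), sq_nonneg (q 3)]
  calc ‖mink δ (toC q)‖ ≤ ‖δ 0 * toC q 0‖ + ‖δ 1 * toC q 1‖ + ‖δ 2 * toC q 2‖ + ‖δ 3 * toC q 3‖ := by
        unfold mink
        refine (norm_sub_le _ _).trans ?_
        gcongr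
        refine (norm_sub_le _ _).trans ?_
        gcongr
        exact norm_sub_le _ _
    _ ≤ _ := by linarith [hj 0, hj 1, hj 2, hj 3]

theorem continuous_mink_toC (δ : Fin 4 → ℂ) : Continuous fun q => mink δ (toC q) := by
  unfold mink toC; fun_prop

theorem memLp_mink_expFun (δ : Fin 4 → ℂ) {z : Fin 4 → ℂ} (hz : reV z ∈ forwardCone) :
    MemLp (fun q => -mink δ (toC q) * expFun z q) 2 (massShellMeasure P) := by
  obtain ⟨ε, hε, h⟩ := exists_mul_le_mink hz
  refine memLp_of_le_exp (C := 4 * ‖δ‖ * (2 / ε)) (c := ε / 2) (by positivity)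
    ((continuous_mink_toC δ).neg.mul (continuous_expFun z)) fun q hq => ?_
  have hq' := massShell_subset_forwardCone hP.out hq
  rw [norm_mul, norm_neg, norm_expFun]
  -- Half of the decay rate is spent on the linear factor `q⁰`.
  have h1 : q 0 ≤ 2 / ε * Real.exp (ε / 2 * q 0) := by
    have := Real.add_one_le_exp (ε / 2 * q 0)
    rw [div_mul_eq_mul_div, le_div_iff₀ hε]
    linarith
  have h2 : Real.exp (-mink (reV z) q) ≤ Real.exp (-(ε / 2 * q 0)) * Real.exp (-(ε / 2 * q 0)) := by
    rw [← Real.exp_add, Real.exp_le_exp]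
    linarith [h q hq']
  calc _ ≤ 4 * ‖δ‖ * (2 / ε * Real.exp (ε / 2 * q 0)) *
        (Real.exp (-(ε / 2 * q 0)) * Real.exp (-(ε / 2 * q 0))) := by
        refine mul_le_mul ((norm_mink_toC_le δ hq').trans ?_) h2 (by positivity)
          (by have := hq.2; positivity)
        gcongr
    _ = _ := by
        rw [Real.exp_neg (ε / 2 * q 0)]
        field_simp

/-- The derivative of `z ↦ e^{-{z, ·}}`. -/
def expVecDeriv (z : Fin 4 → ℂ) (hz : reV z ∈ forwardCone) : (Fin 4 → ℂ) →L[ℂ] L2Shell P :=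
  LinearMap.toContinuousLinearMap
    { toFun := fun δ => (memLp_mink_expFun (P := P) δ hz).toLp _
      map_add' := fun δ δ' => by
        rw [← MemLp.toLp_add]
        congr 1
        ext q
        simp only [Pi.add_apply, mink_add_left]; ring
      map_smul' := fun c δ => by
        rw [RingHom.id_apply, ← MemLp.toLp_const_smul]
        congr 1
        ext q
        simp only [Pi.smul_apply, smul_eq_mul, mink_smul_left]; ring }

theorem expVecDeriv_coeFn {z : Fin 4 → ℂ} (hz : reV z ∈ forwardCone) (δ : Fin 4 → ℂ) :
    expVecDeriv (P := P) z hz δ =ᵐ[massShellMeasure P] fun q => -mink δ (toC q) * expFun z q :=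
  (memLp_mink_expFun (P := P) δ hz).coeFn_toLp

theorem isOpen_reV_forwardCone : IsOpen {z : Fin 4 → ℂ | reV z ∈ forwardCone} := by
  have h : IsOpen forwardCone := by
    have h1 : IsOpen {x : Fin 4 → ℝ | 0 < mink x x} :=
      isOpen_lt continuous_const (by unfold mink; fun_prop)
    exact h1.inter (isOpen_lt continuous_const (continuous_apply 0))
  refine h.preimage ?_
  unfold reV; fun_prop

/-- The remainder `e^{-m} - 1 + m` is at most `|m|² e^{|m|}` with `|m| ≤ 4 ‖δ‖ q⁰`. Of the decay
rate `ε`, half pays for `(q⁰)²` and a quarter for `e^{|m|}`; the last quarter leaves a square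
integrable function. -/
theorem hasFDerivAt_expVec {z : Fin 4 → ℂ} (hz : reV z ∈ forwardCone) :
    HasFDerivAt (expVec P) (expVecDeriv (P := P) z hz) z := by
  obtain ⟨ε, hε, hm⟩ := exists_mul_le_mink hz
  have hexp := memLp_exp_neg (P := P) (c := ε / 4) (by positivity)
  obtain ⟨C, hC⟩ : ∃ C : ℝ, ∀ q : ℝ, 0 < q → q ^ 2 ≤ C * Real.exp (ε / 2 * q) := by
    -- From `x² / 2 ≤ e^x` at `x = ε q / 2`.
    refine ⟨8 / ε ^ 2, fun q hq => ?_⟩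
    have := Real.quadratic_le_exp_of_nonneg (x := ε / 2 * q) (by positivity)
    rw [div_mul_eq_mul_div, le_div_iff₀ (by positivity)]
    nlinarith
  have hC0 : 0 ≤ C := by
    have := (sq_nonneg (1 : ℝ)).trans (hC 1 one_pos)
    exact nonneg_of_mul_nonneg_left this (Real.exp_pos _)
  have hev : ∀ᶠ w in nhds z, ‖expVec P w - expVec P z - expVecDeriv (P := P) z hz (w - z)‖ ≤
      16 * C * ‖hexp.toLp _‖ * ‖w - z‖ ^ 2 := by
    filter_upwards [isOpen_reV_forwardCone.mem_nhds hz, Metric.ball_mem_nhds z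
      (show 0 < ε / 16 by positivity)] with w hw hw'
    set δ := w - z with hδ
    have hδ' : ‖δ‖ < ε / 16 := by rwa [Metric.mem_ball, dist_eq_norm] at hw'
    have key := Lp.norm_le_mul_norm_of_ae_le_mul (c := 16 * C * ‖δ‖ ^ 2)
      (f := expVec P w - expVec P z - expVecDeriv (P := P) z hz δ) (g := hexp.toLp _) ?_
    · calc _ ≤ _ := key
        _ = _ := by ring
    · filter_upwards [ae_mem_massShell hP.out, hexp.coeFn_toLp, expVec_coeFn (P := P) hw,
        expVec_coeFn (P := P) hz, expVecDeriv_coeFn (P := P) hz δ,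
        Lp.coeFn_sub (expVec P w - expVec P z) (expVecDeriv (P := P) z hz δ),
        Lp.coeFn_sub (expVec P w) (expVec P z)] with q hq h1 h2 h3 h4 h5 h6
      rw [h5, Pi.sub_apply, h6, Pi.sub_apply, h1, h2, h3, h4]
      have hq' := massShell_subset_forwardCone hP.out hq
      set m := mink δ (toC q) with hmdef
      have e1 : expFun w q = expFun z q * Complex.exp (-m) := by
        rw [expFun, expFun, ← Complex.exp_add]
        congr 1
        have : w = z + δ := by rw [hδ]; abel
        rw [this, mink_add_left]; ring
      rw [e1, show expFun z q * Complex.exp (-m) - expFun z q - -m * expFun z q =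
        expFun z q * (Complex.exp (-m) - 1 + m) by ring, norm_mul, norm_expFun]
      have hq0 : 0 < q 0 := hq.2
      have e2 : ‖m‖ ≤ 4 * ‖δ‖ * q 0 := norm_mink_toC_le δ hq'
      have e3 : ‖m‖ ≤ ε / 4 * q 0 := by nlinarith
      rw [Real.norm_eq_abs, abs_of_pos (Real.exp_pos _)]
      calc _ ≤ Real.exp (-(ε * q 0)) * ((4 * ‖δ‖ * q 0) ^ 2 * Real.exp (ε / 4 * q 0)) := by
            refine mul_le_mul (Real.exp_le_exp.2 (neg_le_neg (hm q hq'))) ?_ (norm_nonneg _)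
              (Real.exp_pos _).le
            refine (norm_exp_neg_sub_le m).trans ?_
            gcongr
        _ = 16 * ‖δ‖ ^ 2 * q 0 ^ 2 * (Real.exp (-(ε * q 0)) * Real.exp (ε / 4 * q 0)) := by ring
        _ ≤ 16 * ‖δ‖ ^ 2 * (C * Real.exp (ε / 2 * q 0)) *
            (Real.exp (-(ε * q 0)) * Real.exp (ε / 4 * q 0)) := by
            have := hC _ hq0
            gcongr
        _ = 16 * C * ‖δ‖ ^ 2 * (Real.exp (ε / 2 * q 0) *
            (Real.exp (-(ε * q 0)) * Real.exp (ε / 4 * q 0))) := by ring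
        _ = _ := by
            rw [← Real.exp_add, ← Real.exp_add]
            congr 2; ring
  have h2 : HasFDerivAt (fun w => expVec P w - expVec P z - expVecDeriv (P := P) z hz (w - z))
      (0 : (Fin 4 → ℂ) →L[ℂ] L2Shell P) z := by
    refine Asymptotics.IsBigO.hasFDerivAt (n := 2)
      (Asymptotics.IsBigO.of_bound (16 * C * ‖hexp.toLp _‖) ?_) one_lt_two
    filter_upwards [hev] with w hw
    simpa using hw
  have h3 : HasFDerivAt (fun w => expVecDeriv (P := P) z hz (w - z)) (expVecDeriv (P := P) z hz) z := by
    have := (expVecDeriv (P := P) z hz).hasFDerivAt (x := z)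
    simpa only [map_sub] using this.sub_const (expVecDeriv (P := P) z hz z)
  have h4 := (h2.add h3).add_const (expVec P z)
  rw [zero_add] at h4
  convert! h4 using 1
  ext1 w
  simp

theorem differentiableAt_laplace {E : Type*} [NormedAddCommGroup E] [NormedSpace ℂ E]
    {F : E → L2Shell P} {z : E → Fin 4 → ℂ} {x : E} (hF : DifferentiableAt ℂ F x)
    (hz : DifferentiableAt ℂ z x) (hx : reV (z x) ∈ forwardCone) :
    DifferentiableAt ℂ (fun y => laplace (F y) (z y)) x := by
  have h1 : DifferentiableAt ℂ (fun y => expVec P (z y)) x :=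
    (hasFDerivAt_expVec hx).differentiableAt.comp x hz
  have h2 : DifferentiableAt ℂ (fun y => pairing P (F y)) x :=
    (pairing P).differentiableAt.comp x hF
  exact h2.clm_apply h1

theorem continuousWithinAt_laplace {Y : Type*} [TopologicalSpace Y]
    {F : Y → L2Shell P} {z : Y → Fin 4 → ℂ} {S : Set Y} {x : Y} (hF : ContinuousWithinAt F S x)
    (hz : ContinuousWithinAt z S x) (hx : reV (z x) ∈ forwardCone) :
    ContinuousWithinAt (fun y => laplace (F y) (z y)) S x := by
  have h1 : ContinuousWithinAt (fun y => expVec P (z y)) S x :=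
    (hasFDerivAt_expVec hx).continuousAt.comp_continuousWithinAt hz
  have h2 : ContinuousWithinAt (fun y => pairing P (F y)) S x :=
    (pairing P).continuous.continuousAt.comp_continuousWithinAt hF
  exact h2.clm_apply h1

end Laplace

/-! ### Consistency of the continued boosts -/

section Consistency
variable {P : ℝ} [hP : Fact (0 < P)] {X : Set ProperLorentz} {ψ : L2Shell P}
  {F : ProperLorentz → ℂ → L2Shell P}

theorem BoostExtension.continuousOn_imag (hF : BoostExtension X ψ F) {A : ProperLorentz}
    (hA : A ∈ X) : ContinuousOn (fun y : ℝ => F A (Complex.I * y)) (Set.Icc 0 Real.pi) := by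
  have : ContinuousOn ((fun x : ProperLorentz × ℂ => F x.1 x.2) ∘
      fun y : ℝ => (A, Complex.I * (y : ℂ))) (Set.Icc 0 Real.pi) := by
    refine hF.continuousOn.comp (Continuous.continuousOn (by fun_prop)) fun y hy => ⟨hA, ?_⟩
    simpa using hy
  exact this

theorem BoostExtension.apply_zero (hF : BoostExtension X ψ F) {A : ProperLorentz} (hA : A ∈ X) :
    F A 0 = ψ := by
  have := hF.apply_real A hA 0
  rwa [Complex.ofReal_zero, boostConj_zero, rep_one] at this

theorem isOpen_strip : IsOpen {z : ℂ | 0 < z.im ∧ z.im < Real.pi} :=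
  (isOpen_lt continuous_const Complex.continuous_im).inter
    (isOpen_lt Complex.continuous_im continuous_const)

theorem BoostExtension.differentiableAt (hF : BoostExtension X ψ F) {A : ProperLorentz}
    (hA : A ∈ X) {τ : ℂ} (h0 : 0 < τ.im) (h1 : τ.im < Real.pi) : DifferentiableAt ℂ (F A) τ :=
  (hF.differentiableOn A hA).differentiableAt (isOpen_strip.mem_nhds ⟨h0, h1⟩)

/-- By covariance the function does not change under real shifts of `τ`. As it is holomorphic, its
derivative can be computed along the real direction, where it vanishes. -/
theorem BoostExtension.hasDerivAt_laplace (hF : BoostExtension X ψ F) {A : ProperLorentz}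
    (hA : A ∈ X) {τ : ℂ} (h0 : 0 < τ.im) (h1 : τ.im < Real.pi) {z : Fin 4 → ℂ}
    (hz : reV (boostAt A τ *ᵥ z) ∈ forwardCone) :
    HasDerivAt (fun τ => laplace (F A τ) (boostAt A τ *ᵥ z)) 0 τ := by
  have hd : DifferentiableAt ℂ (fun τ => laplace (F A τ) (boostAt A τ *ᵥ z)) τ :=
    differentiableAt_laplace (hF.differentiableAt hA h0 h1) (differentiable_boostAt_mulVec A z τ) hz
  have hconst : ∀ t : ℝ, laplace (F A (τ + t)) (boostAt A (τ + t) *ᵥ z) =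
      laplace (F A τ) (boostAt A τ *ᵥ z) := fun t => by
    rw [hF.add_real A hA τ h0.le h1.le, add_comm τ, ← boostAt_mulVec_add, boostAt_ofReal,
      laplace_rep _ _ hz]
  obtain ⟨d, h2⟩ : ∃ d, HasDerivAt (fun τ => laplace (F A τ) (boostAt A τ *ᵥ z)) d τ :=
    ⟨_, hd.hasDerivAt⟩
  have h3 : HasDerivAt (fun t : ℝ => τ + (t : ℂ)) 1 0 :=
    (Complex.ofRealCLM.hasDerivAt (x := 0)).const_add τ
  have h2' : HasDerivAt (fun τ => laplace (F A τ) (boostAt A τ *ᵥ z)) d (τ + ((0 : ℝ) : ℂ)) := by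
    rw [Complex.ofReal_zero, add_zero]; exact h2
  have h4 := HasDerivAt.scomp (0 : ℝ) h2' h3
  have h5 : ((fun τ => laplace (F A τ) (boostAt A τ *ᵥ z)) ∘ fun t : ℝ => τ + (t : ℂ)) =
      fun _ => laplace (F A τ) (boostAt A τ *ᵥ z) := by
    ext1 t; exact hconst t
  rw [h5, one_smul] at h4
  have := h4.unique (hasDerivAt_const _ _)
  rwa [this] at h2

/-- The derivative vanishes in the open segment. The end points may lie on the boundary of the
strip, where `F A` is only continuous, and are reached by taking limits. -/
theorem BoostExtension.laplace_eq_of_le (hF : BoostExtension X ψ F) {A : ProperLorentz}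
    (hA : A ∈ X) {z : Fin 4 → ℂ} {y₁ y₂ : ℝ} (h0 : 0 ≤ y₁) (h12 : y₁ ≤ y₂) (h2 : y₂ ≤ Real.pi)
    (hz : ∀ y ∈ Set.Icc y₁ y₂, reV (boostAt A (Complex.I * y) *ᵥ z) ∈ forwardCone) :
    laplace (F A (Complex.I * y₁)) (boostAt A (Complex.I * y₁) *ᵥ z) =
      laplace (F A (Complex.I * y₂)) (boostAt A (Complex.I * y₂) *ᵥ z) := by
  rcases h12.eq_or_lt with rfl | h12
  · rfl
  set g : ℝ → ℂ := fun y => laplace (F A (Complex.I * y)) (boostAt A (Complex.I * y) *ᵥ z) with hg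
  have hcont : ContinuousOn g (Set.Icc y₁ y₂) := by
    intro y hy
    refine continuousWithinAt_laplace ?_ ?_ (hz y hy)
    · exact ((hF.continuousOn_imag hA).mono (Set.Icc_subset_Icc h0 h2)) y hy
    · refine (Continuous.continuousWithinAt ?_)
      have := (differentiable_boostAt_mulVec A z).continuous
      exact this.comp (by fun_prop : Continuous fun y : ℝ => Complex.I * (y : ℂ))
  have hderiv : ∀ y ∈ Set.Ioo y₁ y₂, HasDerivAt g 0 y := by
    intro y hy
    have h := hF.hasDerivAt_laplace hA (τ := Complex.I * y) (z := z) (by simpa using h0.trans_lt hy.1)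
      (by simpa using hy.2.trans_le h2) (hz y ⟨hy.1.le, hy.2.le⟩)
    have h3 : HasDerivAt (fun t : ℝ => Complex.I * (t : ℂ)) (Complex.I * 1) y :=
      (Complex.ofRealCLM.hasDerivAt (x := y)).const_mul Complex.I
    have h4 := HasDerivAt.scomp y h h3
    rw [smul_zero] at h4
    exact h4
  obtain ⟨c, hc⟩ := isOpen_Ioo.exists_is_const_of_deriv_eq_zero isPreconnected_Ioo
    (fun y hy => (hderiv y hy).differentiableAt.differentiableWithinAt)
    (fun y hy => (hderiv y hy).deriv)
  have heq : Set.EqOn g (fun _ => c) (Set.Icc y₁ y₂) := by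
    refine Set.EqOn.of_subset_closure (s := Set.Ioo y₁ y₂) (fun y hy => hc y hy) hcont
      continuousOn_const Set.Ioo_subset_Icc_self ?_
    rw [closure_Ioo h12.ne]
  exact (heq (Set.left_mem_Icc.2 h12.le)).trans (heq (Set.right_mem_Icc.2 h12.le)).symm

theorem BoostExtension.laplace_eq_of_uIcc (hF : BoostExtension X ψ F) {A : ProperLorentz}
    (hA : A ∈ X) {z : Fin 4 → ℂ} {y₁ y₂ : ℝ} (h1 : y₁ ∈ Set.Icc 0 Real.pi)
    (h2 : y₂ ∈ Set.Icc 0 Real.pi)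
    (hz : ∀ y ∈ Set.uIcc y₁ y₂, reV (boostAt A (Complex.I * y) *ᵥ z) ∈ forwardCone) :
    laplace (F A (Complex.I * y₁)) (boostAt A (Complex.I * y₁) *ᵥ z) =
      laplace (F A (Complex.I * y₂)) (boostAt A (Complex.I * y₂) *ᵥ z) := by
  rcases le_total y₁ y₂ with h | h
  · exact hF.laplace_eq_of_le hA h1.1 h h2.2 (by rwa [Set.uIcc_of_le h] at hz)
  · exact (hF.laplace_eq_of_le hA h2.1 h h1.2 (by rwa [Set.uIcc_of_ge h] at hz)).symm

/-- Angles `y r` such that the boosts `A Λ(i y r) A⁻¹` move `ζ r` into the domain of the Laplace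
transform. -/
structure IsBoostPath (A : ProperLorentz) (ζ : ℂ → Fin 4 → ℂ) (y : ℝ → ℝ) : Prop where
  continuousOn : ContinuousOn y (Set.Ico 0 Real.pi)
  apply_zero : y 0 = 0
  mem : ∀ r ∈ Set.Ico 0 Real.pi, y r ∈ Set.Icc 0 Real.pi
  mem_cone : ∀ r : ℝ, r ∈ Set.Ico 0 Real.pi →
    reV (boostAt A (Complex.I * y r) *ᵥ ζ r) ∈ forwardCone

/-- The pairs of parameter and angle that lead into the cone form an open set. In a small ball of it
the angle can be frozen at `y r₀`, after which `r` enters only through the entire function `ζ`. -/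
theorem IsBoostPath.eventually_laplace_eq (hF : BoostExtension X ψ F) {A : ProperLorentz}
    (hA : A ∈ X) {ζ : ℂ → Fin 4 → ℂ} (hζ : Differentiable ℂ ζ) {y : ℝ → ℝ}
    (hy : IsBoostPath A ζ y) {r₀ : ℝ} (hr₀ : r₀ ∈ Set.Ico 0 Real.pi) :
    ∀ᶠ r : ℝ in nhdsWithin r₀ (Set.Ico 0 Real.pi),
      laplace (F A (Complex.I * y r)) (boostAt A (Complex.I * y r) *ᵥ ζ r) =
        laplace (F A (Complex.I * y r₀)) (boostAt A (Complex.I * y r₀) *ᵥ ζ r) := by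
  have hcont : Continuous fun x : ℝ × ℝ => boostAt A (Complex.I * x.2) *ᵥ ζ x.1 := by
    have h1 : Continuous fun x : ℝ × ℝ => Complex.I * (x.2 : ℂ) := by fun_prop
    have h2 : Continuous fun x : ℝ × ℝ => (x.1 : ℂ) := by fun_prop
    exact Continuous.matrix_mulVec ((continuous_boostAt A).comp h1) (hζ.continuous.comp h2)
  set S : Set (ℝ × ℝ) := {x | reV (boostAt A (Complex.I * x.2) *ᵥ ζ x.1) ∈ forwardCone} with hS
  have hopen : IsOpen S := isOpen_reV_forwardCone.preimage hcont
  have hmem : ∀ r y' : ℝ, (r, y') ∈ S ↔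
      reV (boostAt A (Complex.I * y') *ᵥ ζ r) ∈ forwardCone := fun r y' => Iff.rfl
  clear_value S
  obtain ⟨ε, hε, hball⟩ := Metric.isOpen_iff.1 hopen (r₀, y r₀)
    ((hmem _ _).2 (hy.mem_cone r₀ hr₀))
  have h1 : ∀ᶠ r in nhdsWithin r₀ (Set.Ico 0 Real.pi), y r ∈ Metric.ball (y r₀) ε :=
    (hy.continuousOn r₀ hr₀) (Metric.ball_mem_nhds _ hε)
  have h2 : ∀ᶠ r in nhdsWithin r₀ (Set.Ico 0 Real.pi), r ∈ Metric.ball r₀ ε :=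
    nhdsWithin_le_nhds (Metric.ball_mem_nhds _ hε)
  filter_upwards [h1, h2, self_mem_nhdsWithin] with r h1 h2 h3
  refine hF.laplace_eq_of_uIcc hA (hy.mem r h3) (hy.mem r₀ hr₀) fun y' hy' => ?_
  have hy'' : y' ∈ Metric.ball (y r₀) ε := by
    rw [Real.ball_eq_Ioo] at h1 ⊢
    exact Set.OrdConnected.uIcc_subset Set.ordConnected_Ioo h1
      (by constructor <;> linarith) hy'
  have : ((r, y') : ℝ × ℝ) ∈ Metric.ball (r₀, y r₀) ε := by
    rw [← ball_prod_same]
    exact ⟨h2, hy''⟩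
  exact (hmem _ _).1 (hball this)

/-- The path `y` is merely continuous; analyticity in `r` comes from freezing the angle. -/
theorem IsBoostPath.analyticAt_laplace (hF : BoostExtension X ψ F) {A : ProperLorentz}
    (hA : A ∈ X) {ζ : ℂ → Fin 4 → ℂ} (hζ : Differentiable ℂ ζ) {y : ℝ → ℝ}
    (hy : IsBoostPath A ζ y) {r₀ : ℝ} (hr₀ : r₀ ∈ Set.Ioo 0 Real.pi) :
    AnalyticAt ℝ (fun r : ℝ => laplace (F A (Complex.I * y r))
      (boostAt A (Complex.I * y r) *ᵥ ζ r)) r₀ := by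
  have hr₀' : r₀ ∈ Set.Ico 0 Real.pi := ⟨hr₀.1.le, hr₀.2⟩
  have hev := hy.eventually_laplace_eq hF hA hζ hr₀'
  rw [mem_nhds_iff.2 ⟨Set.Ioo 0 Real.pi, Set.Ioo_subset_Ico_self, isOpen_Ioo, hr₀⟩
    |> nhdsWithin_eq_nhds.2] at hev
  set G : ℂ → ℂ := fun w => laplace (F A (Complex.I * y r₀))
    (boostAt A (Complex.I * y r₀) *ᵥ ζ w) with hG
  have hZ : Differentiable ℂ fun w => boostAt A (Complex.I * y r₀) *ᵥ ζ w :=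
    (differentiable_mulVec _).comp hζ
  have hGa : AnalyticAt ℂ G r₀ := by
    rw [Complex.analyticAt_iff_eventually_differentiableAt]
    filter_upwards [(isOpen_reV_forwardCone.preimage hZ.continuous).mem_nhds
      (hy.mem_cone r₀ hr₀')] with w hw
    exact differentiableAt_laplace (differentiableAt_const _) (hZ w) hw
  have h1 : AnalyticAt ℝ (fun r : ℝ => G r) r₀ :=
    AnalyticAt.comp (g := G) (f := fun r : ℝ => (r : ℂ)) hGa.restrictScalars
      (Complex.ofRealCLM.analyticAt r₀)
  exact h1.congr (hev.mono fun r hr => hr.symm)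

/-- Near `r = 0` both sides equal the Laplace transform of the common vector `ψ = F A 0 = F B 0` at
`ζ r`, because both angles start at zero. Both sides are real analytic on `(0, π)`, so the identity
theorem applies. -/
theorem IsBoostPath.laplace_eq (hF : BoostExtension X ψ F) {A B : ProperLorentz}
    (hA : A ∈ X) (hB : B ∈ X) {ζ : ℂ → Fin 4 → ℂ} (hζ : Differentiable ℂ ζ) {y y' : ℝ → ℝ}
    (hy : IsBoostPath A ζ y) (hy' : IsBoostPath B ζ y') {r : ℝ} (hr : r ∈ Set.Ioo 0 Real.pi) :
    laplace (F A (Complex.I * y r)) (boostAt A (Complex.I * y r) *ᵥ ζ r) =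
      laplace (F B (Complex.I * y' r)) (boostAt B (Complex.I * y' r) *ᵥ ζ r) := by
  have h0 : (0 : ℝ) ∈ Set.Ico 0 Real.pi := ⟨le_rfl, Real.pi_pos⟩
  have e1 := hy.eventually_laplace_eq hF hA hζ h0
  have e2 := hy'.eventually_laplace_eq hF hB hζ h0
  rw [hy.apply_zero] at e1
  rw [hy'.apply_zero] at e2
  rw [Complex.ofReal_zero, mul_zero, hF.apply_zero hA, boostAt_zero] at e1
  rw [Complex.ofReal_zero, mul_zero, hF.apply_zero hB, boostAt_zero] at e2
  have e3 := (e1.and e2).mono fun r h => h.1.trans h.2.symm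
  rw [Filter.eventually_iff, Metric.mem_nhdsWithin_iff] at e3
  obtain ⟨ε, hε, hsub⟩ := e3
  set r₁ := min (ε / 2) (Real.pi / 2) with hr₁
  have hr₁0 : 0 < r₁ := lt_min (by positivity) (by positivity)
  have hr₁ε : r₁ < ε := (min_le_left _ _).trans_lt (by linarith)
  have hr₁π : r₁ < Real.pi := (min_le_right _ _).trans_lt (by linarith [Real.pi_pos])
  refine AnalyticOnNhd.eqOn_of_preconnected_of_eventuallyEq (U := Set.Ioo 0 Real.pi) (z₀ := r₁)
    (fun r hr => hy.analyticAt_laplace hF hA hζ hr) (fun r hr => hy'.analyticAt_laplace hF hB hζ hr)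
    isPreconnected_Ioo ⟨hr₁0, hr₁π⟩ ?_ hr
  filter_upwards [Ioo_mem_nhds hr₁0 (lt_min hr₁ε hr₁π)] with r hr
  have h3 := lt_min_iff.1 hr.2
  refine hsub ⟨?_, hr.1.le, h3.2⟩
  rw [Metric.mem_ball, Real.dist_eq, sub_zero, abs_of_pos hr.1]
  exact h3.1

/-- Undoing the boost by the same angle in the same frame returns to the real point `p`. -/
theorem isBoostPath_id (B : ProperLorentz) {p : Fin 4 → ℝ} (hp : p ∈ forwardCone) :
    IsBoostPath B (fun r => boostAt B (-(Complex.I * r)) *ᵥ toC p) id := by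
  refine ⟨continuousOn_id, rfl, fun r hr => ⟨hr.1, hr.2.le⟩, fun r _ => ?_⟩
  rw [boostAt_mulVec_add, id, add_neg_cancel, boostAt_zero, Matrix.one_mulVec, reV_toC]
  exact hp

theorem differentiable_boostAt_neg (B : ProperLorentz) (z : Fin 4 → ℂ) :
    Differentiable ℂ fun r => boostAt B (-(Complex.I * r)) *ᵥ z := by
  have := differentiable_boostAt_mulVec B z
  exact this.comp (by fun_prop : Differentiable ℂ fun r : ℂ => -(Complex.I * r))

theorem IsBoostPath.laplace_eq_real (hF : BoostExtension X ψ F) {A B : ProperLorentz}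
    (hA : A ∈ X) (hB : B ∈ X) {p : Fin 4 → ℝ} (hp : p ∈ forwardCone) {y : ℝ → ℝ}
    (hy : IsBoostPath A (fun r => boostAt B (-(Complex.I * r)) *ᵥ toC p) y) {r : ℝ}
    (hr : r ∈ Set.Ioo 0 Real.pi) :
    laplace (F A (Complex.I * y r)) (boostAt A (Complex.I * y r) *ᵥ
      (boostAt B (-(Complex.I * r)) *ᵥ toC p)) = laplace (F B (Complex.I * r)) (toC p) := by
  have h := hy.laplace_eq hF hA hB (differentiable_boostAt_neg B (toC p)) (isBoostPath_id B hp) hr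
  simp only [id] at h
  rw [h, boostAt_mulVec_add, add_neg_cancel, boostAt_zero, Matrix.one_mulVec]

end Consistency

/-! ### Two boosts that differ by a null rotation -/

/-- For real `w` the real part is again a light-cone point, with `Q` lowered by the squares of the
imaginary parts, since `Re v² = (Re v)² - (Im v)²`. -/
theorem reV_lcPoint_mem_forwardCone {Q w : ℝ} (hw : 0 < w) {v₁ v₂ : ℂ}
    (h : v₁.im ^ 2 + v₂.im ^ 2 < Q) : reV (lcPoint (Q : ℂ) w v₁ v₂) ∈ forwardCone := by
  have e : reV (lcPoint (Q : ℂ) w v₁ v₂) =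
      lcPoint (Q - v₁.im ^ 2 - v₂.im ^ 2) w v₁.re v₂.re := by
    have h1 : ((Q : ℂ) + v₁ ^ 2 + v₂ ^ 2).re =
        Q - v₁.im ^ 2 - v₂.im ^ 2 + v₁.re ^ 2 + v₂.re ^ 2 := by
      simp [pow_two]; ring
    have h2 : (((Q : ℂ) + v₁ ^ 2 + v₂ ^ 2) / w).re =
        (Q - v₁.im ^ 2 - v₂.im ^ 2 + v₁.re ^ 2 + v₂.re ^ 2) / w := by
      rw [Complex.div_ofReal_re, h1]
    ext j
    fin_cases j
    · simp [reV, lcPoint, h2]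
    · simp [reV, lcPoint]
    · simp [reV, lcPoint]
    · simp [reV, lcPoint, h2]
  rw [e]
  exact massShell_subset_forwardCone (P := Q - v₁.im ^ 2 - v₂.im ^ 2) (by linarith)
    (lcPoint_mem_massShell (by linarith) hw _ _)

theorem smul_mem_forwardCone {c : ℝ} (hc : 0 < c) {x : Fin 4 → ℝ} (hx : x ∈ forwardCone) :
    c • x ∈ forwardCone := by
  refine ⟨?_, mul_pos hc hx.2⟩
  rw [mink_smul_left, mink_smul_right]
  exact mul_pos hc (mul_pos hc hx.1)

theorem toC_smul (c : ℝ) (x : Fin 4 → ℝ) : toC (c • x) = (c : ℂ) • toC x := by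
  ext j; simp [toC]

theorem reV_smul (c : ℝ) (z : Fin 4 → ℂ) : reV ((c : ℂ) • z) = c • reV z := by
  ext j; simp [reV]

/-- Undoing the boost of the null-rotated frame by a boost of the frame `A` with the same angle
returns `w` to `e^{-t}`. It leaves transverse imaginary parts `-sin r · b e^{-t}`, and for small `b`
the real part stays time-like for every `r`. -/
theorem isBoostPath_nullRot {P : ℝ} (A : ProperLorentz) {b₁ b₂ t x₁ x₂ c : ℝ} (hc : 0 < c)
    (hb : (b₁ * Real.exp (-t)) ^ 2 + (b₂ * Real.exp (-t)) ^ 2 < P) :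
    IsBoostPath A (fun r => boostAt (A * nullRotL b₁ b₂) (-(Complex.I * r)) *ᵥ
      toC (c • realPoint P A t x₁ x₂)) id := by
  refine ⟨continuousOn_id, rfl, fun r hr => ⟨hr.1, hr.2.le⟩, fun r _ => ?_⟩
  have hw : (Complex.exp (-t : ℝ) : ℂ) ≠ 0 := Complex.exp_ne_zero _
  rw [id, toC_smul, Matrix.mulVec_smul, Matrix.mulVec_smul, reV_smul]
  refine smul_mem_forwardCone hc ?_
  rw [realPoint, ← lorentzC_mulVec_toC, toC_lcPoint, Complex.ofReal_exp,
    boostAt_mul_nullRotL_lcPoint _ _ _ _ _ hw, boostAt_lcPoint, ← mul_assoc, ← Complex.exp_add,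
    add_neg_cancel, Complex.exp_zero, one_mul, reV_lorentzC]
  refine lorentz_mem_forwardCone A ?_
  rw [← Complex.ofReal_exp]
  refine reV_lcPoint_mem_forwardCone (Real.exp_pos _) ?_
  have him : ∀ x b : ℝ, ((x : ℂ) - b * (Real.exp (-t) : ℝ) +
      b * (Complex.exp (-(Complex.I * r)) * (Real.exp (-t) : ℝ))).im =
        -(Real.sin r * (b * Real.exp (-t))) := fun x b => by
    have : -(Complex.I * (r : ℂ)) = ((-r : ℝ) : ℂ) * Complex.I := by push_cast; ring
    rw [this, Complex.exp_mul_I, ← Complex.ofReal_cos, ← Complex.ofReal_sin, Real.cos_neg,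
      Real.sin_neg]
    generalize Real.exp (-t) = w
    simp only [Complex.add_im, Complex.sub_im, Complex.mul_im, Complex.mul_re, Complex.add_re,
      Complex.ofReal_re, Complex.ofReal_im, Complex.I_re, Complex.I_im]
    ring
  rw [him, him, neg_sq, neg_sq, mul_pow (Real.sin r), mul_pow (Real.sin r), ← mul_add]
  refine lt_of_le_of_lt ?_ hb
  have := Real.sin_sq_le_one r
  exact mul_le_of_le_one_left (by positivity) this

/-! ### Two boosts with the same complex point -/

/-- The third component is removed by a boost along its axis; it vanishes exactly when `w` equals
the transverse mass `m`. -/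
theorem exists_boostL_eq {P : ℝ} (hP : 0 < P) {p : Fin 4 → ℝ} (hp : p ∈ massShell P) :
    ∃ s m x₁ x₂ : ℝ, 0 < m ∧ m ^ 2 = P + x₁ ^ 2 + x₂ ^ 2 ∧
      p = (boostL s).1 *ᵥ ![m, x₁, x₂, 0] := by
  obtain ⟨t, x₁, x₂, rfl⟩ := exists_eq_lcPoint hP hp
  have hQ : 0 < P + x₁ ^ 2 + x₂ ^ 2 := by positivity
  set m := √(P + x₁ ^ 2 + x₂ ^ 2) with hm
  have hm0 : 0 < m := Real.sqrt_pos.2 hQ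
  have hm2 : m ^ 2 = P + x₁ ^ 2 + x₂ ^ 2 := Real.sq_sqrt hQ.le
  refine ⟨-t - Real.log m, m, x₁, x₂, hm0, hm2, ?_⟩
  have h : (![m, x₁, x₂, 0] : Fin 4 → ℝ) = lcPoint P m x₁ x₂ := by
    ext j
    have : (P + x₁ ^ 2 + x₂ ^ 2) / m = m := by rw [← hm2]; field_simp
    fin_cases j <;> simp [lcPoint, this]
  rw [h, boostL_lcPoint, Real.exp_sub, Real.exp_log hm0, div_mul_cancel₀ _ hm0.ne']

/-- Since `cosh(ir) = cos r` and `sinh(ir) = i sin r`, an imaginary boost is a rotation of the plane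
of the time and the imaginary third direction. The imaginary part of the point then shows the axis
of the boost. -/
theorem boostC_mulVec_real (r m x₁ x₂ : ℝ) :
    boostC (-(Complex.I * r)) *ᵥ toC ![m, x₁, x₂, 0] =
      toC ![m * Real.cos r, x₁, x₂, 0] +
        (Complex.I * (m * Real.sin r : ℝ)) • toC ![0, 0, 0, 1] := by
  have h1 : Complex.cosh (-(Complex.I * r)) = Real.cos r := by
    rw [Complex.cosh_neg, mul_comm, Complex.cosh_mul_I, Complex.ofReal_cos]
  have h2 : Complex.sinh (-(Complex.I * r)) = -(Real.sin r * Complex.I) := by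
    rw [Complex.sinh_neg, mul_comm, Complex.sinh_mul_I, Complex.ofReal_sin]
  ext j
  fin_cases j
  · simp [boostC, h1, h2, toC, Matrix.mulVec, dotProduct, Fin.sum_univ_four, mul_comm]
  · simp [boostC, h1, h2, toC, Matrix.mulVec, dotProduct, Fin.sum_univ_four, mul_comm]
  · simp [boostC, h1, h2, toC, Matrix.mulVec, dotProduct, Fin.sum_univ_four, mul_comm]
  · simp only [boostC, h1, h2, toC, Matrix.mulVec, dotProduct, Fin.sum_univ_four]
    simp [toC]; ring

theorem boostAt_mulVec_real (A : ProperLorentz) (r m x₁ x₂ : ℝ) :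
    boostAt A (-(Complex.I * r)) *ᵥ toC (A.1 *ᵥ ![m, x₁, x₂, 0]) =
      toC (A.1 *ᵥ ![m * Real.cos r, x₁, x₂, 0]) +
        (Complex.I * (m * Real.sin r : ℝ)) • toC (A.1 *ᵥ ![0, 0, 0, 1]) := by
  rw [boostAt, ← Matrix.mulVec_mulVec, ← lorentzC_mulVec_toC, Matrix.mulVec_mulVec _ (lorentzC A⁻¹),
    lorentzC_inv_mul, Matrix.one_mulVec, ← Matrix.mulVec_mulVec, boostC_mulVec_real,
    Matrix.mulVec_add, Matrix.mulVec_smul, lorentzC_mulVec_toC, lorentzC_mulVec_toC]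

theorem boostAt_mulVec_polar (A : ProperLorentz) (y N x₁ x₂ : ℝ) :
    boostAt A (Complex.I * y) *ᵥ (toC (A.1 *ᵥ ![N * Real.cos y, x₁, x₂, 0]) +
        (Complex.I * (N * Real.sin y : ℝ)) • toC (A.1 *ᵥ ![0, 0, 0, 1])) =
      toC (A.1 *ᵥ ![N, x₁, x₂, 0]) := by
  rw [← boostAt_mulVec_real, boostAt_mulVec_add, add_neg_cancel, boostAt_zero, Matrix.one_mulVec]

theorem imV_add_smul (x y : Fin 4 → ℝ) (c : ℝ) : imV (toC x + (Complex.I * c) • toC y) = c • y := by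
  ext j; simp [imV, toC]

theorem reV_add_smul (x y : Fin 4 → ℝ) (c : ℝ) : reV (toC x + (Complex.I * c) • toC y) = x := by
  ext j; simp [reV, toC]

theorem lorentz_mulVec_injective (A : ProperLorentz) :
    Function.Injective fun x : Fin 4 → ℝ => A.1 *ᵥ x := by
  intro x y h
  have := congrArg (fun x => (A⁻¹).1 *ᵥ x) h
  simpa only [lorentz_mulVec_mulVec, inv_mul_cancel, lorentz_coe_one, Matrix.one_mulVec] using this

/-- Both axis vectors have Minkowski square `-1`, so comparison of squares fixes the positive
factors. -/
theorem eq_of_smul_mulVec_eq {A B : ProperLorentz} {a b : ℝ} (ha : 0 < a) (hb : 0 < b)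
    (h : a • (A.1 *ᵥ ![0, 0, 0, 1]) = b • (B.1 *ᵥ ![0, 0, 0, 1])) :
    A.1 *ᵥ ![0, 0, 0, 1] = B.1 *ᵥ ![0, 0, 0, 1] ∧ a = b := by
  have h1 := congrArg (fun x => mink x x) h
  simp only [mink_smul_left, mink_smul_right, lorentz_mink] at h1
  have h2 : mink (![0, 0, 0, 1] : Fin 4 → ℝ) ![0, 0, 0, 1] = -1 := by simp [mink]
  rw [h2] at h1
  have hab : a = b := by nlinarith
  subst hab
  exact ⟨smul_right_injective _ ha.ne' h, rfl⟩

/-- The path of angles that connects two boosts with the same complex point. -/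
theorem isBoostPath_arccos {P : ℝ} (hP : 0 < P) {A B : ProperLorentz}
    (hAB : A.1 *ᵥ ![0, 0, 0, 1] = B.1 *ᵥ ![0, 0, 0, 1]) {m x₁ x₂ : ℝ} (hm : 0 < m)
    (hm2 : m ^ 2 = P + x₁ ^ 2 + x₂ ^ 2) {c : ℝ} (hc : 0 < c) :
    ∃ y : ℝ → ℝ, IsBoostPath A (fun r => boostAt B (-(Complex.I * r)) *ᵥ
        toC (c • (B.1 *ᵥ ![m, x₁, x₂, 0]))) y ∧
      ∀ r m' x₁' x₂' r' : ℝ, 0 < m' → r ∈ Set.Ioo 0 Real.pi → r' ∈ Set.Ioo 0 Real.pi →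
        m' ^ 2 = P + x₁' ^ 2 + x₂' ^ 2 →
        A.1 *ᵥ ![m' * Real.cos r', x₁', x₂', 0] = B.1 *ᵥ ![m * Real.cos r, x₁, x₂, 0] →
        y r = r' := by
  -- The real part of the point, seen from the frame `A`. The two frames share the third axis, so
  -- its third component is zero.
  set X : ℝ → Fin 4 → ℝ := fun r => (A⁻¹ * B).1 *ᵥ ![m * Real.cos r, x₁, x₂, 0] with hX
  have hfix : (A⁻¹ * B).1 *ᵥ ![0, 0, 0, 1] = ![0, 0, 0, 1] := by
    rw [← lorentz_mulVec_mulVec, ← hAB, lorentz_mulVec_mulVec, inv_mul_cancel, lorentz_coe_one,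
      Matrix.one_mulVec]
  have hX3 : ∀ r, X r 3 = 0 := fun r => by
    have h := lorentz_mink (A⁻¹ * B) ![m * Real.cos r, x₁, x₂, 0] ![0, 0, 0, 1]
    rw [hfix] at h
    simpa [mink] using h
  have hXeta : ∀ r, X r = ![X r 0, X r 1, X r 2, 0] := fun r => by
    ext j; fin_cases j <;> simp [hX3]
  have hXsq : ∀ r, X r 0 ^ 2 + (m * Real.sin r) ^ 2 = P + X r 1 ^ 2 + X r 2 ^ 2 := fun r => by
    have h := lorentz_mink (A⁻¹ * B) ![m * Real.cos r, x₁, x₂, 0] ![m * Real.cos r, x₁, x₂, 0]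
    change mink (X r) (X r) = _ at h
    simp only [mink, hX3] at h
    simp at h
    have := Real.sin_sq_add_cos_sq r
    have h3 : (m * Real.sin r) ^ 2 = m ^ 2 - (m * Real.cos r) ^ 2 := by
      rw [mul_pow, mul_pow]; linear_combination m ^ 2 * this
    rw [h3]; linarith
  have hBX : ∀ r, B.1 *ᵥ ![m * Real.cos r, x₁, x₂, 0] = A.1 *ᵥ X r := fun r => by
    rw [hX, lorentz_mulVec_mulVec, mul_inv_cancel_left]
  have hXc : Continuous X := by
    refine Continuous.matrix_mulVec continuous_const ?_
    refine continuous_pi fun j => ?_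
    fin_cases j <;> simp <;> fun_prop
  have hX00 : 0 < X 0 0 := by
    refine (lorentz_mem_massShell (A⁻¹ * B) hP ⟨?_, ?_⟩).2
    · simp [mink]; linarith
    · simpa using hm
  clear_value X
  have hXj : ∀ j, Continuous fun r => X r j := fun j => (continuous_apply j).comp hXc
  -- The transverse mass in the frame `A`. In polar form `X⁰ = N cos y` and `m sin r = N sin y`, and
  -- this `y` is the required angle.
  set N : ℝ → ℝ := fun r => √(P + X r 1 ^ 2 + X r 2 ^ 2) with hN
  have hN0 : ∀ r, 0 < N r := fun r => Real.sqrt_pos.2 (by positivity)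
  have hN2 : ∀ r, N r ^ 2 = P + X r 1 ^ 2 + X r 2 ^ 2 := fun r => Real.sq_sqrt (by positivity)
  have hNc : Continuous N := by
    have h1 := hXj 1
    have h2 := hXj 2
    exact ((continuous_const.add (h1.pow 2)).add (h2.pow 2)).sqrt
  clear_value N
  set y : ℝ → ℝ := fun r => Real.arccos (X r 0 / N r) with hy
  have habs : ∀ r, |X r 0 / N r| ≤ 1 := fun r => by
    rw [abs_div, abs_of_pos (hN0 r), div_le_one (hN0 r)]
    refine abs_le_of_sq_le_sq ?_ (hN0 r).le
    rw [hN2, ← hXsq]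
    nlinarith [sq_nonneg (m * Real.sin r)]
  have hcos : ∀ r, N r * Real.cos (y r) = X r 0 := fun r => by
    rw [hy, Real.cos_arccos (abs_le.1 (habs r)).1 (abs_le.1 (habs r)).2,
      mul_div_cancel₀ _ (hN0 r).ne']
  have hsin : ∀ r, 0 ≤ Real.sin r → N r * Real.sin (y r) = m * Real.sin r := fun r hr => by
    have h1 : 0 ≤ Real.sin (y r) :=
      Real.sin_nonneg_of_nonneg_of_le_pi (Real.arccos_nonneg _) (Real.arccos_le_pi _)
    refine (sq_eq_sq₀ (mul_nonneg (hN0 r).le h1) (mul_nonneg hm.le hr)).1 ?_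
    have h2 := Real.sin_sq_add_cos_sq (y r)
    have h3 : (N r * Real.sin (y r)) ^ 2 = N r ^ 2 - (N r * Real.cos (y r)) ^ 2 := by
      rw [mul_pow, mul_pow]; linear_combination N r ^ 2 * h2
    rw [h3, hcos, hN2, ← hXsq]; ring
  refine ⟨y, ⟨?_, ?_, ?_, ?_⟩, ?_⟩
  · exact (Real.continuous_arccos.comp ((hXj 0).div hNc fun r => (hN0 r).ne')).continuousOn
  -- At `r = 0` the sine vanishes, and the positive time component selects the angle `0` and not
  -- `π`.
  · have h2 : X 0 0 = N 0 := by
      refine (sq_eq_sq₀ hX00.le (hN0 0).le).1 ?_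
      rw [hN2, ← hXsq]; simp
    simp only [hy]
    rw [h2, div_self (hN0 0).ne', Real.arccos_one]
  · exact fun r _ => ⟨Real.arccos_nonneg _, Real.arccos_le_pi _⟩
  · intro r hr
    rw [toC_smul, Matrix.mulVec_smul, Matrix.mulVec_smul, reV_smul]
    refine smul_mem_forwardCone hc ?_
    rw [boostAt_mulVec_real, hBX, hXeta, ← hAB, ← hcos,
      ← hsin r (Real.sin_nonneg_of_nonneg_of_le_pi hr.1 hr.2.le), boostAt_mulVec_polar, reV_toC]
    refine lorentz_mem_forwardCone A (massShell_subset_forwardCone hP ⟨?_, ?_⟩)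
    · have := hN2 r
      simp [mink]; linarith
    · simpa using hN0 r
  · intro r m' x₁' x₂' r' hm' hr hr' hm2' h
    rw [hBX] at h
    have h1 := lorentz_mulVec_injective A h
    have e0 : X r 0 = m' * Real.cos r' := by rw [← h1]; simp
    have e1 : X r 1 = x₁' := by rw [← h1]; simp
    have e2 : X r 2 = x₂' := by rw [← h1]; simp
    have e3 : N r = m' := by
      refine (sq_eq_sq₀ (hN0 r).le hm'.le).1 ?_
      rw [hN2, hm2', e1, e2]
    simp only [hy]
    rw [e0, e3, mul_div_cancel_left₀ _ hm'.ne', Real.arccos_cos hr'.1.le hr'.2.le]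

section Consistency
variable {P : ℝ} [hP : Fact (0 < P)] {X : Set ProperLorentz} {ψ : L2Shell P}
  {F : ProperLorentz → ℂ → L2Shell P}

/-- After boosts along the axes of the two frames both momenta have vanishing third component. Equal
imaginary parts then force equal third axes, equal real parts show that the path of
`isBoostPath_arccos` takes the value `σ` at `σ'`, and the Laplace transforms are compared along this
path. -/
theorem BoostExtension.laplace_eq_of_imag (hF : BoostExtension X ψ F) {A B : ProperLorentz}
    (hA : A ∈ X) (hB : B ∈ X) {σ σ' : ℝ} (hσ : σ ∈ Set.Ioo 0 Real.pi) (hσ' : σ' ∈ Set.Ioo 0 Real.pi)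
    {p p' : Fin 4 → ℝ} (hp : p ∈ massShell P) (hp' : p' ∈ massShell P)
    (h : zetaPoint A (Complex.I * σ) p = zetaPoint B (Complex.I * σ') p') {c : ℝ} (hc : 0 < c) :
    laplace (F A (Complex.I * σ)) (toC (c • p)) = laplace (F B (Complex.I * σ')) (toC (c • p')) := by
  obtain ⟨s, m, x₁, x₂, hm, hm2, hpe⟩ := exists_boostL_eq hP.out (lorentz_mem_massShell A⁻¹ hP.out hp)
  obtain ⟨s', m', x₁', x₂', hm', hm2', hpe'⟩ :=
    exists_boostL_eq hP.out (lorentz_mem_massShell B⁻¹ hP.out hp')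
  have e : p = (A * boostL s).1 *ᵥ ![m, x₁, x₂, 0] := by
    rw [← lorentz_mulVec_mulVec, ← hpe, lorentz_mulVec_mulVec, mul_inv_cancel, lorentz_coe_one,
      Matrix.one_mulVec]
  have e' : p' = (B * boostL s').1 *ᵥ ![m', x₁', x₂', 0] := by
    rw [← lorentz_mulVec_mulVec, ← hpe', lorentz_mulVec_mulVec, mul_inv_cancel, lorentz_coe_one,
      Matrix.one_mulVec]
  set A' := A * boostL s with hA'
  set B' := B * boostL s' with hB'
  have hz := h
  rw [zetaPoint_eq, zetaPoint_eq, ← boostAt_mul_boostL A s, ← boostAt_mul_boostL B s', ← hA', ← hB',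
    e, e', boostAt_mulVec_real, boostAt_mulVec_real] at hz
  have him := congrArg imV hz
  have hre := congrArg reV hz
  rw [imV_add_smul, imV_add_smul] at him
  rw [reV_add_smul, reV_add_smul] at hre
  obtain ⟨hAB, -⟩ := eq_of_smul_mulVec_eq (mul_pos hm (Real.sin_pos_of_mem_Ioo hσ))
    (mul_pos hm' (Real.sin_pos_of_mem_Ioo hσ')) him
  obtain ⟨y, hy, hyr⟩ := isBoostPath_arccos hP.out hAB hm' hm2' hc
  have hyσ := hyr σ' m x₁ x₂ σ hm hσ' hσ hm2 hre
  rw [← e'] at hy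
  have hbB : ∀ τ, boostAt B' τ = boostAt B τ := boostAt_mul_boostL B s'
  have hbA : ∀ τ, boostAt A' τ = boostAt A τ := boostAt_mul_boostL A s
  have hy2 : IsBoostPath A (fun r => boostAt B (-(Complex.I * r)) *ᵥ toC (c • p')) y := by
    refine ⟨hy.continuousOn, hy.apply_zero, hy.mem, fun r hr => ?_⟩
    have := hy.mem_cone r hr
    rwa [hbA, hbB] at this
  have key := hy2.laplace_eq_real hF hA hB
    (smul_mem_forwardCone hc (massShell_subset_forwardCone hP.out hp')) hσ'
  rw [← key, hyσ]
  congr 1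
  rw [zetaPoint_eq, zetaPoint_eq] at h
  rw [toC_smul, toC_smul, Matrix.mulVec_smul, Matrix.mulVec_smul, ← h, boostAt_mulVec_add,
    add_neg_cancel, boostAt_zero, Matrix.one_mulVec]

theorem BoostExtension.laplace_add_real (hF : BoostExtension X ψ F) {A : ProperLorentz}
    (hA : A ∈ X) {τ : ℂ} (h0 : 0 ≤ τ.im) (h1 : τ.im ≤ Real.pi) (t : ℝ) {z : Fin 4 → ℂ}
    (hz : reV z ∈ forwardCone) :
    laplace (F A (τ + t)) (lorentzC (boostConj A t) *ᵥ z) = laplace (F A τ) z := by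
  rw [hF.add_real A hA τ h0 h1, laplace_rep _ _ hz]

/-- The Laplace transform of the continued orbit at the real point `c p` depends only on the
complex point belonging to `p`. -/
theorem BoostExtension.laplace_eq_of_zetaPoint (hF : BoostExtension X ψ F) {A B : ProperLorentz}
    (hA : A ∈ X) (hB : B ∈ X) {τ τ' : ℂ} (h0 : 0 < τ.im) (h1 : τ.im < Real.pi) (h0' : 0 < τ'.im)
    (h1' : τ'.im < Real.pi) {p p' : Fin 4 → ℝ} (hp : p ∈ massShell P) (hp' : p' ∈ massShell P)
    (h : zetaPoint A τ p = zetaPoint B τ' p') {c : ℝ} (hc : 0 < c) :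
    laplace (F A τ) (toC (c • p)) = laplace (F B τ') (toC (c • p')) := by
  -- The real part of the parameter is absorbed into the point, by covariance of the Laplace
  -- transform.
  have key : ∀ {A : ProperLorentz}, A ∈ X → ∀ {τ : ℂ}, 0 < τ.im → τ.im < Real.pi →
      ∀ {p : Fin 4 → ℝ}, p ∈ massShell P → ∃ q ∈ massShell P,
        zetaPoint A (Complex.I * τ.im) q = zetaPoint A τ p ∧
        laplace (F A (Complex.I * τ.im)) (toC (c • q)) = laplace (F A τ) (toC (c • p)) := by
    intro A hA τ h0 h1 p hp
    have hτ : τ + ((-τ.re : ℝ) : ℂ) = Complex.I * τ.im := by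
      apply Complex.ext <;> simp
    refine ⟨(boostConj A (-τ.re)).1 *ᵥ p, lorentz_mem_massShell _ hP.out hp, ?_, ?_⟩
    · rw [← hτ, zetaPoint_mul_add]
    · rw [← hτ, toC_smul, ← lorentzC_mulVec_toC, ← Matrix.mulVec_smul, ← toC_smul]
      refine hF.laplace_add_real hA h0.le h1.le _ ?_
      rw [reV_toC]
      exact smul_mem_forwardCone hc (massShell_subset_forwardCone hP.out hp)
  obtain ⟨q, hq, hz, he⟩ := key hA h0 h1 hp
  obtain ⟨q', hq', hz', he'⟩ := key hB h0' h1' hp'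
  rw [← he, ← he']
  exact hF.laplace_eq_of_imag hA hB ⟨h0, h1⟩ ⟨h0', h1'⟩ hq hq' (by rw [hz, hz', h]) hc

end Consistency

/-! ### An approximate identity on the mass shell -/

theorem massShellMeasure_pos_of_isOpen {P : ℝ} (hP : 0 < P) {U : Set (Fin 4 → ℝ)} (hU : IsOpen U)
    {p : Fin 4 → ℝ} (hp : p ∈ massShell P) (hpU : p ∈ U) : 0 < massShellMeasure P U := by
  rw [pos_iff_ne_zero]
  intro h0
  have h1 := ae_shellPoint hP (measure_eq_zero_iff_ae_notMem.1 h0)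
  have h2 : IsOpen (shellPoint P ⁻¹' U) := hU.preimage (continuous_shellPoint P)
  refine (h2.measure_pos (volume : Measure (Fin 3 → ℝ)) ⟨fun j => p j.succ, ?_⟩).ne'
    (measure_eq_zero_iff_ae_notMem.2 h1)
  rw [Set.mem_preimage, shellPoint_tail hp]
  exact hpU

/-- Moving `p` to rest turns the Minkowski product into `√P q⁰`. A small excess energy then means a
small momentum, so the sets on which the product is near `P` shrink to `p`. -/
theorem exists_mink_lt_imp_mem {P : ℝ} (hP : 0 < P) {p : Fin 4 → ℝ} (hp : p ∈ massShell P)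
    {U : Set (Fin 4 → ℝ)} (hU : U ∈ nhds p) :
    ∃ δ > 0, ∀ q ∈ massShell P, mink p q < P + δ → q ∈ U := by
  have hs : 0 < √P := Real.sqrt_pos.2 hP
  have hs2 : √P * √P = P := Real.mul_self_sqrt hP.le
  set p₀ : Fin 4 → ℝ := ![√P, 0, 0, 0] with hp₀
  have hp₀' : p₀ ∈ massShell P := ⟨by simp [mink, p₀, hs2], by simpa [p₀] using hs⟩
  obtain ⟨A, hA⟩ := exists_mulVec_eq hP hp₀' hp
  have hcont : Continuous fun q : Fin 4 → ℝ => A.1 *ᵥ q :=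
    Continuous.matrix_mulVec continuous_const continuous_id
  have hV : (fun q : Fin 4 → ℝ => A.1 *ᵥ q) ⁻¹' U ∈ nhds p₀ :=
    hcont.continuousAt.preimage_mem_nhds (by rwa [hA])
  obtain ⟨r, hr, hball⟩ := Metric.mem_nhds_iff.1 hV
  -- With `q⁰ < √P + η` the squared momentum `(q⁰)² - P` is below `η (2√P + η)`, which has to be
  -- less than `r²`.
  set η := min (r / 2) (r ^ 2 / (2 * (2 * √P + r))) with hη
  have hη0 : 0 < η := lt_min (by positivity) (by positivity)
  have hηr : η < r := (min_le_left _ _).trans_lt (by linarith)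
  have hη2 : η * (2 * √P + η) < r ^ 2 := by
    calc η * (2 * √P + η) ≤ r ^ 2 / (2 * (2 * √P + r)) * (2 * √P + r) :=
          mul_le_mul (min_le_right _ _) (by linarith) (by positivity) (by positivity)
      _ = r ^ 2 / 2 := by field_simp
      _ < r ^ 2 := by nlinarith
  refine ⟨√P * η, by positivity, fun q hq hlt => ?_⟩
  set q' := (A⁻¹).1 *ᵥ q with hq'
  have hqq : A.1 *ᵥ q' = q := by
    rw [hq', lorentz_mulVec_mulVec, mul_inv_cancel, lorentz_coe_one, Matrix.one_mulVec]
  obtain ⟨h1, h2⟩ := lorentz_mem_massShell A⁻¹ hP hq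
  rw [← hq'] at h1 h2
  rw [← hA, ← hqq, lorentz_mink] at hlt
  have h3 : √P * q' 0 < √P * (√P + η) := by
    have : mink p₀ q' = √P * q' 0 := by simp [mink, p₀]
    rw [← this]; linarith
  have h4 : q' 0 < √P + η := lt_of_mul_lt_mul_left h3 hs.le
  simp only [mink] at h1
  have h5 : √P ≤ q' 0 := by
    refine abs_le_of_sq_le_sq' ?_ h2.le |>.2
    nlinarith [sq_nonneg (q' 1), sq_nonneg (q' 2), sq_nonneg (q' 3)]
  have h6 : q' 1 ^ 2 + q' 2 ^ 2 + q' 3 ^ 2 < r ^ 2 := by nlinarith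
  rw [← hqq]
  refine hball ?_
  rw [Metric.mem_ball, dist_pi_lt_iff hr]
  intro j
  rw [Real.dist_eq]
  have hj : ∀ x : ℝ, x ^ 2 < r ^ 2 → |x - 0| < r := fun x hx => by
    rw [sub_zero]; exact abs_lt_of_sq_lt_sq hx hr.le
  fin_cases j
  · change |q' 0 - √P| < r
    rw [abs_lt]; constructor <;> linarith
  · exact hj (q' 1) (by nlinarith [sq_nonneg (q' 2), sq_nonneg (q' 3)])
  · exact hj (q' 2) (by nlinarith [sq_nonneg (q' 1), sq_nonneg (q' 3)])
  · exact hj (q' 3) (by nlinarith [sq_nonneg (q' 1), sq_nonneg (q' 2)])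

/-- The unnormalised kernel `e^{-c{p, q}}`. -/
def expKernel (c : ℝ) (p q : Fin 4 → ℝ) : ENNReal := ENNReal.ofReal (Real.exp (-(c * mink p q)))

theorem expKernel_comm (c : ℝ) (p q : Fin 4 → ℝ) : expKernel c p q = expKernel c q p := by
  rw [expKernel, mink_comm, expKernel]

theorem measurable_expKernel (c : ℝ) :
    Measurable fun x : (Fin 4 → ℝ) × (Fin 4 → ℝ) => expKernel c x.1 x.2 := by
  unfold expKernel mink; fun_prop

theorem measurable_expKernel_right (c : ℝ) (p : Fin 4 → ℝ) : Measurable (expKernel c p) := by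
  unfold expKernel mink; fun_prop

/-- The normalisation `∫ e^{-c{p, q}}`, which does not depend on the point `p` of the mass shell. -/
def expNorm (P c : ℝ) : ENNReal :=
  ∫⁻ q, expKernel c (lcPoint P 1 0 0) q ∂(massShellMeasure P)

/-- The normalised kernel. -/
def shellKernel (P c : ℝ) (p q : Fin 4 → ℝ) : ENNReal := expKernel c p q / expNorm P c

theorem shellKernel_comm (P c : ℝ) (p q : Fin 4 → ℝ) :
    shellKernel P c p q = shellKernel P c q p := by
  rw [shellKernel, expKernel_comm, shellKernel]

theorem measurable_shellKernel (P c : ℝ) :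
    Measurable fun x : (Fin 4 → ℝ) × (Fin 4 → ℝ) => shellKernel P c x.1 x.2 :=
  (measurable_expKernel c).div_const _

theorem measurable_shellKernel_right (P c : ℝ) (p : Fin 4 → ℝ) :
    Measurable (shellKernel P c p) :=
  (measurable_expKernel_right c p).div_const _

section Kernel
variable {P : ℝ} [hP : Fact (0 < P)]

theorem lintegral_expKernel {p : Fin 4 → ℝ} (hp : p ∈ massShell P) (c : ℝ) :
    ∫⁻ q, expKernel c p q ∂(massShellMeasure P) = expNorm P c := by
  obtain ⟨A, hA⟩ := exists_mulVec_eq hP.out (lcPoint_mem_massShell hP.out one_pos 0 0) hp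
  rw [expNorm, ← (measurePreserving_lorentz hP.out A).lintegral_comp
    (measurable_expKernel_right c p), ← hA]
  simp only [expKernel, lorentz_mink]

theorem expNorm_lt_top {c : ℝ} (hc : 0 < c) : expNorm P c < ⊤ := by
  have hp : lcPoint P 1 0 0 ∈ massShell P := lcPoint_mem_massShell hP.out one_pos 0 0
  obtain ⟨ε, hε, h⟩ := exists_mul_le_mink (massShell_subset_forwardCone hP.out hp)
  refine lt_of_le_of_lt ?_ (lintegral_exp_neg_lt_top hP.out (c := c * ε) (by positivity))
  refine lintegral_mono_ae ?_
  filter_upwards [ae_mem_massShell hP.out] with q hq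
  refine ENNReal.ofReal_le_ofReal (Real.exp_le_exp.2 (neg_le_neg ?_))
  rw [mul_assoc]
  exact mul_le_mul_of_nonneg_left (h q (massShell_subset_forwardCone hP.out hq)) hc.le

theorem le_expNorm {p : Fin 4 → ℝ} (hp : p ∈ massShell P) {c : ℝ} (hc : 0 ≤ c) (δ : ℝ) :
    ENNReal.ofReal (Real.exp (-(c * (P + δ)))) * massShellMeasure P {q | mink p q < P + δ} ≤
      expNorm P c := by
  have hm : MeasurableSet {q : Fin 4 → ℝ | mink p q < P + δ} := by
    refine (isOpen_lt ?_ continuous_const).measurableSet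
    unfold mink; fun_prop
  rw [← lintegral_expKernel hp, ← setLIntegral_const]
  refine (setLIntegral_mono' hm fun q hq => ?_).trans (setLIntegral_le_lintegral _ _)
  refine ENNReal.ofReal_le_ofReal (Real.exp_le_exp.2 (neg_le_neg ?_))
  exact mul_le_mul_of_nonneg_left (le_of_lt hq) hc

theorem massShellMeasure_mink_lt_pos {p : Fin 4 → ℝ} (hp : p ∈ massShell P) {δ : ℝ} (hδ : 0 < δ) :
    0 < massShellMeasure P {q | mink p q < P + δ} := by
  refine massShellMeasure_pos_of_isOpen hP.out (isOpen_lt ?_ continuous_const) hp ?_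
  · unfold mink; fun_prop
  · rw [Set.mem_ofPred_eq, hp.1]; linarith

theorem expNorm_pos {c : ℝ} (hc : 0 ≤ c) : 0 < expNorm P c := by
  have hp : lcPoint P 1 0 0 ∈ massShell P := lcPoint_mem_massShell hP.out one_pos 0 0
  refine lt_of_lt_of_le ?_ (le_expNorm hp hc 1)
  exact ENNReal.mul_pos (by simpa using Real.exp_pos _)
    (massShellMeasure_mink_lt_pos hp one_pos).ne'

theorem lintegral_shellKernel {p : Fin 4 → ℝ} (hp : p ∈ massShell P) {c : ℝ} (hc : 0 < c) :
    ∫⁻ q, shellKernel P c p q ∂(massShellMeasure P) = 1 := by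
  simp only [shellKernel, div_eq_mul_inv]
  rw [lintegral_mul_const _ (measurable_expKernel_right c p), lintegral_expKernel hp,
    ENNReal.mul_inv_cancel (expNorm_pos hc.le).ne' (expNorm_lt_top hc).ne]

/-- Laplace's method: for `c ≥ 1` the numerator is at most a constant times `e^{-(c - 1)(P + δ)}`,
while the normalisation is at least a positive constant times `e^{-c (P + δ/2)}`. The quotient
decays like `e^{-cδ/2}`. -/
theorem tendsto_setLIntegral_shellKernel {p : Fin 4 → ℝ} (hp : p ∈ massShell P) {δ : ℝ}
    (hδ : 0 < δ) : Filter.Tendsto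
      (fun c => ∫⁻ q in {q | P + δ ≤ mink p q}, shellKernel P c p q ∂(massShellMeasure P))
      Filter.atTop (nhds 0) := by
  set m := massShellMeasure P {q | mink p q < P + δ / 2} with hm
  have hm0 : 0 < m := massShellMeasure_mink_lt_pos hp (by positivity)
  have hms : MeasurableSet {q : Fin 4 → ℝ | P + δ ≤ mink p q} := by
    refine (isClosed_le continuous_const ?_).measurableSet
    unfold mink; fun_prop
  have hC : expNorm P 1 / m ≠ ⊤ := ENNReal.div_ne_top (expNorm_lt_top one_pos).ne hm0.ne'
  have hlim : Filter.Tendsto (fun c : ℝ => ENNReal.ofReal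
      (Real.exp (P + δ) * Real.exp (-(δ / 2 * c))) * (expNorm P 1 / m)) Filter.atTop (nhds 0) := by
    have h1 : Filter.Tendsto (fun c : ℝ => Real.exp (P + δ) * Real.exp (-(δ / 2 * c)))
        Filter.atTop (nhds 0) := by
      rw [← mul_zero (Real.exp (P + δ))]
      refine Filter.Tendsto.const_mul _ (Real.tendsto_exp_neg_atTop_nhds_zero.comp ?_)
      exact Filter.tendsto_id.const_mul_atTop (by positivity)
    have h2 := ENNReal.Tendsto.mul_const (ENNReal.tendsto_ofReal h1) (b := expNorm P 1 / m)
      (Or.inr hC)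
    rwa [ENNReal.ofReal_zero, zero_mul] at h2
  refine tendsto_of_tendsto_of_tendsto_of_le_of_le' tendsto_const_nhds hlim
    (Filter.Eventually.of_forall fun c => zero_le) ?_
  filter_upwards [Filter.eventually_ge_atTop 1] with c hc
  simp only [shellKernel, div_eq_mul_inv]
  rw [lintegral_mul_const _ (measurable_expKernel_right c p)]
  have h1 : ∫⁻ q in {q | P + δ ≤ mink p q}, expKernel c p q ∂(massShellMeasure P) ≤
      ENNReal.ofReal (Real.exp (-((c - 1) * (P + δ)))) * expNorm P 1 := by
    rw [← lintegral_expKernel hp, ← lintegral_const_mul _ (measurable_expKernel_right 1 p)]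
    refine (setLIntegral_mono' hms fun q hq => ?_).trans (setLIntegral_le_lintegral _ _)
    rw [expKernel, expKernel, ← ENNReal.ofReal_mul (Real.exp_pos _).le, ← Real.exp_add]
    refine ENNReal.ofReal_le_ofReal (Real.exp_le_exp.2 ?_)
    have : P + δ ≤ mink p q := hq
    nlinarith
  have h2 := ENNReal.inv_le_inv.2 (le_expNorm hp (zero_le_one.trans hc) (δ / 2))
  rw [← hm] at h2
  refine (mul_le_mul' h1 h2).trans (le_of_eq ?_)
  have hexp : 0 < Real.exp (-(c * (P + δ / 2))) := Real.exp_pos _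
  rw [ENNReal.mul_inv (Or.inl (by simpa using hexp)) (Or.inl ENNReal.ofReal_ne_top),
    ← ENNReal.ofReal_inv_of_pos hexp, mul_mul_mul_comm, ← ENNReal.ofReal_mul (Real.exp_pos _).le,
    ← Real.exp_neg, ← Real.exp_add, ← Real.exp_add]
  congr 3
  ring

/-- The mean square oscillation with respect to the kernel. -/
def meanOscillation (P c : ℝ) (f : (Fin 4 → ℝ) → ℂ) : ENNReal :=
  ∫⁻ p, ∫⁻ q, ‖f q - f p‖ₑ ^ 2 * shellKernel P c p q ∂(massShellMeasure P) ∂(massShellMeasure P)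

theorem lintegral_lintegral_left {c : ℝ} (hc : 0 < c) (f : (Fin 4 → ℝ) → ENNReal) :
    ∫⁻ p, ∫⁻ q, f p * shellKernel P c p q ∂(massShellMeasure P) ∂(massShellMeasure P) =
      ∫⁻ p, f p ∂(massShellMeasure P) := by
  refine lintegral_congr_ae ?_
  filter_upwards [ae_mem_massShell hP.out] with p hp
  rw [lintegral_const_mul _ (measurable_shellKernel_right P c p), lintegral_shellKernel hp hc,
    mul_one]

theorem lintegral_lintegral_right {c : ℝ} (hc : 0 < c) {f : (Fin 4 → ℝ) → ENNReal}
    (hf : Measurable f) :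
    ∫⁻ p, ∫⁻ q, f q * shellKernel P c p q ∂(massShellMeasure P) ∂(massShellMeasure P) =
      ∫⁻ p, f p ∂(massShellMeasure P) := by
  rw [lintegral_lintegral_swap]
  · simp only [shellKernel_comm P c _ (_ : Fin 4 → ℝ)]
    rw [← lintegral_lintegral_left hc f]
  · exact ((hf.comp measurable_snd).mul (measurable_shellKernel P c)).aemeasurable

end Kernel

theorem ENNReal.add_sq_le (a b : ENNReal) : (a + b) ^ 2 ≤ 2 * (a ^ 2 + b ^ 2) := by
  have h := ENNReal.rpow_add_le_mul_rpow_add_rpow a b (p := 2) (by norm_num)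
  norm_num at h
  exact_mod_cast h

theorem ENNReal.exists_pos_const_mul_sq_le {C ε : ENNReal} (hC : C ≠ ⊤) (hε : 0 < ε) :
    ∃ δ : ENNReal, 0 < δ ∧ C * δ ^ 2 ≤ ε := by
  have h1 : Filter.Tendsto (fun δ : ENNReal => C * δ ^ 2) (nhdsWithin 0 (Set.Ioi 0)) (nhds 0) := by
    have := ENNReal.Tendsto.const_mul (a := C) ((ENNReal.continuous_pow 2).tendsto 0) (Or.inr hC)
    rw [zero_pow two_ne_zero, mul_zero] at this
    exact this.mono_left nhdsWithin_le_nhds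
  obtain ⟨r, h2, h3⟩ := ((h1.eventually_le_const hε).and self_mem_nhdsWithin).exists
  exact ⟨r, h3, h2⟩

/-- Cauchy–Schwarz for `f √k` and `√k`. -/
theorem lintegral_mul_sq_le {α : Type*} [MeasurableSpace α] {μ : Measure α} {f k : α → ENNReal}
    (hf : Measurable f) (hk : Measurable k) :
    (∫⁻ x, f x * k x ∂μ) ^ 2 ≤ (∫⁻ x, f x ^ 2 * k x ∂μ) * ∫⁻ x, k x ∂μ := by
  have h := ENNReal.lintegral_mul_le_Lp_mul_Lq μ Real.HolderConjugate.two_two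
    (f := fun x => f x * k x ^ (1 / 2 : ℝ)) (g := fun x => k x ^ (1 / 2 : ℝ))
    (hf.mul (hk.pow_const _)).aemeasurable (hk.pow_const _).aemeasurable
  have hk2 : ∀ x, k x ^ (1 / 2 : ℝ) * k x ^ (1 / 2 : ℝ) = k x := fun x => by
    rw [← ENNReal.rpow_add_of_nonneg _ _ (by norm_num) (by norm_num)]; norm_num
  have e1 : ∀ x, ((fun x => f x * k x ^ (1 / 2 : ℝ)) * fun x => k x ^ (1 / 2 : ℝ)) x =
      f x * k x := fun x => by
    rw [Pi.mul_apply, mul_assoc, hk2]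
  have e2 : ∀ x, (f x * k x ^ (1 / 2 : ℝ)) ^ (2 : ℝ) = f x ^ 2 * k x := fun x => by
    rw [ENNReal.rpow_two, mul_pow, sq (k x ^ (1 / 2 : ℝ)), hk2]
  have e3 : ∀ x, (k x ^ (1 / 2 : ℝ)) ^ (2 : ℝ) = k x := fun x => by
    rw [ENNReal.rpow_two, sq, hk2]
  simp only [e1, e2, e3] at h
  calc _ ≤ ((∫⁻ x, f x ^ 2 * k x ∂μ) ^ (1 / 2 : ℝ) * (∫⁻ x, k x ∂μ) ^ (1 / 2 : ℝ)) ^ 2 := by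
        gcongr
    _ = _ := by
        rw [mul_pow, ← ENNReal.rpow_two, ← ENNReal.rpow_two, ← ENNReal.rpow_mul,
          ← ENNReal.rpow_mul]
        norm_num

theorem L2Shell_lintegral_sq {P : ℝ} (F : L2Shell P) :
    ∫⁻ p, ‖F p‖ₑ ^ 2 ∂(massShellMeasure P) = ‖F‖ₑ ^ 2 := by
  have h := eLpNorm_eq_lintegral_rpow_enorm_toReal (μ := massShellMeasure P) (f := F) (p := 2)
    (by norm_num) (by norm_num)
  rw [Lp.enorm_def, h]
  norm_num
  rw [← ENNReal.rpow_two, ← ENNReal.rpow_mul]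
  norm_num

section Kernel
variable {P : ℝ} [hP : Fact (0 < P)]

omit hP in
theorem measurable_oscillation_integrand {f : (Fin 4 → ℝ) → ℂ} (hf : Measurable f) (c : ℝ) :
    Measurable fun x : (Fin 4 → ℝ) × (Fin 4 → ℝ) => ‖f x.2 - f x.1‖ₑ ^ 2 * shellKernel P c x.1 x.2 := by
  have h1 : Measurable fun x : (Fin 4 → ℝ) × (Fin 4 → ℝ) => f x.1 := hf.comp measurable_fst
  have h2 : Measurable fun x : (Fin 4 → ℝ) × (Fin 4 → ℝ) => f x.2 := hf.comp measurable_snd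
  exact ((h2.sub h1).enorm.pow_const 2).mul (measurable_shellKernel P c)

/-- Two uses of `(a + b)² ≤ 2 (a² + b²)` leave the errors `4 |f - g|²` at `p` and at `q`. The kernel
has total mass one in either variable, so each integrates to four times the squared distance. -/
theorem meanOscillation_le {f g : (Fin 4 → ℝ) → ℂ} (hf : Measurable f) (hg : Measurable g) {c : ℝ}
    (hc : 0 < c) : meanOscillation P c f ≤ 2 * meanOscillation P c g +
      8 * ∫⁻ p, ‖f p - g p‖ₑ ^ 2 ∂(massShellMeasure P) := by
  set h : (Fin 4 → ℝ) → ENNReal := fun p => ‖f p - g p‖ₑ ^ 2 with hh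
  have hhm : Measurable h := (hf.sub hg).enorm.pow_const 2
  have key : ∀ p q, ‖f q - f p‖ₑ ^ 2 ≤ 2 * ‖g q - g p‖ₑ ^ 2 + 4 * h q + 4 * h p := by
    intro p q
    have h1 : f q - f p = (g q - g p) + ((f q - g q) - (f p - g p)) := by ring
    calc ‖f q - f p‖ₑ ^ 2 ≤ (‖g q - g p‖ₑ + (‖f q - g q‖ₑ + ‖f p - g p‖ₑ)) ^ 2 := by
          rw [h1]
          gcongr
          refine (enorm_add_le _ _).trans ?_
          gcongr
          exact enorm_sub_le
      _ ≤ 2 * (‖g q - g p‖ₑ ^ 2 + 2 * (‖f q - g q‖ₑ ^ 2 + ‖f p - g p‖ₑ ^ 2)) := by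
          refine (ENNReal.add_sq_le _ _).trans ?_
          gcongr
          exact ENNReal.add_sq_le _ _
      _ = _ := by rw [hh]; ring
  set μ := massShellMeasure P
  have hk := measurable_shellKernel P c
  calc meanOscillation P c f ≤ ∫⁻ p, ∫⁻ q, (2 * (‖g q - g p‖ₑ ^ 2 * shellKernel P c p q) +
        (4 * (h q * shellKernel P c p q) + 4 * (h p * shellKernel P c p q))) ∂μ ∂μ := by
        refine lintegral_mono fun p => lintegral_mono fun q => ?_
        calc _ ≤ (2 * ‖g q - g p‖ₑ ^ 2 + 4 * h q + 4 * h p) * shellKernel P c p q :=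
              mul_le_mul_left (key p q) _
          _ = _ := by ring
    _ = 2 * meanOscillation P c g + (4 * ∫⁻ p, h p ∂μ + 4 * ∫⁻ p, h p ∂μ) := by
        have m1 := measurable_oscillation_integrand (P := P) hg c
        have m2 : Measurable fun x : (Fin 4 → ℝ) × (Fin 4 → ℝ) => h x.2 * shellKernel P c x.1 x.2 :=
          (hhm.comp measurable_snd).mul hk
        have m3 : Measurable fun x : (Fin 4 → ℝ) × (Fin 4 → ℝ) => h x.1 * shellKernel P c x.1 x.2 :=
          (hhm.comp measurable_fst).mul hk
        have n1 : ∀ p, Measurable fun q => ‖g q - g p‖ₑ ^ 2 * shellKernel P c p q :=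
          fun p => ((hg.sub_const _).enorm.pow_const 2).mul (measurable_shellKernel_right P c p)
        have n2 : ∀ p, Measurable fun q => h q * shellKernel P c p q :=
          fun p => hhm.mul (measurable_shellKernel_right P c p)
        have n3 : ∀ p, Measurable fun q => h p * shellKernel P c p q :=
          fun p => (measurable_shellKernel_right P c p).const_mul _
        have i1 : ∀ p, ∫⁻ q, (2 * (‖g q - g p‖ₑ ^ 2 * shellKernel P c p q) +
            (4 * (h q * shellKernel P c p q) + 4 * (h p * shellKernel P c p q))) ∂μ =
            2 * ∫⁻ q, ‖g q - g p‖ₑ ^ 2 * shellKernel P c p q ∂μ +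
            (4 * ∫⁻ q, h q * shellKernel P c p q ∂μ + 4 * ∫⁻ q, h p * shellKernel P c p q ∂μ) := by
          intro p
          rw [lintegral_add_left ((n1 p).const_mul 2), lintegral_add_left ((n2 p).const_mul 4),
            lintegral_const_mul _ (n1 p), lintegral_const_mul _ (n2 p),
            lintegral_const_mul _ (n3 p)]
        have o1 := m1.lintegral_prod_right' (ν := μ)
        have o2 := m2.lintegral_prod_right' (ν := μ)
        have o3 := m3.lintegral_prod_right' (ν := μ)
        rw [lintegral_congr i1, lintegral_add_left (o1.const_mul 2),
          lintegral_add_left (o2.const_mul 4), lintegral_const_mul _ o1, lintegral_const_mul _ o2,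
          lintegral_const_mul _ o3]
        have l1 := lintegral_lintegral_left (P := P) hc h
        have l2 := lintegral_lintegral_right (P := P) hc hhm
        rw [l1, l2]
        rfl
    _ = _ := by rw [← add_mul]; norm_num

/-- Near `p` continuity makes the oscillation small; away from `p` it is bounded and the kernel has
little mass. -/
theorem tendsto_lintegral_oscillation {p : Fin 4 → ℝ} (hp : p ∈ massShell P) {g : (Fin 4 → ℝ) → ℂ}
    (hg : Continuous g) {M : ℝ} (hM : ∀ q, ‖g q‖ ≤ M) : Filter.Tendsto
      (fun c => ∫⁻ q, ‖g q - g p‖ₑ ^ 2 * shellKernel P c p q ∂(massShellMeasure P))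
      Filter.atTop (nhds 0) := by
  rw [ENNReal.tendsto_nhds_zero]
  intro ε hε
  obtain ⟨r, hr0, hr⟩ : ∃ r : ℝ, 0 < r ∧ ENNReal.ofReal r ^ 2 ≤ ε / 2 := by
    obtain ⟨δ, h0, h1⟩ := ENNReal.exists_pos_const_mul_sq_le ENNReal.one_ne_top
      (ENNReal.half_pos hε.ne')
    rw [one_mul] at h1
    -- `δ` may be infinite; cutting it at `1` yields a real radius.
    have hne : min δ 1 ≠ ⊤ := ne_top_of_le_ne_top ENNReal.one_ne_top (min_le_right _ _)
    refine ⟨(min δ 1).toReal, ENNReal.toReal_pos (lt_min h0 one_pos).ne' hne, ?_⟩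
    rw [ENNReal.ofReal_toReal hne]
    exact (pow_le_pow_left' (min_le_left _ _) 2).trans h1
  obtain ⟨δ, hδ, hδ'⟩ := exists_mink_lt_imp_mem hP.out hp
    (hg.continuousAt.preimage_mem_nhds (Metric.ball_mem_nhds (g p) hr0))
  have hM0 : 0 ≤ M := (norm_nonneg _).trans (hM p)
  set C : ENNReal := ENNReal.ofReal (2 * M) ^ 2 with hC
  have htail := ENNReal.Tendsto.const_mul (tendsto_setLIntegral_shellKernel hp hδ) (a := C)
    (Or.inr (ENNReal.pow_ne_top ENNReal.ofReal_ne_top))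
  rw [mul_zero] at htail
  have hms : MeasurableSet {q : Fin 4 → ℝ | P + δ ≤ mink p q} := by
    refine (isClosed_le continuous_const ?_).measurableSet
    unfold mink; fun_prop
  filter_upwards [htail.eventually_le_const (ENNReal.half_pos hε.ne'),
    Filter.eventually_gt_atTop 0] with c h1 hc
  have hk := measurable_shellKernel_right P c p
  calc _ ≤ ∫⁻ q, (ε / 2 * shellKernel P c p q +
        {q | P + δ ≤ mink p q}.indicator (fun q => C * shellKernel P c p q) q)
          ∂(massShellMeasure P) := by
        refine lintegral_mono_ae ?_
        filter_upwards [ae_mem_massShell hP.out] with q hq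
        by_cases hqδ : P + δ ≤ mink p q
        · rw [Set.indicator_of_mem (show q ∈ {q | P + δ ≤ mink p q} from hqδ)]
          refine le_add_left (mul_le_mul_left ?_ _)
          rw [hC, ← ofReal_norm]
          gcongr
          refine (norm_sub_le _ _).trans ?_
          linarith [hM q, hM p]
        · refine le_add_right (mul_le_mul_left ?_ _)
          have := hδ' q hq (not_le.1 hqδ)
          rw [Set.mem_preimage, Metric.mem_ball, dist_eq_norm] at this
          refine le_trans ?_ hr
          rw [← ofReal_norm]
          gcongr
    _ = ε / 2 + C * ∫⁻ q in {q | P + δ ≤ mink p q}, shellKernel P c p q ∂(massShellMeasure P) := by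
        rw [lintegral_add_left (hk.const_mul _), lintegral_const_mul _ hk, lintegral_shellKernel hp hc,
          mul_one, lintegral_indicator hms, lintegral_const_mul _ hk]
    _ ≤ ε / 2 + ε / 2 := by gcongr
    _ = ε := ENNReal.add_halves ε

/-- The constant dominating function needs a set of finite measure. The integrand is symmetric in
`p` and `q` and vanishes unless one of them lies in the support of `g`, so the integral is at most
twice its part with `p` in the support, where dominated convergence applies. -/
theorem tendsto_meanOscillation {g : (Fin 4 → ℝ) → ℂ} (hg : Continuous g)
    (hs : HasCompactSupport g) :
    Filter.Tendsto (fun c => meanOscillation P c g) Filter.atTop (nhds 0) := by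
  obtain ⟨M, hM⟩ := hs.exists_bound_of_continuous hg
  have hM0 : 0 ≤ M := (norm_nonneg _).trans (hM 0)
  set μ := massShellMeasure P
  set S := tsupport g with hS
  have hSm : MeasurableSet S := (isClosed_tsupport g).measurableSet
  have hSfin : μ S < ⊤ := hs.isCompact.measure_lt_top
  set H : ℝ → (Fin 4 → ℝ) → ENNReal :=
    fun c p => ∫⁻ q, ‖g q - g p‖ₑ ^ 2 * shellKernel P c p q ∂μ with hH
  have hHm : ∀ c, Measurable (H c) := fun c =>
    (measurable_oscillation_integrand hg.measurable c).lintegral_prod_right'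
  have hlim : Filter.Tendsto (fun c => ∫⁻ p in S, H c p ∂μ) Filter.atTop (nhds 0) := by
    have h := tendsto_lintegral_filter_of_dominated_convergence (μ := μ.restrict S)
      (l := Filter.atTop) (F := H) (f := fun _ => 0) (fun _ => ENNReal.ofReal (2 * M) ^ 2)
      (Filter.Eventually.of_forall hHm) ?_ ?_ ?_
    · simpa using h
    · filter_upwards [Filter.eventually_gt_atTop 0] with c hc
      filter_upwards [ae_restrict_of_ae (ae_mem_massShell hP.out)] with p hp
      calc H c p ≤ ∫⁻ q, ENNReal.ofReal (2 * M) ^ 2 * shellKernel P c p q ∂μ := by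
            refine lintegral_mono fun q => mul_le_mul_left ?_ _
            rw [← ofReal_norm]
            gcongr
            refine (norm_sub_le _ _).trans ?_
            linarith [hM q, hM p]
        _ = _ := by
            rw [lintegral_const_mul _ (measurable_shellKernel_right P c p),
              lintegral_shellKernel hp hc, mul_one]
    · rw [setLIntegral_const]
      exact ENNReal.mul_ne_top (ENNReal.pow_ne_top ENNReal.ofReal_ne_top) hSfin.ne
    · filter_upwards [ae_restrict_of_ae (ae_mem_massShell hP.out)] with p hp
      exact tendsto_lintegral_oscillation hp hg hM
  have hlim2 := ENNReal.Tendsto.const_mul hlim (a := 2) (Or.inr (by norm_num))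
  rw [mul_zero] at hlim2
  refine tendsto_of_tendsto_of_tendsto_of_le_of_le tendsto_const_nhds hlim2
    (fun c => zero_le) fun c => ?_
  have m1 := measurable_oscillation_integrand (P := P) hg.measurable c
  set T : (Fin 4 → ℝ) → (Fin 4 → ℝ) → ENNReal :=
    fun p q => ‖g q - g p‖ₑ ^ 2 * shellKernel P c p q with hT
  have hTsymm : ∀ p q, T p q = T q p := fun p q => by
    simp only [hT]
    rw [shellKernel_comm, ← enorm_neg, neg_sub]
  have hT0 : ∀ p q, p ∉ S → q ∉ S → T p q = 0 := fun p q hp hq => by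
    simp only [hT]
    rw [image_eq_zero_of_notMem_tsupport hp, image_eq_zero_of_notMem_tsupport hq]
    simp
  have hi1 : Measurable fun x : (Fin 4 → ℝ) × (Fin 4 → ℝ) => S.indicator (fun p => T p x.2) x.1 := by
    have : (fun x : (Fin 4 → ℝ) × (Fin 4 → ℝ) => S.indicator (fun p => T p x.2) x.1) =
        (Prod.fst ⁻¹' S).indicator fun x => T x.1 x.2 := by
      ext x; by_cases h : x.1 ∈ S <;> simp [h]
    rw [this]
    exact m1.indicator (measurable_fst hSm)
  have e1 : ∫⁻ p, ∫⁻ q, S.indicator (fun p => T p q) p ∂μ ∂μ = ∫⁻ p in S, H c p ∂μ := by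
    rw [← lintegral_indicator hSm]
    refine lintegral_congr fun p => ?_
    by_cases h : p ∈ S <;> simp [h, hH, hT]
  have e2 : ∫⁻ p, ∫⁻ q, S.indicator (fun q => T p q) q ∂μ ∂μ = ∫⁻ p in S, H c p ∂μ := by
    rw [← e1, lintegral_lintegral_swap (f := fun p q => S.indicator (fun p => T p q) p)
      hi1.aemeasurable]
    refine lintegral_congr fun q => lintegral_congr fun p => ?_
    by_cases h : p ∈ S <;> simp [h, hTsymm]
  calc meanOscillation P c g ≤ ∫⁻ p, ∫⁻ q, (S.indicator (fun p => T p q) p +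
        S.indicator (fun q => T p q) q) ∂μ ∂μ := by
        refine lintegral_mono fun p => lintegral_mono fun q => ?_
        change T p q ≤ _
        by_cases hp : p ∈ S
        · rw [Set.indicator_of_mem hp]; exact le_self_add
        · by_cases hq : q ∈ S
          · rw [Set.indicator_of_mem hq]; exact le_add_self
          · rw [hT0 p q hp hq]; exact zero_le
    _ = (∫⁻ p, ∫⁻ q, S.indicator (fun p => T p q) p ∂μ ∂μ) +
        ∫⁻ p, ∫⁻ q, S.indicator (fun q => T p q) q ∂μ ∂μ := by
        have n1 : ∀ p, Measurable fun q => S.indicator (fun p => T p q) p :=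
          fun p => hi1.comp measurable_prodMk_left
        rw [← lintegral_add_left hi1.lintegral_prod_right']
        exact lintegral_congr fun p => lintegral_add_left (n1 p) _
    _ = _ := by rw [e1, e2, two_mul]

theorem tendsto_meanOscillation_L2Shell (F : L2Shell P) :
    Filter.Tendsto (fun c => meanOscillation P c F) Filter.atTop (nhds 0) := by
  rw [ENNReal.tendsto_nhds_zero]
  intro ε hε
  obtain ⟨δ, hδ0, hδ⟩ := ENNReal.exists_pos_const_mul_sq_le (C := 8) (by norm_num)
    (ENNReal.half_pos hε.ne')
  obtain ⟨g, hgs, hgF, hgc, hgm⟩ :=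
    (Lp.memLp F).exists_hasCompactSupport_eLpNorm_sub_le (by norm_num) hδ0.ne'
  have h2 := ENNReal.Tendsto.const_mul (tendsto_meanOscillation (P := P) hgc hgs) (a := 2)
    (Or.inr (by norm_num))
  rw [mul_zero] at h2
  filter_upwards [h2.eventually_le_const (ENNReal.half_pos hε.ne'),
    Filter.eventually_gt_atTop 0] with c h1 hc
  have h3 : ∫⁻ p, ‖F p - g p‖ₑ ^ 2 ∂(massShellMeasure P) ≤ δ ^ 2 := by
    have h := eLpNorm_eq_lintegral_rpow_enorm_toReal (μ := massShellMeasure P) (f := (F : (Fin 4 → ℝ) → ℂ) - g)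
      (p := 2)
      (by norm_num) (by norm_num)
    rw [h] at hgF
    have h4 := pow_le_pow_left' hgF 2
    rw [← ENNReal.rpow_two, ← ENNReal.rpow_mul] at h4
    norm_num at h4
    exact h4
  calc meanOscillation P c F ≤ _ :=
        meanOscillation_le (Lp.stronglyMeasurable F).measurable hgc.measurable hc
    _ ≤ ε / 2 + 8 * δ ^ 2 := by gcongr
    _ ≤ ε / 2 + ε / 2 := by gcongr
    _ = ε := ENNReal.add_halves ε

/-- The oscillation tends to zero uniformly on compact subsets of `L²`. -/
theorem eventually_meanOscillation_le {C : Set (L2Shell P)} (hC : IsCompact C) {ε : ENNReal}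
    (hε : 0 < ε) : ∀ᶠ c in Filter.atTop, ∀ F ∈ C, meanOscillation P c F ≤ ε := by
  obtain ⟨δ, hδ0, hδ⟩ := ENNReal.exists_pos_const_mul_sq_le (C := 8) (by norm_num)
    (ENNReal.half_pos hε.ne')
  -- Finitely many centres suffice by compactness, and the oscillation changes in a controlled way
  -- within each ball.
  obtain ⟨t, -, ht⟩ := hC.elim_nhds_subcover (fun F => Metric.eball F δ)
    fun F _ => Metric.eball_mem_nhds F hδ0
  have h4 : ε / 2 / 2 ≠ 0 := (ENNReal.half_pos (ENNReal.half_pos hε.ne').ne').ne'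
  have hev : ∀ᶠ c in Filter.atTop, ∀ G ∈ t, meanOscillation P c G ≤ ε / 2 / 2 := by
    rw [Filter.eventually_all_finset]
    intro G _
    exact (tendsto_meanOscillation_L2Shell G).eventually_le_const (pos_iff_ne_zero.2 h4)
  filter_upwards [hev, Filter.eventually_gt_atTop 0] with c h1 hc F hF
  obtain ⟨G, hGt, hG⟩ := Set.mem_iUnion₂.1 (ht hF)
  have h3 : ∫⁻ p, ‖F p - G p‖ₑ ^ 2 ∂(massShellMeasure P) ≤ δ ^ 2 := by
    have h5 : ∫⁻ p, ‖F p - G p‖ₑ ^ 2 ∂(massShellMeasure P) = ‖F - G‖ₑ ^ 2 := by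
      rw [← L2Shell_lintegral_sq]
      refine lintegral_congr_ae ?_
      filter_upwards [Lp.coeFn_sub F G] with p hp
      rw [hp, Pi.sub_apply]
    rw [h5, ← edist_eq_enorm_sub]
    exact pow_le_pow_left' (le_of_lt hG) 2
  calc meanOscillation P c F ≤ _ := meanOscillation_le (Lp.stronglyMeasurable F).measurable
        (Lp.stronglyMeasurable G).measurable hc
    _ ≤ 2 * (ε / 2 / 2) + 8 * δ ^ 2 := by
        have := h1 G hGt
        gcongr
    _ ≤ ε / 2 + ε / 2 := by
        gcongr
        rw [two_mul, ENNReal.add_halves]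
    _ = ε := ENNReal.add_halves ε

/-- The smoothing of `F` with the kernel, a normalised Laplace transform. -/
def smoothing (c : ℝ) (F : L2Shell P) (p : Fin 4 → ℝ) : ℂ :=
  laplace F (toC (c • p)) / ((expNorm P c).toReal : ℂ)

/-- The normalised kernel is a probability density in `q`, so the difference is the average of `F q
- F p`, to which Cauchy–Schwarz applies. -/
theorem enorm_smoothing_sub_sq_le {c : ℝ} (hc : 0 < c) (F : L2Shell P) {p : Fin 4 → ℝ}
    (hp : p ∈ massShell P) : ‖smoothing c F p - F p‖ₑ ^ 2 ≤
      ∫⁻ q, ‖F q - F p‖ₑ ^ 2 * shellKernel P c p q ∂(massShellMeasure P) := by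
  set μ := massShellMeasure P
  have hz : reV (toC (c • p)) ∈ forwardCone := by
    rw [reV_toC]; exact smul_mem_forwardCone hc (massShell_subset_forwardCone hP.out hp)
  set Z := (expNorm P c).toReal with hZ
  have hZ0 : 0 < Z := ENNReal.toReal_pos (expNorm_pos hc.le).ne' (expNorm_lt_top hc).ne
  have hZe : ENNReal.ofReal Z = expNorm P c := ENNReal.ofReal_toReal (expNorm_lt_top hc).ne
  have hexp : ∀ q, expFun (toC (c • p)) q = (Real.exp (-(c * mink p q)) : ℝ) := fun q => by
    rw [expFun, mink_toC, mink_smul_left]; push_cast; rfl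
  have hint1 : Integrable (fun q => F q * expFun (toC (c • p)) q) μ :=
    (Lp.memLp F).integrable_mul (memLp_expFun hz)
  have hk : ∀ q, ‖expFun (toC (c • p)) q‖ₑ = expKernel c p q := fun q => by
    rw [hexp, ← ofReal_norm, Complex.norm_real, Real.norm_eq_abs,
      abs_of_pos (Real.exp_pos _), expKernel]
  have hint2 : Integrable (expFun (toC (c • p))) μ := by
    refine ⟨(continuous_expFun _).aestronglyMeasurable, ?_⟩
    rw [hasFiniteIntegral_iff_enorm, lintegral_congr hk, lintegral_expKernel hp]
    exact expNorm_lt_top hc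
  have hZint : ∫ q, expFun (toC (c • p)) q ∂μ = Z := by
    rw [integral_congr_ae (Filter.Eventually.of_forall hexp), integral_complex_ofReal,
      integral_eq_lintegral_of_nonneg_ae (Filter.Eventually.of_forall fun q => (Real.exp_pos _).le)
      (Continuous.aestronglyMeasurable (by unfold mink; fun_prop)), hZ, ← lintegral_expKernel hp]
    rfl
  have hdiff : smoothing c F p - F p = (∫ q, (F q - F p) * expFun (toC (c • p)) q ∂μ) / Z := by
    have : ∫ q, (F q - F p) * expFun (toC (c • p)) q ∂μ =
        (∫ q, F q * expFun (toC (c • p)) q ∂μ) - F p * Z := by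
      rw [← hZint, ← integral_const_mul, ← integral_sub hint1 (hint2.const_mul _)]
      refine integral_congr_ae (Filter.Eventually.of_forall fun q => ?_)
      simp only; ring
    have hZc : (Z : ℂ) ≠ 0 := by exact_mod_cast hZ0.ne'
    rw [smoothing, laplace_eq F hz, this, ← hZ, sub_div, mul_div_cancel_right₀ _ hZc]
  have hle : ‖smoothing c F p - F p‖ₑ ≤ ∫⁻ q, ‖F q - F p‖ₑ * shellKernel P c p q ∂μ := by
    have hmF : Measurable fun q => ‖F q - F p‖ₑ :=
      ((Lp.stronglyMeasurable F).measurable.sub_const _).enorm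
    rw [hdiff, div_eq_mul_inv, enorm_mul, enorm_inv (by exact_mod_cast hZ0.ne')]
    have hZn : ‖(Z : ℂ)‖ₑ = expNorm P c := by
      rw [← ofReal_norm, Complex.norm_real, Real.norm_eq_abs, abs_of_pos hZ0, hZe]
    rw [hZn]
    simp only [shellKernel, div_eq_mul_inv, ← mul_assoc]
    rw [lintegral_mul_const (f := fun q => ‖F q - F p‖ₑ * expKernel c p q) _ (hmF.mul (measurable_expKernel_right c p))]
    refine mul_le_mul_left ((enorm_integral_le_lintegral_enorm _).trans (le_of_eq ?_)) _
    refine lintegral_congr fun q => ?_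
    rw [enorm_mul, hk]
  have hmF : Measurable fun q => ‖F q - F p‖ₑ :=
    ((Lp.stronglyMeasurable F).measurable.sub_const _).enorm
  refine (pow_le_pow_left' hle 2).trans ?_
  have := lintegral_mul_sq_le (μ := μ) hmF (measurable_shellKernel_right P c p)
  rwa [lintegral_shellKernel hp hc, mul_one] at this

end Kernel

/-! ### Mean value inequalities -/

theorem measurable_indicator_of_continuousOn {α β : Type*} [TopologicalSpace α] [MeasurableSpace α]
    [BorelSpace α] [TopologicalSpace β] [MeasurableSpace β] [BorelSpace β] [Zero β] {s : Set α}
    (hs : MeasurableSet s) {f : α → β} (hf : ContinuousOn f s) : Measurable (s.indicator f) := by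
  classical
  rw [← Set.piecewise_eq_indicator]
  exact hf.measurable_piecewise continuousOn_const hs

theorem lintegral_complex {f : ℂ → ENNReal} (hf : Measurable f) :
    ∫⁻ z, f z = ∫⁻ y : ℝ, ∫⁻ x : ℝ, f (x + y * Complex.I) := by
  have h1 := Complex.volume_preserving_equiv_real_prod.symm.lintegral_comp hf
  have hm : Measurable fun q : ℝ × ℝ => f (q.1 + q.2 * Complex.I) := by
    refine hf.comp ?_
    fun_prop
  rw [← h1, Measure.volume_eq_prod, ← lintegral_prod_symm' _ hm]
  refine lintegral_congr fun q => ?_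
  congr 1
  apply Complex.ext <;> simp [Complex.measurableEquivRealProd]

theorem lintegral_comp_mul_left {f : ℝ → ENNReal} (hf : Measurable f) {a : ℝ} (ha : a ≠ 0) :
    ENNReal.ofReal |a| * ∫⁻ x, f (a * x) = ∫⁻ x, f x := by
  have h := Real.smul_map_volume_mul_left ha
  calc _ = ENNReal.ofReal |a| * ∫⁻ x, f x ∂(Measure.map (a * ·) volume) := by
        rw [lintegral_map hf (measurable_const_mul a)]
    _ = ∫⁻ x, f x ∂(ENNReal.ofReal |a| • Measure.map (a * ·) volume) := by
        rw [lintegral_smul_measure, smul_eq_mul]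
    _ = _ := by rw [h]

/-- Integration over `ℂ` in the real coordinates given by `1` and a non-real number `κ`. -/
theorem lintegral_complex_skew {f : ℂ → ENNReal} (hf : Measurable f) {κ : ℂ} (hκ : κ.im ≠ 0) :
    ∫⁻ z, f z = ENNReal.ofReal |κ.im| * ∫⁻ b : ℝ, ∫⁻ x : ℝ, f (x + b * κ) := by
  rw [lintegral_complex hf]
  have hm : Measurable fun y : ℝ => ∫⁻ x : ℝ, f (x + y * Complex.I) := by
    have : Measurable fun q : ℝ × ℝ => f (q.2 + q.1 * Complex.I) := by
      refine hf.comp ?_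
      fun_prop
    exact this.lintegral_prod_right'
  -- Substitute `y = b Im κ`; the real part of `b κ` is then absorbed by a translation of `x`.
  rw [← lintegral_comp_mul_left hm hκ]
  congr 1
  refine lintegral_congr fun b => ?_
  rw [← lintegral_add_right_eq_self (fun x : ℝ => f (x + (κ.im * b : ℝ) * Complex.I)) (b * κ.re)]
  refine lintegral_congr fun x => ?_
  congr 1
  apply Complex.ext
  · simp
  · simp; ring

theorem lintegral_complex_skew₂ {f : ℂ × ℂ → ENNReal} (hf : Measurable f) {κ : ℂ}
    (hκ : κ.im ≠ 0) :
    ∫⁻ v₁, ∫⁻ v₂, f (v₁, v₂) = ENNReal.ofReal |κ.im| ^ 2 *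
      ∫⁻ b : ℝ × ℝ, ∫⁻ x : ℝ × ℝ, f (x.1 + b.1 * κ, x.2 + b.2 * κ) := by
  have h1 : ∀ v₁, ∫⁻ v₂, f (v₁, v₂) =
      ENNReal.ofReal |κ.im| * ∫⁻ b : ℝ, ∫⁻ x : ℝ, f (v₁, x + b * κ) := fun v₁ =>
    lintegral_complex_skew (hf.comp measurable_prodMk_left) hκ
  have m1 : Measurable fun v₁ : ℂ => ∫⁻ v₂, f (v₁, v₂) := hf.lintegral_prod_right'
  rw [lintegral_complex_skew m1 hκ]
  simp only [h1]
  have m3 : Measurable fun q : (ℝ × ℝ) × ℝ => ∫⁻ x₂ : ℝ, f (q.2 + q.1.1 * κ, x₂ + q.1.2 * κ) := by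
    have : Measurable fun q : ((ℝ × ℝ) × ℝ) × ℝ => f (q.1.2 + q.1.1.1 * κ, q.2 + q.1.1.2 * κ) := by
      refine hf.comp ?_
      fun_prop
    exact this.lintegral_prod_right'
  have m3b : ∀ b₁ : ℝ, Measurable fun q : ℝ × ℝ => ∫⁻ x₂ : ℝ, f (q.1 + b₁ * κ, x₂ + q.2 * κ) := by
    intro b₁
    have : Measurable fun q : (ℝ × ℝ) × ℝ => f (q.1.1 + b₁ * κ, q.2 + q.1.2 * κ) := by
      refine hf.comp ?_
      fun_prop
    exact this.lintegral_prod_right'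
  have m2b : ∀ b₁ : ℝ, Measurable fun x₁ : ℝ => ∫⁻ b : ℝ, ∫⁻ x : ℝ, f (x₁ + b₁ * κ, x + b * κ) :=
    fun b₁ => (m3b b₁).lintegral_prod_right'
  have e1 : ∀ b₁ : ℝ, ∫⁻ x₁ : ℝ, ENNReal.ofReal |κ.im| *
      ∫⁻ b : ℝ, ∫⁻ x : ℝ, f (x₁ + b₁ * κ, x + b * κ) = ENNReal.ofReal |κ.im| *
      ∫⁻ b : ℝ, ∫⁻ x₁ : ℝ, ∫⁻ x : ℝ, f (x₁ + b₁ * κ, x + b * κ) := fun b₁ => by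
    rw [lintegral_const_mul _ (m2b b₁), lintegral_lintegral_swap (m3b b₁).aemeasurable]
  have m5 : Measurable fun b : ℝ × ℝ => ∫⁻ x₁ : ℝ, ∫⁻ x : ℝ, f (x₁ + b.1 * κ, x + b.2 * κ) :=
    m3.lintegral_prod_right'
  simp only [e1]
  have e2 : ∫⁻ b : ℝ × ℝ, ∫⁻ x : ℝ × ℝ, f (x.1 + b.1 * κ, x.2 + b.2 * κ) =
      ∫⁻ b : ℝ × ℝ, ∫⁻ x₁ : ℝ, ∫⁻ x : ℝ, f (x₁ + b.1 * κ, x + b.2 * κ) :=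
    lintegral_congr fun b => by
      have m6 : Measurable fun q : ℝ × ℝ => f (q.1 + b.1 * κ, q.2 + b.2 * κ) := by
        refine hf.comp ?_
        fun_prop
      rw [Measure.volume_eq_prod ℝ ℝ, lintegral_prod _ m6.aemeasurable]
  rw [lintegral_const_mul _ (m5.lintegral_prod_right' (ν := volume)), ← mul_assoc, ← sq, e2,
    Measure.volume_eq_prod ℝ ℝ, lintegral_prod _ m5.aemeasurable]

/-- The mean value property on a circle, with the angles shifted by periodicity to the interval used
by polar coordinates. -/
theorem enorm_mul_le_lintegral_circle {h : ℂ → ℂ} {z₀ : ℂ} {R ρ : ℝ}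
    (hd : DifferentiableOn ℂ h (Metric.ball z₀ R)) (h0 : 0 < ρ) (h1 : ρ < R) :
    ENNReal.ofReal (2 * Real.pi) * ‖h z₀‖ₑ ≤
      ∫⁻ θ in Set.Ioo (-Real.pi) Real.pi, ‖h (circleMap z₀ ρ θ)‖ₑ := by
  have hpi := Real.pi_pos
  have hdc : DiffContOnCl ℂ h (Metric.ball z₀ |ρ|) := by
    refine DifferentiableOn.diffContOnCl_ball (U := Metric.ball z₀ R) hd ?_
    rw [abs_of_pos h0]
    exact Metric.closedBall_subset_ball h1
  have hav := hdc.circleAverage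
  have hper : Function.Periodic (fun θ => h (circleMap z₀ ρ θ)) (2 * Real.pi) := fun θ => by
    simp only [periodic_circleMap z₀ ρ θ]
  have hint : ∫ θ in (0)..(2 * Real.pi), h (circleMap z₀ ρ θ) =
      ∫ θ in (-Real.pi)..Real.pi, h (circleMap z₀ ρ θ) := by
    have := hper.intervalIntegral_add_eq 0 (-Real.pi)
    rw [zero_add, show -Real.pi + 2 * Real.pi = Real.pi by ring] at this
    exact this
  rw [Real.circleAverage_def, hint, intervalIntegral.integral_of_le (by linarith),
    integral_Ioc_eq_integral_Ioo] at hav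
  have e : ENNReal.ofReal (2 * Real.pi) * ‖h z₀‖ₑ =
      ‖∫ θ in Set.Ioo (-Real.pi) Real.pi, h (circleMap z₀ ρ θ)‖ₑ := by
    rw [← hav, enorm_smul, ← mul_assoc, ← ofReal_norm, norm_inv, Real.norm_eq_abs,
      abs_of_pos (by positivity), ← ENNReal.ofReal_mul (by positivity),
      mul_inv_cancel₀ (by positivity), ENNReal.ofReal_one, one_mul]
  rw [e]
  exact enorm_integral_le_lintegral_enorm _

/-- Only radii in `(r/2, r)` are used, with the polar weight bounded below by `r/2`. This gives the
constant `2π · (r/2) · (r/2)`. -/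
theorem enorm_mul_le_lintegral_ball {h : ℂ → ℂ} {z₀ : ℂ} {R r : ℝ}
    (hd : DifferentiableOn ℂ h (Metric.ball z₀ R)) (h0 : 0 < r) (h1 : r < R) :
    ENNReal.ofReal (Real.pi * r ^ 2 / 2) * ‖h z₀‖ₑ ≤ ∫⁻ z in Metric.ball z₀ r, ‖h z‖ₑ := by
  set f : ℂ → ENNReal := (Metric.ball z₀ r).indicator fun z => ‖h z‖ₑ with hf
  have hfm : Measurable f := measurable_indicator_of_continuousOn Metric.isOpen_ball.measurableSet
    ((hd.continuousOn.mono (Metric.ball_subset_ball h1.le)).enorm)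
  rw [← lintegral_indicator Metric.isOpen_ball.measurableSet,
    ← lintegral_add_left_eq_self (fun z => f z) z₀, ← Complex.lintegral_comp_polarCoord_symm]
  set g : ℝ × ℝ → ENNReal :=
    fun p => ENNReal.ofReal p.1 * f (z₀ + Complex.polarCoord.symm p) with hg
  have hgm : Measurable g := by
    have : Measurable fun p : ℝ × ℝ => f (z₀ + Complex.polarCoord.symm p) := by
      simp only [Complex.polarCoord_symm_apply]
      refine hfm.comp ?_
      fun_prop
    exact measurable_fst.ennreal_ofReal.mul this
  calc ENNReal.ofReal (Real.pi * r ^ 2 / 2) * ‖h z₀‖ₑ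
      = ∫⁻ ρ in Set.Ioo (r / 2) r, ENNReal.ofReal (r / 2) *
          (ENNReal.ofReal (2 * Real.pi) * ‖h z₀‖ₑ) := by
        rw [setLIntegral_const, Real.volume_Ioo, ← mul_assoc,
          ← ENNReal.ofReal_mul (by positivity), mul_right_comm,
          ← ENNReal.ofReal_mul (by positivity)]
        congr 2; ring
    _ ≤ ∫⁻ ρ in Set.Ioo (r / 2) r, ∫⁻ θ in Set.Ioo (-Real.pi) Real.pi, g (ρ, θ) := by
        refine setLIntegral_mono' measurableSet_Ioo fun ρ hρ => ?_
        have hρ0 : 0 < ρ := by linarith [hρ.1]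
        refine (mul_le_mul' (ENNReal.ofReal_le_ofReal hρ.1.le)
          (enorm_mul_le_lintegral_circle hd hρ0 (hρ.2.trans h1))).trans ?_
        rw [← lintegral_const_mul' _ _ ENNReal.ofReal_ne_top]
        refine lintegral_mono fun θ => ?_
        have e : z₀ + Complex.polarCoord.symm (ρ, θ) = circleMap z₀ ρ θ := by
          rw [Complex.polarCoord_symm_apply, circleMap, Complex.exp_mul_I]
          push_cast; rfl
        have hmem : circleMap z₀ ρ θ ∈ Metric.ball z₀ r := by
          rw [Metric.mem_ball, dist_eq_norm, circleMap_sub_center, norm_circleMap_zero,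
            abs_of_pos hρ0]
          exact hρ.2
        simp only [hg, e, hf, Set.indicator_of_mem hmem]
        exact le_rfl
    _ ≤ ∫⁻ ρ in Set.Ioi 0, ∫⁻ θ in Set.Ioo (-Real.pi) Real.pi, g (ρ, θ) :=
        lintegral_mono_set fun ρ hρ => by
          have := hρ.1
          simp only [Set.mem_Ioi]; linarith
    _ = ∫⁻ p in Complex.polarCoord.target, g p := by
        rw [Complex.polarCoord_target, Measure.volume_eq_prod, setLIntegral_prod _ hgm.aemeasurable]
    _ = _ := by simp only [hg, smul_eq_mul]; rfl

/-- The mean value inequality over polydiscs in `ℂ³`. -/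
theorem enorm_mul_le_lintegral_polydisc {h : ℂ → ℂ → ℂ → ℂ} {z₁ z₂ z₃ : ℂ} {R r : ℝ}
    (hd : DifferentiableOn ℂ (fun z : ℂ × ℂ × ℂ => h z.1 z.2.1 z.2.2)
      (Metric.ball (z₁, z₂, z₃) R)) (h0 : 0 < r) (h1 : r < R) :
    ENNReal.ofReal (Real.pi * r ^ 2 / 2) ^ 3 * ‖h z₁ z₂ z₃‖ₑ ≤
      ∫⁻ s in Metric.ball z₁ r, ∫⁻ v₁ in Metric.ball z₂ r, ∫⁻ v₂ in Metric.ball z₃ r,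
        ‖h s v₁ v₂‖ₑ := by
  have hmem : ∀ {a b c : ℂ}, a ∈ Metric.ball z₁ R → b ∈ Metric.ball z₂ R → c ∈ Metric.ball z₃ R →
      (a, b, c) ∈ Metric.ball (z₁, z₂, z₃) R := fun ha hb hc => by
    rw [← ball_prod_same, ← ball_prod_same]; exact ⟨ha, hb, hc⟩
  have hz : ∀ z : ℂ, z ∈ Metric.ball z R := fun z => Metric.mem_ball_self (h0.trans h1)
  set C := ENNReal.ofReal (Real.pi * r ^ 2 / 2) with hC
  have hCt : C ≠ ⊤ := ENNReal.ofReal_ne_top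
  have d1 : DifferentiableOn ℂ (fun s => h s z₂ z₃) (Metric.ball z₁ R) :=
    DifferentiableOn.comp (g := fun z : ℂ × ℂ × ℂ => h z.1 z.2.1 z.2.2)
      (f := fun s => (s, z₂, z₃)) hd (by fun_prop) fun s hs => hmem hs (hz _) (hz _)
  have d2 : ∀ s ∈ Metric.ball z₁ R, DifferentiableOn ℂ (fun v => h s v z₃) (Metric.ball z₂ R) :=
    fun s hs => DifferentiableOn.comp (g := fun z : ℂ × ℂ × ℂ => h z.1 z.2.1 z.2.2)
      (f := fun v => (s, v, z₃)) hd (by fun_prop) fun v hv => hmem hs hv (hz _)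
  have d3 : ∀ s ∈ Metric.ball z₁ R, ∀ v ∈ Metric.ball z₂ R,
      DifferentiableOn ℂ (fun w => h s v w) (Metric.ball z₃ R) :=
    fun s hs v hv => DifferentiableOn.comp (g := fun z : ℂ × ℂ × ℂ => h z.1 z.2.1 z.2.2)
      (f := fun w => (s, v, w)) hd (by fun_prop) fun w hw => hmem hs hv hw
  have hsub : ∀ z : ℂ, Metric.ball z r ⊆ Metric.ball z R := fun z =>
    Metric.ball_subset_ball h1.le
  calc C ^ 3 * ‖h z₁ z₂ z₃‖ₑ = C * C * (C * ‖h z₁ z₂ z₃‖ₑ) := by ring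
    _ ≤ C * C * ∫⁻ s in Metric.ball z₁ r, ‖h s z₂ z₃‖ₑ := by
        gcongr
        exact enorm_mul_le_lintegral_ball d1 h0 h1
    _ = C * ∫⁻ s in Metric.ball z₁ r, C * ‖h s z₂ z₃‖ₑ := by
        rw [lintegral_const_mul' _ _ hCt, mul_assoc]
    _ ≤ C * ∫⁻ s in Metric.ball z₁ r, ∫⁻ v₁ in Metric.ball z₂ r, ‖h s v₁ z₃‖ₑ := by
        refine mul_le_mul' le_rfl (setLIntegral_mono' Metric.isOpen_ball.measurableSet fun s hs => ?_)
        exact enorm_mul_le_lintegral_ball (d2 s (hsub _ hs)) h0 h1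
    _ = ∫⁻ s in Metric.ball z₁ r, ∫⁻ v₁ in Metric.ball z₂ r, C * ‖h s v₁ z₃‖ₑ := by
        rw [← lintegral_const_mul' _ _ hCt]
        refine lintegral_congr fun s => ?_
        rw [lintegral_const_mul' _ _ hCt]
    _ ≤ _ := by
        refine setLIntegral_mono' Metric.isOpen_ball.measurableSet fun s hs => ?_
        refine setLIntegral_mono' Metric.isOpen_ball.measurableSet fun v hv => ?_
        exact enorm_mul_le_lintegral_ball (d3 s (hsub _ hs) v (hsub _ hv)) h0 h1

/-- Integration over `ℂ³` in the coordinates `(t + iσ, x₁ + b₁ κ, x₂ + b₂ κ)`, where `κ` depends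
on `t` and `σ`. -/
theorem lintegral_skew_le {H : ℂ × ℂ × ℂ → ENNReal} (hH : Measurable H) {κ : ℂ → ℂ}
    (hκm : Measurable κ) {C ε : ENNReal} {S : Set (ℝ × ℝ × ℝ)} (hS : MeasurableSet S)
    (hκ : ∀ s v₁ v₂, H (s, v₁, v₂) ≠ 0 → (κ s).im ≠ 0 ∧ ENNReal.ofReal |(κ s).im| ≤ C)
    (hle : ∀ σ b₁ b₂ : ℝ, ∫⁻ x : ℝ × ℝ, ∫⁻ t : ℝ, H (t + σ * Complex.I,
      x.1 + b₁ * κ (t + σ * Complex.I), x.2 + b₂ * κ (t + σ * Complex.I)) ≤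
        S.indicator (fun _ => ε) (σ, b₁, b₂)) :
    ∫⁻ s, ∫⁻ v₁, ∫⁻ v₂, H (s, v₁, v₂) ≤ C ^ 2 * (ε * volume S) := by
  set G : ℝ → ℝ → ℝ × ℝ → ℝ × ℝ → ENNReal := fun σ t b x => H (t + σ * Complex.I,
      x.1 + b.1 * κ (t + σ * Complex.I), x.2 + b.2 * κ (t + σ * Complex.I)) with hG
  have hκ' : Measurable fun q : ((ℝ × ℝ) × (ℝ × ℝ)) × (ℝ × ℝ) =>
      κ (q.1.1.2 + q.1.1.1 * Complex.I) := by
    refine hκm.comp ?_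
    fun_prop
  have mG : Measurable fun q : ((ℝ × ℝ) × (ℝ × ℝ)) × (ℝ × ℝ) => G q.1.1.1 q.1.1.2 q.1.2 q.2 := by
    refine hH.comp ?_
    fun_prop
  have step1 : ∀ s, ∫⁻ v₁, ∫⁻ v₂, H (s, v₁, v₂) ≤
      C ^ 2 * ∫⁻ b : ℝ × ℝ, ∫⁻ x : ℝ × ℝ, H (s, x.1 + b.1 * κ s, x.2 + b.2 * κ s) := by
    intro s
    -- The number `κ s` may be real only where `H (s, ·, ·)` vanishes identically, and there the
    -- inequality is trivial. Elsewhere the Jacobian is `|Im κ|² ≤ C²`.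
    by_cases h0 : ∀ v₁ v₂, H (s, v₁, v₂) = 0
    · simp [h0]
    · push Not at h0
      obtain ⟨v₁, v₂, hv⟩ := h0
      obtain ⟨h1, h2⟩ := hκ s v₁ v₂ hv
      rw [lintegral_complex_skew₂ (f := fun v => H (s, v.1, v.2))
        (hH.comp (by fun_prop : Measurable fun v : ℂ × ℂ => (s, v.1, v.2))) h1]
      gcongr
  have hm2 : Measurable fun s : ℂ =>
      ∫⁻ b : ℝ × ℝ, ∫⁻ x : ℝ × ℝ, H (s, x.1 + b.1 * κ s, x.2 + b.2 * κ s) := by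
    have : Measurable fun q : (ℂ × (ℝ × ℝ)) × (ℝ × ℝ) =>
        H (q.1.1, q.2.1 + q.1.2.1 * κ q.1.1, q.2.2 + q.1.2.2 * κ q.1.1) := by
      have hk : Measurable fun q : (ℂ × (ℝ × ℝ)) × (ℝ × ℝ) => κ q.1.1 :=
        hκm.comp (by fun_prop)
      refine hH.comp ?_
      fun_prop
    exact this.lintegral_prod_right'.lintegral_prod_right'
  have mG2 : Measurable fun q : (ℝ × ℝ) × (ℝ × ℝ) => ∫⁻ x, G q.1.1 q.1.2 q.2 x :=
    mG.lintegral_prod_right'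
  calc _ ≤ ∫⁻ s, C ^ 2 * ∫⁻ b : ℝ × ℝ, ∫⁻ x : ℝ × ℝ,
          H (s, x.1 + b.1 * κ s, x.2 + b.2 * κ s) := lintegral_mono step1
    _ = C ^ 2 * ∫⁻ σ : ℝ, ∫⁻ t : ℝ, ∫⁻ b, ∫⁻ x, G σ t b x := by
        rw [lintegral_const_mul _ hm2, lintegral_complex hm2]
    _ = C ^ 2 * ∫⁻ σ : ℝ, ∫⁻ b : ℝ × ℝ, ∫⁻ x, ∫⁻ t, G σ t b x := by
        congr 1
        refine lintegral_congr fun σ => ?_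
        have m3 : Measurable fun q : ℝ × (ℝ × ℝ) => ∫⁻ x, G σ q.1 q.2 x :=
          mG2.comp (by fun_prop : Measurable fun q : ℝ × (ℝ × ℝ) => ((σ, q.1), q.2))
        rw [lintegral_lintegral_swap (f := fun t b => ∫⁻ x, G σ t b x) m3.aemeasurable]
        refine lintegral_congr fun b => ?_
        have m4 : Measurable fun q : ℝ × (ℝ × ℝ) => G σ q.1 b q.2 :=
          mG.comp (by fun_prop : Measurable fun q : ℝ × (ℝ × ℝ) => (((σ, q.1), b), q.2))
        rw [lintegral_lintegral_swap (f := fun t x => G σ t b x) m4.aemeasurable]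
    _ ≤ C ^ 2 * ∫⁻ σ : ℝ, ∫⁻ b : ℝ × ℝ, S.indicator (fun _ => ε) (σ, b.1, b.2) := by
        gcongr with σ b
        exact hle σ b.1 b.2
    _ = _ := by
        have m5 : Measurable (S.indicator fun _ => ε) := measurable_const.indicator hS
        rw [← lintegral_prod (fun q : ℝ × ℝ × ℝ => S.indicator (fun _ => ε) q) m5.aemeasurable,
          ← Measure.volume_eq_prod, lintegral_indicator_const hS]

/-! ### Uniform limits of holomorphic functions of several variables -/

/-- Cauchy's estimate on balls makes the derivatives uniformly Cauchy as well, so the limit is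
differentiable with the limit of the derivatives. -/
theorem differentiableOn_of_uniformCauchySeqOn {E : Type*} [NormedAddCommGroup E] [NormedSpace ℂ E]
    {f : ℕ → E → ℂ} {g : E → ℂ} {U : Set E} (hU : IsOpen U)
    (hf : ∀ n, DifferentiableOn ℂ (f n) U) (hc : UniformCauchySeqOn f Filter.atTop U)
    (hlim : ∀ x ∈ U, Filter.Tendsto (fun n => f n x) Filter.atTop (nhds (g x))) :
    DifferentiableOn ℂ g U := by
  intro x hx
  obtain ⟨r, hr, hball⟩ := Metric.isOpen_iff.1 hU x hx
  have hsub : ∀ y ∈ Metric.ball x (r / 2), Metric.ball y (r / 2) ⊆ U := fun y hy =>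
    (Metric.ball_subset_ball' (by rw [Metric.mem_ball] at hy; linarith)).trans hball
  have hyU : ∀ y ∈ Metric.ball x (r / 2), y ∈ U := fun y hy =>
    hsub y hy (Metric.mem_ball_self (by positivity))
  have hd : ∀ n, ∀ y ∈ U, HasFDerivAt (f n) (fderiv ℂ (f n) y) y := fun n y hy =>
    ((hf n).differentiableAt (hU.mem_nhds hy)).hasFDerivAt
  have hcd : UniformCauchySeqOn (fun n => fderiv ℂ (f n)) Filter.atTop (Metric.ball x (r / 2)) := by
    rw [Metric.uniformCauchySeqOn_iff] at hc ⊢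
    intro ε hε
    obtain ⟨N, hN⟩ := hc (ε * r / 8) (by positivity)
    refine ⟨N, fun m hm n hn y hy => ?_⟩
    have h1 : DifferentiableOn ℂ (fun z => f m z - f n z) (Metric.ball y (r / 2)) :=
      ((hf m).sub (hf n)).mono (hsub y hy)
    have h2 : Set.MapsTo (fun z => f m z - f n z) (Metric.ball y (r / 2))
        (Metric.closedBall (f m y - f n y) (ε * r / 4)) := by
      intro z hz
      have e1 := hN m hm n hn z (hsub y hy hz)
      have e2 := hN m hm n hn y (hyU y hy)
      rw [dist_eq_norm] at e1 e2
      rw [Metric.mem_closedBall, dist_eq_norm]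
      refine (norm_sub_le _ _).trans ?_
      linarith
    have h3 := Complex.norm_fderiv_le_div_of_mapsTo_ball h1 h2 (by positivity)
    have h4 : fderiv ℂ (fun z => f m z - f n z) y = fderiv ℂ (f m) y - fderiv ℂ (f n) y :=
      ((hd m y (hyU y hy)).sub (hd n y (hyU y hy))).fderiv
    rw [h4] at h3
    rw [dist_eq_norm]
    refine h3.trans_lt ?_
    rw [div_lt_iff₀ (by positivity)]
    nlinarith [mul_pos hε hr]
  have hex : ∀ y, ∃ L : E →L[ℂ] ℂ, y ∈ Metric.ball x (r / 2) →
      Filter.Tendsto (fun n => fderiv ℂ (f n) y) Filter.atTop (nhds L) := by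
    intro y
    by_cases hy : y ∈ Metric.ball x (r / 2)
    · obtain ⟨L, hL⟩ := cauchySeq_tendsto_of_complete (hcd.cauchySeq hy)
      exact ⟨L, fun _ => hL⟩
    · exact ⟨0, fun h => absurd h hy⟩
  choose L hL using hex
  have h5 := hcd.tendstoUniformlyOn_of_tendsto hL
  exact (hasFDerivAt_of_tendstoUniformlyOn Metric.isOpen_ball h5
    (fun n y hy => hd n y (hyU y hy)) (fun y hy => hlim y (hyU y hy))
    (Metric.mem_ball_self (by positivity))).differentiableAt.differentiableWithinAt

/-! ### Local convergence of the regularised continuations -/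

/-- The smoothed continuation in the chart of `A`, at the parameters `z = (s, v₁, v₂)`. -/
def chartLaplace {P : ℝ} (A : ProperLorentz) (σ : ℝ) (F : L2Shell P) (c : ℝ) (z : ℂ × ℂ × ℂ) : ℂ :=
  laplace F (boostAt A (Complex.I * σ) *ᵥ ((c : ℂ) • chartPoint P A z.1 z.2.1 z.2.2)) /
    ((expNorm P c).toReal : ℂ)

/-- The parameters at which `chartLaplace` represents a smoothing of the continued orbit. -/
structure IsRegularParam (P : ℝ) (X : Set ProperLorentz) (A : ProperLorentz) (σ : ℝ)
    (z : ℂ × ℂ × ℂ) : Prop where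
  im_pos : 0 < z.1.im
  im_lt : z.1.im < Real.pi
  mem : A * nullRotL (nullParam z.1 z.2.1) (nullParam z.1 z.2.2) ∈ X
  small : (nullParam z.1 z.2.1 * Real.exp (-z.1.re)) ^ 2 +
    (nullParam z.1 z.2.2 * Real.exp (-z.1.re)) ^ 2 < P
  cone : ∀ y ∈ Set.uIcc z.1.im σ,
    reV (boostAt A (Complex.I * (y : ℝ)) *ᵥ chartPoint P A z.1 z.2.1 z.2.2) ∈ forwardCone

theorem differentiable_chartPoint (P : ℝ) (A : ProperLorentz) :
    Differentiable ℂ fun z : ℂ × ℂ × ℂ => chartPoint P A z.1 z.2.1 z.2.2 := fun z =>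
  (differentiable_mulVec (lorentzC A)).differentiableAt.comp z
    (differentiableAt_lcPoint (by fun_prop) (by fun_prop) (by fun_prop) (by fun_prop)
      (Complex.exp_ne_zero _))

theorem nullParam_ofReal (s : ℂ) (x : ℝ) : nullParam s x = 0 := by
  simp [nullParam]

theorem boostAt_chartPoint_real (P : ℝ) (A : ProperLorentz) (σ t x₁ x₂ : ℝ) :
    boostAt A (Complex.I * σ) *ᵥ chartPoint P A (t + Complex.I * σ) x₁ x₂ =
      toC (realPoint P A t x₁ x₂) := by
  rw [← zetaPoint_realPoint, zetaPoint_eq, boostAt_mulVec_add, add_neg_cancel, boostAt_zero,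
    Matrix.one_mulVec]

section Local
variable {P : ℝ} [hP : Fact (0 < P)] {X : Set ProperLorentz} {ψ : L2Shell P}
  {F : ProperLorentz → ℂ → L2Shell P}

/-- At a fixed complex point, `isBoostPath_nullRot` passes from the null-rotated frame to `A` at the
angle `Im s`, and then the angle is moved to `σ` within the frame `A`. The left side uses one fixed
vector and is visibly holomorphic in `z`; the right side is the smoothing of an `L²` vector at a
real point. -/
theorem IsRegularParam.chartLaplace_eq (hF : BoostExtension X ψ F) {A : ProperLorentz}
    (hA : A ∈ X) {σ : ℝ} (hσ : σ ∈ Set.Icc 0 Real.pi) {z : ℂ × ℂ × ℂ}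
    (hz : IsRegularParam P X A σ z) {c : ℝ} (hc : 0 < c) :
    chartLaplace A σ (F A (Complex.I * σ)) c z =
      smoothing c (F (A * nullRotL (nullParam z.1 z.2.1) (nullParam z.1 z.2.2))
        (Complex.I * z.1.im))
        (realPoint P A z.1.re (realParam z.1 z.2.1) (realParam z.1 z.2.2)) := by
  have hr : z.1.im ∈ Set.Ioo 0 Real.pi := ⟨hz.im_pos, hz.im_lt⟩
  have hs := (Real.sin_pos_of_pos_of_lt_pi hz.im_pos hz.im_lt).ne'
  have hpc : c • realPoint P A z.1.re (realParam z.1 z.2.1) (realParam z.1 z.2.2) ∈ forwardCone :=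
    smul_mem_forwardCone hc (massShell_subset_forwardCone hP.out (realPoint_mem hP.out _ _ _ _))
  have h1 := (isBoostPath_nullRot (P := P) A hc hz.small (x₁ := realParam z.1 z.2.1)
    (x₂ := realParam z.1 z.2.2)).laplace_eq_real hF hA hz.mem hpc hr
  have h2 : boostAt (A * nullRotL (nullParam z.1 z.2.1) (nullParam z.1 z.2.2))
      (-(Complex.I * z.1.im)) *ᵥ
        toC (c • realPoint P A z.1.re (realParam z.1 z.2.1) (realParam z.1 z.2.2)) =
      (c : ℂ) • chartPoint P A z.1 z.2.1 z.2.2 := by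
    rw [chartPoint_eq A hs, toC_smul, Matrix.mulVec_smul]
  rw [h2, id] at h1
  rw [chartLaplace, smoothing, ← h1]
  congr 1
  refine (hF.laplace_eq_of_uIcc hA ⟨hr.1.le, hr.2.le⟩ hσ fun y hy => ?_).symm
  rw [Matrix.mulVec_smul, reV_smul]
  exact smul_mem_forwardCone hc (hz.cone y hy)

theorem differentiableOn_chartLaplace {U : Set (ℂ × ℂ × ℂ)} {A : ProperLorentz} {σ : ℝ}
    (hU : ∀ z ∈ U, IsRegularParam P X A σ z) (G : L2Shell P) {c : ℝ} (hc : 0 < c) :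
    DifferentiableOn ℂ (chartLaplace A σ G c) U := by
  intro z hz
  refine DifferentiableAt.differentiableWithinAt ?_
  have h1 : DifferentiableAt ℂ (fun z : ℂ × ℂ × ℂ => boostAt A (Complex.I * σ) *ᵥ
      ((c : ℂ) • chartPoint P A z.1 z.2.1 z.2.2)) z :=
    (differentiable_mulVec (boostAt A (Complex.I * σ))).differentiableAt.comp z
      ((differentiable_chartPoint P A z).const_smul (c : ℂ))
  have h2 := differentiableAt_laplace (differentiableAt_const G) h1 (by
    rw [Matrix.mulVec_smul, reV_smul]
    exact smul_mem_forwardCone hc ((hU z hz).cone σ Set.right_mem_uIcc))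
  have h3 := h2.mul_const (((expNorm P c).toReal : ℂ)⁻¹)
  have e : chartLaplace A σ G c = fun z : ℂ × ℂ × ℂ => laplace G (boostAt A (Complex.I * σ) *ᵥ
      ((c : ℂ) • chartPoint P A z.1 z.2.1 z.2.2)) * ((expNorm P c).toReal : ℂ)⁻¹ := by
    funext y
    rw [chartLaplace, div_eq_mul_inv]
  rw [e]
  exact h3

theorem eventually_nullParam_mem (t σ x₁ x₂ : ℝ) (hσ : σ ∈ Set.Ioo 0 Real.pi)
    {S : Set (ℝ × ℝ × ℝ)} (hS : S ∈ nhds (σ, (0 : ℝ), (0 : ℝ))) :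
    ∀ᶠ z : ℂ × ℂ × ℂ in nhds (t + Complex.I * σ, (x₁ : ℂ), (x₂ : ℂ)),
      (z.1.im, nullParam z.1 z.2.1, nullParam z.1 z.2.2) ∈ S := by
  set s : ℂ := t + Complex.I * σ with hs
  have him : s.im = σ := by simp [s]
  have hsin : Real.sin s.im ≠ 0 := by rw [him]; exact (Real.sin_pos_of_pos_of_lt_pi hσ.1 hσ.2).ne'
  have e1 : ContinuousAt (fun y : ℂ × ℂ × ℂ => nullParam y.1 y.2.1) (s, (x₁ : ℂ), (x₂ : ℂ)) :=
    continuousAt_nullParam (by fun_prop) (by fun_prop) hsin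
  have e2 : ContinuousAt (fun y : ℂ × ℂ × ℂ => nullParam y.1 y.2.2) (s, (x₁ : ℂ), (x₂ : ℂ)) :=
    continuousAt_nullParam (by fun_prop) (by fun_prop) hsin
  have e0 : ContinuousAt (fun y : ℂ × ℂ × ℂ => y.1.im) (s, (x₁ : ℂ), (x₂ : ℂ)) := by fun_prop
  have e := e0.prodMk (e1.prodMk e2)
  refine e.eventually_mem ?_
  simpa only [nullParam_ofReal, him] using hS

theorem eventually_isRegularParam {A : ProperLorentz} (hA : A ∈ interior X) (t σ x₁ x₂ : ℝ)
    (hσ : σ ∈ Set.Ioo 0 Real.pi) :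
    ∀ᶠ z in nhds ((t + Complex.I * σ, (x₁ : ℂ), (x₂ : ℂ)) : ℂ × ℂ × ℂ),
      IsRegularParam P X A σ z := by
  set z₀ : ℂ × ℂ × ℂ := (t + Complex.I * σ, (x₁ : ℂ), (x₂ : ℂ)) with hz₀
  have him : (t + Complex.I * σ : ℂ).im = σ := by simp
  have h1 := eventually_nullRot_mem hA (s := t + Complex.I * σ) (by simpa using hσ.1)
    (by simpa using hσ.2) x₁ x₂
  have hsin : Real.sin (t + Complex.I * σ : ℂ).im ≠ 0 := by
    rw [him]; exact (Real.sin_pos_of_pos_of_lt_pi hσ.1 hσ.2).ne'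
  have h2 : ∀ᶠ z in nhds z₀, (nullParam z.1 z.2.1 * Real.exp (-z.1.re)) ^ 2 +
      (nullParam z.1 z.2.2 * Real.exp (-z.1.re)) ^ 2 < P := by
    have e1 : ContinuousAt (fun y : ℂ × ℂ × ℂ => nullParam y.1 y.2.1) z₀ :=
      continuousAt_nullParam (by fun_prop) (by fun_prop) hsin
    have e2 : ContinuousAt (fun y : ℂ × ℂ × ℂ => nullParam y.1 y.2.2) z₀ :=
      continuousAt_nullParam (by fun_prop) (by fun_prop) hsin
    have e3 : ContinuousAt (fun y : ℂ × ℂ × ℂ => Real.exp (-y.1.re)) z₀ := by fun_prop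
    have e4 := ((e1.mul e3).pow 2).add ((e2.mul e3).pow 2)
    refine e4.eventually (gt_mem_nhds ?_)
    simp only [Pi.add_apply, Pi.mul_apply, Pi.pow_apply, hz₀, nullParam_ofReal]
    simpa using hP.out
  have h3 : ∀ᶠ x : ℝ × (ℂ × ℂ × ℂ) in nhds (σ, z₀),
      reV (boostAt A (Complex.I * (x.1 : ℝ)) *ᵥ chartPoint P A x.2.1 x.2.2.1 x.2.2.2) ∈
        forwardCone := by
    have hc : Continuous fun x : ℝ × (ℂ × ℂ × ℂ) =>
        boostAt A (Complex.I * (x.1 : ℝ)) *ᵥ chartPoint P A x.2.1 x.2.2.1 x.2.2.2 :=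
      ((continuous_boostAt A).comp (by fun_prop)).matrix_mulVec
        ((differentiable_chartPoint P A).continuous.comp continuous_snd)
    refine hc.continuousAt.eventually (isOpen_reV_forwardCone.mem_nhds ?_)
    have := boostAt_chartPoint_real P A σ t x₁ x₂
    simp only [hz₀]
    rw [this]
    change reV (toC (realPoint P A t x₁ x₂)) ∈ forwardCone
    rw [reV_toC]
    exact massShell_subset_forwardCone hP.out (realPoint_mem hP.out _ _ _ _)
  rw [nhds_prod_eq] at h3
  obtain ⟨pa, ha, pb, hb, h4⟩ := Filter.eventually_prod_iff.1 h3
  -- The cone condition is needed on the whole segment between `Im s` and `σ`; an interval around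
  -- `σ` as first factor of a product neighbourhood contains it.
  obtain ⟨ε, hε, h5⟩ := Metric.eventually_nhds_iff_ball.1 ha
  have h6 : ∀ᶠ z in nhds z₀, z.1.im ∈ Metric.ball σ ε := by
    have e0 : ContinuousAt (fun y : ℂ × ℂ × ℂ => y.1.im) z₀ := by fun_prop
    refine e0.eventually_mem (Metric.isOpen_ball.mem_nhds ?_)
    simp only [hz₀, him]
    exact Metric.mem_ball_self hε
  filter_upwards [h1, h2, hb, h6] with z g1 g2 g3 g6
  refine ⟨g1.1, g1.2.1, interior_subset g1.2.2, g2, fun y hy => h4 (h5 y ?_) g3⟩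
  have := Metric.mem_ball_self (x := σ) hε
  rw [Real.ball_eq_Ioo] at g6 this ⊢
  exact Set.OrdConnected.uIcc_subset Set.ordConnected_Ioo g6 this hy

end Local

/-- In the coordinates `v = x + b (e^{-s} - e^{-Re s})` the frame is given by `b` alone and the real
point by `Re s` and `x`. So for fixed `Im s` and `b` the chart is a copy of the mass shell carrying
a single `L²` vector. -/
theorem skew_params {s : ℂ} (hs : Real.sin s.im ≠ 0) (x b : ℝ) :
    nullParam s (x + b * (Complex.exp (-s) - (Real.exp (-s.re) : ℝ))) = b ∧
      realParam s (x + b * (Complex.exp (-s) - (Real.exp (-s.re) : ℝ))) = x := by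
  have hre : (Complex.exp (-s)).re = Real.exp (-s.re) * Real.cos s.im := by
    rw [Complex.exp_re]; simp
  have him : (Complex.exp (-s)).im = -(Real.exp (-s.re) * Real.sin s.im) := by
    rw [Complex.exp_im]; simp
  have h1 : nullParam s (x + b * (Complex.exp (-s) - (Real.exp (-s.re) : ℝ))) = b := by
    have : ((x : ℂ) + b * (Complex.exp (-s) - (Real.exp (-s.re) : ℝ))).im =
        -(b * (Real.exp (-s.re) * Real.sin s.im)) := by
      rw [Complex.add_im, Complex.im_ofReal_mul, Complex.sub_im, him, Complex.ofReal_im,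
        Complex.ofReal_im]
      ring
    rw [nullParam, this, Real.exp_neg]
    field_simp
  refine ⟨h1, ?_⟩
  rw [realParam, h1]
  have : ((x : ℂ) + b * (Complex.exp (-s) - (Real.exp (-s.re) : ℝ))).re =
      x + b * (Real.exp (-s.re) * Real.cos s.im - Real.exp (-s.re)) := by
    rw [Complex.add_re, Complex.re_ofReal_mul, Complex.sub_re, hre, Complex.ofReal_re,
      Complex.ofReal_re]
  rw [this]; ring

section Local
variable {P : ℝ} [hP : Fact (0 < P)] {X : Set ProperLorentz} {ψ : L2Shell P}
  {F : ProperLorentz → ℂ → L2Shell P}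

/-- The pointwise oscillation of `f`. -/
def shellOscillation (P c : ℝ) (f : (Fin 4 → ℝ) → ℂ) (p : Fin 4 → ℝ) : ENNReal :=
  ∫⁻ q, ‖f q - f p‖ₑ ^ 2 * shellKernel P c p q ∂(massShellMeasure P)

theorem measurable_shellOscillation (c : ℝ) (G : L2Shell P) : Measurable (shellOscillation P c G) := by
  exact (measurable_oscillation_integrand (Lp.stronglyMeasurable G).measurable c).lintegral_prod_right'

theorem enorm_smoothing_sub_smoothing_sq_le {c c' : ℝ} (hc : 0 < c) (hc' : 0 < c') (G : L2Shell P)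
    {p : Fin 4 → ℝ} (hp : p ∈ massShell P) : ‖smoothing c G p - smoothing c' G p‖ₑ ^ 2 ≤
      2 * (shellOscillation P c G p + shellOscillation P c' G p) := by
  have h : smoothing c G p - smoothing c' G p =
      (smoothing c G p - G p) - (smoothing c' G p - G p) := by ring
  rw [h]
  calc _ ≤ (‖smoothing c G p - G p‖ₑ + ‖smoothing c' G p - G p‖ₑ) ^ 2 :=
        pow_le_pow_left' enorm_sub_le 2
    _ ≤ _ := (ENNReal.add_sq_le _ _).trans (by
        gcongr
        · exact enorm_smoothing_sub_sq_le hc G hp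
        · exact enorm_smoothing_sub_sq_le hc' G hp)

theorem lintegral_realPoint (A : ProperLorentz) {f : (Fin 4 → ℝ) → ENNReal} (hf : Measurable f) :
    ∫⁻ x : ℝ × ℝ, ∫⁻ t : ℝ, f (realPoint P A t x.1 x.2) = ∫⁻ p, f p ∂(massShellMeasure P) := by
  have h := lintegral_lightCone hP.out (f := fun p => f (A.1 *ᵥ p)) (hf.comp (measurable_mulVec A.1))
  rw [← (measurePreserving_lorentz hP.out A).lintegral_comp hf, h]
  rfl

/-- On each slice of fixed `(Im s, b₁, b₂)` the measure `dt dx₁ dx₂` is the invariant measure, so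
the slice integral is at most twice the sum of two mean oscillations, that is, `4 ε`. The slices are
integrated over `S`, and the Jacobian is bounded since `|Im κ| ≤ e^{-Re s} ≤ e^{-T}`. -/
theorem lintegral_chartLaplace_sub_sq_le (hF : BoostExtension X ψ F) {A : ProperLorentz}
    (hA : A ∈ X) {σ : ℝ} (hσ : σ ∈ Set.Icc 0 Real.pi) {U : Set (ℂ × ℂ × ℂ)} (hU : IsOpen U)
    (hreg : ∀ z ∈ U, IsRegularParam P X A σ z) {S : Set (ℝ × ℝ × ℝ)} (hS : MeasurableSet S)
    (hUS : ∀ z ∈ U, (z.1.im, nullParam z.1 z.2.1, nullParam z.1 z.2.2) ∈ S) {T : ℝ}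
    (hT : ∀ z ∈ U, T ≤ z.1.re) {c c' : ℝ} (hc : 0 < c) (hc' : 0 < c') {ε : ENNReal}
    (hε : ∀ y ∈ S, meanOscillation P c (F (A * nullRotL y.2.1 y.2.2) (Complex.I * y.1)) ≤ ε)
    (hε' : ∀ y ∈ S, meanOscillation P c' (F (A * nullRotL y.2.1 y.2.2) (Complex.I * y.1)) ≤ ε) :
    ∫⁻ s, ∫⁻ v₁, ∫⁻ v₂, U.indicator (fun z => ‖chartLaplace A σ (F A (Complex.I * σ)) c z -
        chartLaplace A σ (F A (Complex.I * σ)) c' z‖ₑ ^ 2) (s, v₁, v₂) ≤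
      ENNReal.ofReal (Real.exp (-T)) ^ 2 * (4 * ε * volume S) := by
  have hcont : ContinuousOn (fun z => ‖chartLaplace A σ (F A (Complex.I * σ)) c z -
        chartLaplace A σ (F A (Complex.I * σ)) c' z‖ₑ ^ 2) U := by
    have h1 := (differentiableOn_chartLaplace hreg (F A (Complex.I * σ)) hc).continuousOn
    have h2 := (differentiableOn_chartLaplace hreg (F A (Complex.I * σ)) hc').continuousOn
    exact (ENNReal.continuous_pow 2).comp_continuousOn (continuous_enorm.comp_continuousOn (h1.sub h2))
  set κ : ℂ → ℂ := fun s => Complex.exp (-s) - (Real.exp (-s.re) : ℝ) with hκ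
  have hκm : Measurable κ := by
    have : Continuous κ := by fun_prop
    exact this.measurable
  refine lintegral_skew_le (measurable_indicator_of_continuousOn hU.measurableSet hcont) hκm hS
    (C := ENNReal.ofReal (Real.exp (-T))) ?_ ?_
  · intro s v₁ v₂ hne
    have hz : (s, v₁, v₂) ∈ U := Set.mem_of_indicator_ne_zero hne
    have h0 := (hreg _ hz).im_pos
    have h1 := (hreg _ hz).im_lt
    have hs := Real.sin_pos_of_pos_of_lt_pi h0 h1
    have him : (κ s).im = -(Real.exp (-s.re) * Real.sin s.im) := by
      rw [hκ, Complex.sub_im, Complex.ofReal_im, Complex.exp_im]; simp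
    have hpos : 0 < Real.exp (-s.re) * Real.sin s.im := mul_pos (Real.exp_pos _) hs
    rw [him, abs_neg, abs_of_pos hpos]
    refine ⟨neg_ne_zero.2 hpos.ne', ENNReal.ofReal_le_ofReal ?_⟩
    calc _ ≤ Real.exp (-s.re) * 1 := by gcongr; exact Real.sin_le_one _
      _ ≤ _ := by rw [mul_one, Real.exp_le_exp]; linarith [hT _ hz]
  · intro σ' b₁ b₂
    have key : ∀ (x : ℝ × ℝ) (t : ℝ), (t + σ' * Complex.I, x.1 + b₁ * κ (t + σ' * Complex.I),
        x.2 + b₂ * κ (t + σ' * Complex.I)) ∈ U → (σ', b₁, b₂) ∈ S ∧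
        ‖chartLaplace A σ (F A (Complex.I * σ)) c (t + σ' * Complex.I,
          x.1 + b₁ * κ (t + σ' * Complex.I), x.2 + b₂ * κ (t + σ' * Complex.I)) -
        chartLaplace A σ (F A (Complex.I * σ)) c' (t + σ' * Complex.I,
          x.1 + b₁ * κ (t + σ' * Complex.I), x.2 + b₂ * κ (t + σ' * Complex.I))‖ₑ ^ 2 ≤
        2 * (shellOscillation P c (F (A * nullRotL b₁ b₂) (Complex.I * σ')) (realPoint P A t x.1 x.2) +
          shellOscillation P c' (F (A * nullRotL b₁ b₂) (Complex.I * σ')) (realPoint P A t x.1 x.2)) := by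
      intro x t hz
      have hr := hreg _ hz
      have hs : Real.sin (t + σ' * Complex.I : ℂ).im ≠ 0 :=
        (Real.sin_pos_of_pos_of_lt_pi hr.im_pos hr.im_lt).ne'
      have him : (t + σ' * Complex.I : ℂ).im = σ' := by simp
      have hre : (t + σ' * Complex.I : ℂ).re = t := by simp
      obtain ⟨n1, r1⟩ := skew_params hs x.1 b₁
      obtain ⟨n2, r2⟩ := skew_params hs x.2 b₂
      have hmem := hUS _ hz
      have e1 := hr.chartLaplace_eq hF hA hσ hc
      have e2 := hr.chartLaplace_eq hF hA hσ hc'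
      simp only [hκ] at hmem e1 e2 ⊢
      rw [n1, n2, him] at hmem
      rw [n1, n2, r1, r2, him, hre] at e1 e2
      refine ⟨hmem, ?_⟩
      rw [hre, e1, e2]
      exact enorm_smoothing_sub_smoothing_sq_le hc hc' _ (realPoint_mem hP.out _ _ _ _)
    by_cases hmem : (σ', b₁, b₂) ∈ S
    · rw [Set.indicator_of_mem hmem]
      have g1 := hε (σ', b₁, b₂) hmem
      have g2 := hε' (σ', b₁, b₂) hmem
      dsimp only at g1 g2
      generalize F (A * nullRotL b₁ b₂) (Complex.I * σ') = G at key g1 g2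
      have m1 := measurable_shellOscillation c G
      have m2 := measurable_shellOscillation c' G
      have m4 : Measurable fun p => shellOscillation P c G p + shellOscillation P c' G p := m1.add m2
      have m3 : Measurable fun p => 2 * (shellOscillation P c G p + shellOscillation P c' G p) :=
        m4.const_mul 2
      have h3 := lintegral_realPoint (P := P) A m3
      calc _ ≤ ∫⁻ x : ℝ × ℝ, ∫⁻ t : ℝ, 2 * (shellOscillation P c G (realPoint P A t x.1 x.2) +
            shellOscillation P c' G (realPoint P A t x.1 x.2)) := by
            refine lintegral_mono fun x => lintegral_mono fun t => ?_
            by_cases hz : (t + σ' * Complex.I, x.1 + b₁ * κ (t + σ' * Complex.I),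
              x.2 + b₂ * κ (t + σ' * Complex.I)) ∈ U
            · rw [Set.indicator_of_mem hz]
              exact (key x t hz).2
            · rw [Set.indicator_of_notMem hz]
              exact zero_le
        _ = 2 * (meanOscillation P c G + meanOscillation P c' G) := by
            rw [h3, lintegral_const_mul _ m4, lintegral_add_left m1]
            rfl
        _ ≤ 2 * (ε + ε) := mul_le_mul_right (add_le_add g1 g2) 2
        _ = 4 * ε := by ring
    · have h0 : ∀ (x : ℝ × ℝ) (t : ℝ), (t + σ' * Complex.I, x.1 + b₁ * κ (t + σ' * Complex.I),
        x.2 + b₂ * κ (t + σ' * Complex.I)) ∉ U := fun x t hz => hmem (key x t hz).1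
      rw [Set.indicator_of_notMem hmem]
      simp [Set.indicator_of_notMem (h0 _ _)]

end Local

theorem setLIntegral_polydisc_le {U : Set (ℂ × ℂ × ℂ)} {z₁ z₂ z₃ : ℂ} {r : ℝ}
    (hU : Metric.ball (z₁, z₂, z₃) r ⊆ U) (H : ℂ × ℂ × ℂ → ENNReal) :
    ∫⁻ s in Metric.ball z₁ r, ∫⁻ v₁ in Metric.ball z₂ r, ∫⁻ v₂ in Metric.ball z₃ r, H (s, v₁, v₂) ≤
      ∫⁻ s, ∫⁻ v₁, ∫⁻ v₂, U.indicator H (s, v₁, v₂) := by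
  refine le_trans (setLIntegral_mono' Metric.isOpen_ball.measurableSet fun s hs => ?_)
    (setLIntegral_le_lintegral _ _)
  refine le_trans (setLIntegral_mono' Metric.isOpen_ball.measurableSet fun v₁ hv₁ => ?_)
    (setLIntegral_le_lintegral _ _)
  refine le_trans (setLIntegral_mono' Metric.isOpen_ball.measurableSet fun v₂ hv₂ => ?_)
    (setLIntegral_le_lintegral _ _)
  rw [Set.indicator_of_mem]
  refine hU ?_
  rw [← ball_prod_same, ← ball_prod_same]
  exact ⟨hs, hv₁, hv₂⟩

section Local
variable {P : ℝ} [hP : Fact (0 < P)] {X : Set ProperLorentz} {ψ : L2Shell P}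
  {F : ProperLorentz → ℂ → L2Shell P}

theorem BoostExtension.continuousOn_nullRot (hF : BoostExtension X ψ F) (A : ProperLorentz)
    {S : Set (ℝ × ℝ × ℝ)}
    (hS : ∀ y ∈ S, y.1 ∈ Set.Ioo 0 Real.pi ∧ A * nullRotL y.2.1 y.2.2 ∈ X) :
    ContinuousOn (fun y : ℝ × ℝ × ℝ => F (A * nullRotL y.2.1 y.2.2) (Complex.I * y.1)) S := by
  have hn : Continuous fun y : ℝ × ℝ × ℝ => nullRotL y.2.1 y.2.2 :=
    continuous_nullRotL.comp continuous_snd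
  have hg : Continuous fun y : ℝ × ℝ × ℝ =>
      ((A * nullRotL y.2.1 y.2.2, Complex.I * (y.1 : ℂ)) : ProperLorentz × ℂ) :=
    (continuous_const.mul hn).prodMk (by fun_prop)
  refine hF.continuousOn.comp (f := fun y : ℝ × ℝ × ℝ =>
      ((A * nullRotL y.2.1 y.2.2, Complex.I * (y.1 : ℂ)) : ProperLorentz × ℂ))
      hg.continuousOn fun y hy => ⟨(hS y hy).2, ?_⟩
  have := (hS y hy).1
  simpa using ⟨this.1.le, this.2.le⟩

/-- Near a point with real transverse coordinates, the smoothed continuations are holomorphic and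
converge uniformly. -/
theorem exists_uniformCauchySeqOn_chartLaplace (hF : BoostExtension X ψ F) {A : ProperLorentz}
    (hA : A ∈ interior X) (t σ x₁ x₂ : ℝ) (hσ : σ ∈ Set.Ioo 0 Real.pi) :
    ∃ U : Set (ℂ × ℂ × ℂ), IsOpen U ∧ (t + Complex.I * σ, (x₁ : ℂ), (x₂ : ℂ)) ∈ U ∧
      (∀ z ∈ U, IsRegularParam P X A σ z) ∧
      UniformCauchySeqOn (fun n : ℕ => chartLaplace A σ (F A (Complex.I * σ)) (n + 1))
        Filter.atTop U := by
  have hAX : A ∈ X := interior_subset hA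
  have hσ' : σ ∈ Set.Icc 0 Real.pi := ⟨hσ.1.le, hσ.2.le⟩
  set z₀ : ℂ × ℂ × ℂ := (t + Complex.I * σ, (x₁ : ℂ), (x₂ : ℂ)) with hz₀
  -- For a compact set of angles and null parameters the vectors `F (A * nullRotL b₁ b₂) (i σ)` form
  -- a compact subset of `L²`, on which the oscillation tends to zero uniformly.
  obtain ⟨S, hSn, hSs, hSc⟩ : ∃ S ∈ nhds (σ, (0 : ℝ), (0 : ℝ)),
      (∀ y ∈ S, y.1 ∈ Set.Ioo 0 Real.pi ∧ A * nullRotL y.2.1 y.2.2 ∈ X) ∧ IsCompact S := by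
    have h1 : {y : ℝ × ℝ × ℝ | y.1 ∈ Set.Ioo 0 Real.pi ∧ A * nullRotL y.2.1 y.2.2 ∈ X} ∈
        nhds (σ, (0 : ℝ), (0 : ℝ)) := by
      have hn : Continuous fun y : ℝ × ℝ × ℝ => A * nullRotL y.2.1 y.2.2 :=
        continuous_const.mul (continuous_nullRotL.comp continuous_snd)
      refine Filter.inter_mem (continuous_fst.continuousAt.preimage_mem_nhds
        (Ioo_mem_nhds hσ.1 hσ.2)) (hn.continuousAt.preimage_mem_nhds ?_)
      rw [nullRotL_zero, mul_one]
      exact mem_interior_iff_mem_nhds.1 hA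
    obtain ⟨S, h2, h3, h4⟩ := local_compact_nhds h1
    exact ⟨S, h2, fun y hy => h3 hy, h4⟩
  have hSm : MeasurableSet S := hSc.isClosed.measurableSet
  have hre : ∀ᶠ z : ℂ × ℂ × ℂ in nhds z₀, t - 1 ≤ z.1.re := by
    have : ContinuousAt (fun z : ℂ × ℂ × ℂ => z.1.re) z₀ := by fun_prop
    refine this.eventually (le_mem_nhds ?_)
    simp [hz₀]
  obtain ⟨δ, hδ, hball⟩ := Metric.eventually_nhds_iff_ball.1
    ((eventually_isRegularParam (P := P) hA t σ x₁ x₂ hσ).and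
      ((eventually_nullParam_mem t σ x₁ x₂ hσ hSn).and hre))
  set B := Metric.ball z₀ δ with hB
  set G := F A (Complex.I * σ) with hG
  have hsub : Metric.ball z₀ (δ / 2) ⊆ B := Metric.ball_subset_ball (by linarith)
  refine ⟨Metric.ball z₀ (δ / 2), Metric.isOpen_ball, Metric.mem_ball_self (by positivity),
    fun z hz => (hball z (hsub hz)).1, ?_⟩
  set V := ENNReal.ofReal (Real.pi * (δ / 3) ^ 2 / 2) ^ 3 with hV
  have hV0 : V ≠ 0 := by
    have : 0 < Real.pi * (δ / 3) ^ 2 / 2 := by positivity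
    exact pow_ne_zero _ (ENNReal.ofReal_pos.2 this).ne'
  have hVt : V ≠ ⊤ := ENNReal.pow_ne_top ENNReal.ofReal_ne_top
  rw [Metric.uniformCauchySeqOn_iff]
  intro η hη
  have hC : ENNReal.ofReal (Real.exp (-(t - 1))) ^ 2 * (4 * volume S) ≠ ⊤ :=
    ENNReal.mul_ne_top (ENNReal.pow_ne_top ENNReal.ofReal_ne_top)
      (ENNReal.mul_ne_top (by norm_num) hSc.measure_lt_top.ne)
  have hη2 : 0 < V * ENNReal.ofReal (η / 2) ^ 2 :=
    ENNReal.mul_pos hV0 (pow_ne_zero _ (ENNReal.ofReal_pos.2 (by positivity)).ne')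
  obtain ⟨ε, hε0, hε⟩ := ENNReal.exists_pos_const_mul_sq_le hC hη2
  have hε2 : 0 < ε ^ 2 := pos_iff_ne_zero.2 (pow_ne_zero _ hε0.ne')
  have hev := eventually_meanOscillation_le (hSc.image_of_continuousOn
    (hF.continuousOn_nullRot A hSs)) hε2
  have hev' : ∀ᶠ n : ℕ in Filter.atTop, ∀ y ∈ S,
      meanOscillation P (n + 1) (F (A * nullRotL y.2.1 y.2.2) (Complex.I * y.1)) ≤ ε ^ 2 := by
    have hn : Filter.Tendsto (fun n : ℕ => (n : ℝ) + 1) Filter.atTop Filter.atTop :=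
      Filter.tendsto_atTop_add_const_right _ _ tendsto_natCast_atTop_atTop
    filter_upwards [hn.eventually hev] with n h y hy
    exact h _ (Set.mem_image_of_mem _ hy)
  obtain ⟨N, hN⟩ := Filter.eventually_atTop.1 hev'
  refine ⟨N, fun m hm n hn z hz => ?_⟩
  have hm0 : (0 : ℝ) < m + 1 := by positivity
  have hn0 : (0 : ℝ) < n + 1 := by positivity
  have hL2 := lintegral_chartLaplace_sub_sq_le hF hAX hσ' Metric.isOpen_ball
    (fun z hz => (hball z hz).1) hSm (fun z hz => (hball z hz).2.1) (fun z hz => (hball z hz).2.2)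
    hm0 hn0 (hN m hm) (hN n hn)
  have hzB : Metric.ball z (δ / 2) ⊆ B := Metric.ball_subset_ball' (by
    rw [Metric.mem_ball] at hz; linarith)
  have hd : DifferentiableOn ℂ (fun w : ℂ × ℂ × ℂ =>
      (chartLaplace A σ G (m + 1) w - chartLaplace A σ G (n + 1) w) ^ 2) (Metric.ball z (δ / 2)) := by
    have h1 := differentiableOn_chartLaplace (fun w hw => (hball w (hzB hw)).1) G hm0
    have h2 := differentiableOn_chartLaplace (fun w hw => (hball w (hzB hw)).1) G hn0
    exact (h1.sub h2).pow 2
  -- The mean value inequality for the holomorphic square of the difference converts the `L²` bound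
  -- into a pointwise one. The radius `δ/3 < δ/2` keeps the polydisc around `z` inside `B`.
  have hmean := enorm_mul_le_lintegral_polydisc (h := fun s v₁ v₂ =>
      (chartLaplace A σ G (m + 1) (s, v₁, v₂) - chartLaplace A σ G (n + 1) (s, v₁, v₂)) ^ 2)
    (z₁ := z.1) (z₂ := z.2.1) (z₃ := z.2.2) hd (r := δ / 3) (by positivity) (by linarith)
  simp only [enorm_pow] at hmean
  have hle := setLIntegral_polydisc_le (U := B) (z₁ := z.1) (z₂ := z.2.1) (z₃ := z.2.2) (r := δ / 3)
    ((Metric.ball_subset_ball (by linarith)).trans hzB)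
    (fun w => ‖chartLaplace A σ G (m + 1) w - chartLaplace A σ G (n + 1) w‖ₑ ^ 2)
  have hfin := (hmean.trans hle).trans hL2
  have hfin2 : V * ‖chartLaplace A σ G (m + 1) z - chartLaplace A σ G (n + 1) z‖ₑ ^ 2 ≤
      V * ENNReal.ofReal (η / 2) ^ 2 := by
    refine hfin.trans (le_trans (le_of_eq ?_) hε)
    ring
  have hfin3 := (ENNReal.mul_le_mul_iff_right hV0 hVt).1 hfin2
  have hfin4 := le_of_not_gt fun h => ((ENNReal.pow_lt_pow_left_iff two_ne_zero).2 h).not_ge hfin3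
  rw [dist_eq_norm]
  rw [← ofReal_norm, ENNReal.ofReal_le_ofReal_iff (by positivity)] at hfin4
  linarith

end Local

/-! ### Existence and uniqueness of the holomorphic function on `M⁺` -/

section Continuation
variable {P : ℝ} [hP : Fact (0 < P)]

/-- An everywhere existing limit of the smoothings of `G` agrees with `G` almost everywhere. -/
theorem ae_eq_of_tendsto_smoothing {G : L2Shell P} {v : (Fin 4 → ℝ) → ℂ}
    (h : ∀ p ∈ massShell P, Filter.Tendsto (fun n : ℕ => smoothing (n + 1) G p) Filter.atTop
      (nhds (v p))) : ∀ᵐ p ∂(massShellMeasure P), v p = G p := by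
  have hm : ∀ n : ℕ, Measurable (shellOscillation P (n + 1) G) :=
    fun n => measurable_shellOscillation _ G
  have hn : Filter.Tendsto (fun n : ℕ => (n : ℝ) + 1) Filter.atTop Filter.atTop :=
    Filter.tendsto_atTop_add_const_right _ _ tendsto_natCast_atTop_atTop
  have hlim : Filter.Tendsto (fun n : ℕ => ∫⁻ p, shellOscillation P (n + 1) G p
      ∂(massShellMeasure P)) Filter.atTop (nhds 0) :=
    (tendsto_meanOscillation_L2Shell G).comp hn
  -- By Fatou's lemma the lower limit of the oscillations has integral zero, hence vanishes almost
  -- everywhere; no subsequence is needed because the smoothings converge.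
  have h0 : ∫⁻ p, Filter.liminf (fun n : ℕ => shellOscillation P (n + 1) G p) Filter.atTop
      ∂(massShellMeasure P) = 0 := by
    refine le_antisymm ((lintegral_liminf_le hm).trans (le_of_eq hlim.liminf_eq)) zero_le
  have h1 := (lintegral_eq_zero_iff (Measurable.liminf hm)).1 h0
  filter_upwards [h1, ae_mem_massShell hP.out] with p hp hps
  have h2 : Filter.Tendsto (fun n : ℕ => ‖smoothing (n + 1) G p - G p‖ₑ ^ 2) Filter.atTop
      (nhds (‖v p - G p‖ₑ ^ 2)) :=
    ((ENNReal.continuous_pow 2).tendsto _).comp ((continuous_enorm.tendsto _).comp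
      ((h p hps).sub_const _))
  have h3 : ‖v p - G p‖ₑ ^ 2 ≤ 0 := by
    rw [← h2.liminf_eq]
    refine (Filter.liminf_le_liminf (Filter.Eventually.of_forall fun n => ?_)).trans (le_of_eq hp)
    exact enorm_smoothing_sub_sq_le (by positivity) G hps
  rw [nonpos_iff_eq_zero, sq_eq_zero_iff, enorm_eq_zero, sub_eq_zero] at h3
  exact h3

variable {K : PolyhedralRegion} {i : Fin K.n} {ψ : L2Shell P} {F : ProperLorentz → ℂ → L2Shell P}

/-- In the chart of one frame the smoothings converge to a holomorphic function. Any other frame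
that reaches the same complex point has, for each `n`, the same smoothing there by
`laplace_eq_of_zetaPoint`, hence the same limit. -/
theorem exists_local_continuation (hF : BoostExtension (K.X i) ψ F) {ζ₀ : Fin 4 → ℂ}
    (hζ₀ : ζ₀ ∈ Mplus P K i) :
    ∃ (O : Set (Fin 4 → ℂ)) (g : (Fin 4 → ℂ) → ℂ), IsOpen O ∧ ζ₀ ∈ O ∧ DifferentiableOn ℂ g O ∧
      ∀ A ∈ interior (K.X i), ∀ τ : ℂ, 0 < τ.im → τ.im < Real.pi → ∀ p ∈ massShell P,
        zetaPoint A τ p ∈ O → Filter.Tendsto (fun n : ℕ => smoothing (n + 1) (F A τ) p)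
          Filter.atTop (nhds (g (zetaPoint A τ p))) := by
  obtain ⟨A, hA, σ, t, x₁, x₂, h0, h1, rfl⟩ := (mem_Mplus_iff_exists_chart hP.out).1 hζ₀
  have hAX := interior_subset hA
  have hσ : σ ∈ Set.Icc 0 Real.pi := ⟨h0.le, h1.le⟩
  obtain ⟨U, hU, hzU, hreg, hcau⟩ :=
    exists_uniformCauchySeqOn_chartLaplace hF hA t σ x₁ x₂ ⟨h0, h1⟩
  set f : ℕ → ℂ × ℂ × ℂ → ℂ := fun n => chartLaplace A σ (F A (Complex.I * σ)) (n + 1) with hf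
  set g : ℂ × ℂ × ℂ → ℂ := fun z => Filter.atTop.limUnder fun n => f n z with hg
  have hlim : ∀ z ∈ U, Filter.Tendsto (fun n => f n z) Filter.atTop (nhds (g z)) :=
    fun z hz => (hcau.cauchySeq hz).tendsto_limUnder
  have hgd : DifferentiableOn ℂ g U := differentiableOn_of_uniformCauchySeqOn hU
    (fun n => differentiableOn_chartLaplace hreg _ (by positivity)) hcau hlim
  set s : ℂ := t + Complex.I * σ with hs
  set chart : (Fin 4 → ℂ) → ℂ × ℂ × ℂ := fun ζ => (chartS A s ζ, chartV₁ A ζ, chartV₂ A ζ) with hchart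
  set T := {ζ : Fin 4 → ℂ | (chartW A ζ ≠ 0 ∧ chartW A ζ * Complex.exp s ∈
    Complex.slitPlane) ∧ chart ζ ∈ U} with hT
  have hTmem : ∀ ζ, ζ ∈ T ↔ (chartW A ζ ≠ 0 ∧ chartW A ζ * Complex.exp s ∈
    Complex.slitPlane) ∧ chart ζ ∈ U := fun ζ => Iff.rfl
  clear_value T
  have hOmem : ∀ ζ ∈ interior T, (chartW A ζ ≠ 0 ∧ chartW A ζ * Complex.exp s ∈
    Complex.slitPlane) ∧ chart ζ ∈ U := fun ζ hζ => (hTmem ζ).1 (interior_subset hζ)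
  refine ⟨interior T, fun ζ => g (chart ζ), isOpen_interior, ?_, fun ζ hζ => ?_, ?_⟩
  · rw [zetaPoint_realPoint, mem_interior_iff_mem_nhds]
    filter_upwards [eventually_chart_slitPlane P A s x₁ x₂,
      (tendsto_chart P A s x₁ x₂).eventually (hU.mem_nhds hzU)] with ζ h2 h3
    exact (hTmem ζ).2 ⟨h2, h3⟩
  · obtain ⟨⟨_, h2⟩, h3⟩ := hOmem ζ hζ
    have hd : DifferentiableAt ℂ chart ζ := (differentiableAt_chartS A s h2).prodMk
      ((differentiable_chartV₁ A ζ).prodMk (differentiable_chartV₂ A ζ))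
    exact ((hgd.differentiableAt (hU.mem_nhds h3)).comp ζ hd).differentiableWithinAt
  · intro B hB τ h0' h1' p hp hζ
    obtain ⟨⟨h2, _⟩, h3⟩ := hOmem _ hζ
    have hr := hreg _ h3
    have hsin := (Real.sin_pos_of_pos_of_lt_pi hr.im_pos hr.im_lt).ne'
    have hcs := Mplus_subset P K i (zetaPoint_mem_Mplus hB h0' h1' hp)
    have e1 := chartPoint_chart A s h2 hcs
    have e2 := chartPoint_eq (P := P) A hsin (chart (zetaPoint B τ p)).2.1
      (chart (zetaPoint B τ p)).2.2
    rw [← zetaPoint_eq, show chartPoint P A (chart (zetaPoint B τ p)).1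
      (chart (zetaPoint B τ p)).2.1 (chart (zetaPoint B τ p)).2.2 = zetaPoint B τ p from e1] at e2
    refine (hlim _ h3).congr fun n => ?_
    have hc : (0 : ℝ) < n + 1 := by positivity
    simp only [hf]
    rw [hr.chartLaplace_eq hF hAX hσ hc, smoothing, smoothing,
      hF.laplace_eq_of_zetaPoint (interior_subset hB) hr.mem h0' h1' (by simpa using hr.im_pos)
        (by simpa using hr.im_lt) hp (realPoint_mem hP.out _ _ _ _) e2 hc]

/-- The smoothings of the continued orbits converge to a holomorphic function on `M⁺`. -/
theorem exists_continuation (hF : BoostExtension (K.X i) ψ F) :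
    ∃ u : Mplus P K i → ℂ, IsHolomorphicOnSubmanifold (Mplus P K i) u ∧
      ∀ A ∈ interior (K.X i), ∀ τ : ℂ, 0 < τ.im → τ.im < Real.pi →
        ∀ᵐ p ∂(massShellMeasure P), ∀ ζ : Mplus P K i, (ζ : Fin 4 → ℂ) = zetaPoint A τ p →
          u ζ = F A τ p := by
  choose O g hO hmem hg hlim using fun ζ : Mplus P K i => exists_local_continuation hF ζ.2
  refine ⟨fun ζ => g ζ ζ, fun ζ₀ => ⟨O ζ₀, g ζ₀, hO ζ₀, hmem ζ₀, hg ζ₀, fun ζ hζ => ?_⟩, ?_⟩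
  · obtain ⟨_, A, hA, τ, p, hp, h0, h1, h⟩ := ζ.2
    -- Two local functions agree at `ζ` because both values are the limit of the same sequence of
    -- smoothings.
    have l1 := hlim ζ A hA τ h0 h1 p hp (h ▸ hmem ζ)
    have l2 := hlim ζ₀ A hA τ h0 h1 p hp (h ▸ hζ)
    rw [← h] at l1 l2
    exact tendsto_nhds_unique l1 l2
  · intro A hA τ h0 h1
    classical
    -- The default value `0` does not occur on the mass shell, whose image lies in `M⁺`.
    have key := ae_eq_of_tendsto_smoothing (G := F A τ)
      (v := fun p => if h : zetaPoint A τ p ∈ Mplus P K i then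
        g ⟨zetaPoint A τ p, h⟩ (zetaPoint A τ p) else 0) fun p hp => by
        have h := zetaPoint_mem_Mplus (P := P) hA h0 h1 hp
        simp only [dif_pos h]
        exact hlim ⟨_, h⟩ A hA τ h0 h1 p hp (hmem ⟨_, h⟩)
    filter_upwards [key] with p hp ζ hζ
    obtain ⟨ζ, hM⟩ := ζ
    subst hζ
    simp only [dif_pos hM] at hp
    exact hp

end Continuation

theorem IsHolomorphicOnSubmanifold.continuous {n : ℕ} {M : Set (Fin n → ℂ)} {v : M → ℂ}
    (h : IsHolomorphicOnSubmanifold M v) : Continuous v := by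
  rw [continuous_iff_continuousAt]
  intro ζ
  obtain ⟨O, G, hO, hζ, hG, hv⟩ := h ζ
  have h1 : ContinuousAt (fun z : M => G z) ζ :=
    ContinuousAt.comp (g := G) (hG.continuousOn.continuousAt (hO.mem_nhds hζ))
      continuous_subtype_val.continuousAt
  refine h1.congr ?_
  filter_upwards [continuous_subtype_val.continuousAt.preimage_mem_nhds (hO.mem_nhds hζ)] with z hz
  exact (hv z hz).symm

theorem continuous_zetaPoint (A : ProperLorentz) (τ : ℂ) : Continuous (zetaPoint A τ) := by
  have : zetaPoint A τ = fun p => boostAt A (-τ) *ᵥ toC p := funext fun p => zetaPoint_eq A τ p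
  rw [this]
  refine Continuous.matrix_mulVec continuous_const ?_
  unfold toC; fun_prop

/-- A holomorphic function on `M⁺` is determined by the almost everywhere values of its
restrictions to the images of the mass shell. -/
theorem eq_of_ae_eq_zetaPoint {P : ℝ} (hP : 0 < P) {K : PolyhedralRegion} {i : Fin K.n}
    {u v : Mplus P K i → ℂ} (hu : IsHolomorphicOnSubmanifold (Mplus P K i) u)
    (hv : IsHolomorphicOnSubmanifold (Mplus P K i) v)
    (h : ∀ A ∈ interior (K.X i), ∀ τ : ℂ, 0 < τ.im → τ.im < Real.pi →
      ∀ᵐ p ∂(massShellMeasure P), ∀ ζ : Mplus P K i, (ζ : Fin 4 → ℂ) = zetaPoint A τ p →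
        u ζ = v ζ) : u = v := by
  classical
  funext ζ
  obtain ⟨_, A, hA, τ, p, hp, h0, h1, hζ⟩ := ζ.2
  have hmem : ∀ q : massShell P, zetaPoint A τ q ∈ Mplus P K i :=
    fun q => zetaPoint_mem_Mplus hA h0 h1 q.2
  have key : ∀ {w : Mplus P K i → ℂ}, IsHolomorphicOnSubmanifold (Mplus P K i) w →
      ContinuousOn (fun q => if h : zetaPoint A τ q ∈ Mplus P K i then w ⟨_, h⟩ else 0)
        (massShell P) := fun {w} hw => by
    rw [continuousOn_iff_continuous_domRestrict]
    have h2 : Continuous fun q : massShell P => w ⟨zetaPoint A τ q, hmem q⟩ :=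
      hw.continuous.comp (((continuous_zetaPoint A τ).comp continuous_subtype_val).subtype_mk hmem)
    convert h2 using 1
    funext q
    exact dif_pos (hmem q)
  have hae : ∀ᵐ q ∂(massShellMeasure P),
      (if h : zetaPoint A τ q ∈ Mplus P K i then u ⟨_, h⟩ else 0) =
        if h : zetaPoint A τ q ∈ Mplus P K i then v ⟨_, h⟩ else 0 := by
    filter_upwards [h A hA τ h0 h1] with q hq
    split_ifs with h3
    · exact hq _ rfl
    · rfl
  -- Both restrictions are continuous, so full support of the measure gives equality at every point
  -- of the mass shell, in particular at the `p` that produces `ζ`.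
  have h4 := eqOn_massShell_of_ae_eq hP (key hu) (key hv) hae hp
  have h5 := hmem ⟨p, hp⟩
  simp only [dif_pos h5] at h4
  obtain ⟨ζ, hM⟩ := ζ
  subst hζ
  exact h4

end

theorem mainTheorem7 (P : ℝ) (hP : 0 < P) (K : PolyhedralRegion) (i : Fin K.n) :
    Mplus P K i ⊆ complexMassShell P ∧
    IsOpen ((↑) ⁻¹' Mplus P K i : Set (complexMassShell P)) ∧
    Mplus P K i = complexMassShell P ∩ Tplus K i ∧
    IsComplexSubmanifold 3 (Mplus P K i) ∧
    ∀ φ ∈ HRplus P K, ∃ Ψ : ProperLorentz → ℂ → L2Shell P,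
      (∀ A ∈ K.X i, ∀ τ : ℂ, 0 ≤ τ.im → τ.im ≤ Real.pi → ∀ χ : L2Shell P,
        (φ, χ) ∈ complexGroupGraph (boostRep P (K.vertex i) A) τ ↔ χ = Ψ A τ) ∧
      ContinuousOn (fun x : ProperLorentz × ℂ => Ψ x.1 x.2)
        {x | x.1 ∈ K.X i ∧ 0 ≤ x.2.im ∧ x.2.im ≤ Real.pi} ∧
      ∃! u : Mplus P K i → ℂ,
        IsHolomorphicOnSubmanifold (Mplus P K i) u ∧
        ∀ A ∈ interior (K.X i), ∀ τ : ℂ, 0 < τ.im → τ.im < Real.pi →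
          ∀ᵐ p ∂(massShellMeasure P), ∀ ζ : Mplus P K i, (ζ : Fin 4 → ℂ) = zetaPoint A τ p →
            Ψ A τ p = Complex.exp (Complex.I * (mink p (K.vertex i) : ℝ)) * u ζ := by
  have : Fact (0 < P) := ⟨hP⟩
  refine ⟨Mplus_subset P K i, isOpen_Mplus hP K i, Mplus_eq hP K i,
    isComplexSubmanifold_Mplus hP K i, fun φ hφ => ?_⟩
  obtain ⟨F, hF, hgraph⟩ := exists_boostExtension hφ i
  obtain ⟨u, hu, huF⟩ := exists_continuation hF
  -- The vertex enters only through the phase, which has modulus one, is independent of the frame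
  -- and of `τ`, and cancels in the uniqueness argument.
  refine ⟨fun A τ => phase P (K.vertex i) (F A τ), hgraph,
    (phase P (K.vertex i)).continuous.comp_continuousOn hF.continuousOn, u, ⟨hu, ?_⟩, ?_⟩
  · intro A hA τ h0 h1
    filter_upwards [huF A hA τ h0 h1, phase_coeFn (K.vertex i) (F A τ)] with p h2 h3 ζ hζ
    rw [h3, h2 ζ hζ, phaseFactor]
  · rintro v ⟨hv, hvΨ⟩
    refine eq_of_ae_eq_zetaPoint hP hv hu fun A hA τ h0 h1 => ?_
    filter_upwards [huF A hA τ h0 h1, hvΨ A hA τ h0 h1, phase_coeFn (K.vertex i) (F A τ)]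
      with p h2 h3 h4 ζ hζ
    have h5 := h3 ζ hζ
    rw [h4, phaseFactor] at h5
    rw [h2 ζ hζ]
    exact (mul_left_cancel₀ (Complex.exp_ne_zero _) h5).symm
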